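/- Let $S^2\subset\mathbb R^3$ be the unit sphere. For a bounded open set $D\subset\mathbb C$ and a map $N:D\to S^2$ that is holomorphic (as a map to the Riemann sphere), a real number $\lambda$ is an eigenvalue of the problem $$\triangle\varphi+\tfrac12\lambda|\nabla N|^2\varphi=0\ \text{ in } D,\qquad \varphi=0\ \text{ on }\partial D,$$ if some nonzero $\varphi\in H^1_0(D)$ satisfies $\int_D\nabla\varphi\cdot\nabla v=\lambda\int_D\frac12|\nabla N|^2\varphi v$ for all $v\in C_c^\infty(D)$; the least eigenvalue, if it exists, is denoted $\lambda_{N,D}$. For an open set $\Omega\subset S^2$ whose closure is not all of $S^2$, $\lambda_\Omega:=\lambda_{P^{-1},P(\Omega)}$, where $P$ is stereographic projection from a point outside $\overline\Omega$. Let $\Delta\subset\mathbb C$ be a bounded open set (for instance one with piecewise $C^2$ boundary), and let $N:\overline\Delta\to S^2$ be continuous on $\overline\Delta$ and, on $\Delta$, holomorphic and not constant on any connected component. (1) Let $\Omega\subset S^2$ be a nonempty connected open set with $C^2$ boundary and $\overline\Omega\neq S^2$, and suppose $\Omega\subseteq N(\Delta)$ and $N(\partial\Delta)\cap\Omega=\emptyset$.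 Then $\lambda_{N,\Delta}$ exists, $\lambda_\Omega$ exists for every choice of the point of projection outside $\overline\Omega$, and $\lambda_{N,\Delta}\le\lambda_\Omega$. If moreover $N^{-1}(\partial\Omega)$ contains a point of $\Delta$, then $\lambda_{N,\Delta}<\lambda_\Omega$. (2) In particular, if $H\subset S^2$ is an open hemisphere with $H\subseteq N(\Delta)$ and $N(\partial\Delta)\cap H=\emptyset$, and $N^{-1}(\partial H)$ contains a point of $\Delta$ (for example, if $N(\Delta)\supseteq\overline H$), then $\lambda_{N,\Delta}$ exists and $\lambda_{N,\Delta}<2$. -/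

import Mathlib

open MeasureTheory Filter
open scoped Topology ContDiff

noncomputable section

namespace SphereEigen

/-- Euclidean 3-space. -/
abbrev E3 : Type := EuclideanSpace ℝ (Fin 3)

/-- The Riemann sphere, realised as the unit sphere of Euclidean 3-space. -/
abbrev S2 : Type := Metric.sphere (0 : E3) 1

/-- The north pole `(0, 0, 1)`. -/
def north : S2 :=
  ⟨!₂[0, 0, 1], by
    rw [mem_sphere_zero_iff_norm, EuclideanSpace.norm_eq, Fin.sum_univ_three]
    simp⟩

/-- The south pole `(0, 0, -1)`. -/
def south : S2 :=
  ⟨!₂[0, 0, -1], by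
    rw [mem_sphere_zero_iff_norm, EuclideanSpace.norm_eq, Fin.sum_univ_three]
    simp⟩

/-- Stereographic projection from the north pole, `x ↦ (x₁ + i x₂) / (1 - x₃)`
(meaningful away from the north pole). -/
def stereo (x : S2) : ℂ :=
  (((x : E3) 0 : ℂ) + ((x : E3) 1 : ℂ) * Complex.I) / (1 - ((x : E3) 2 : ℂ))

/-- The coordinate `1 / stereo` of the sphere around the north pole,
`x ↦ (x₁ - i x₂) / (1 + x₃)` (meaningful away from the south pole). -/
def stereoInv (x : S2) : ℂ :=
  (((x : E3) 0 : ℂ) - ((x : E3) 1 : ℂ) * Complex.I) / (1 + ((x : E3) 2 : ℂ))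

/-- The inverse of stereographic projection from the north pole,
`z ↦ (2 Re z, 2 Im z, |z|² - 1) / (1 + |z|²)`. -/
def invStereo (z : ℂ) : S2 :=
  ⟨!₂[2 * z.re / (1 + ‖z‖ ^ 2), 2 * z.im / (1 + ‖z‖ ^ 2), (‖z‖ ^ 2 - 1) / (1 + ‖z‖ ^ 2)], by
    rw [mem_sphere_zero_iff_norm, EuclideanSpace.norm_eq, Fin.sum_univ_three,
      Real.sqrt_eq_one]
    have h : ‖z‖ ^ 2 = z.re ^ 2 + z.im ^ 2 := by
      rw [Complex.sq_norm, Complex.normSq_apply]; ring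
    have h0 : (1 + (z.re ^ 2 + z.im ^ 2)) ≠ 0 := by positivity
    simp only [Real.norm_eq_abs, sq_abs, h]
    simp
    field_simp
    ring⟩

/-- The action of a linear isometry of Euclidean 3-space on the unit sphere. -/
def rot (R : E3 ≃ₗᵢ[ℝ] E3) (x : S2) : S2 :=
  ⟨R x, by
    rw [mem_sphere_zero_iff_norm, R.norm_map]
    exact mem_sphere_zero_iff_norm.mp x.2⟩

/-- `invStereoRot R` is the inverse of stereographic projection from the point `rot R north`. -/
def invStereoRot (R : E3 ≃ₗᵢ[ℝ] E3) (z : ℂ) : S2 := rot R (invStereo z)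

/-- `N` is a conformal map from the open set `D` to the sphere, apart from ramification points:
it is holomorphic as a map to the Riemann sphere (its stereographic projection is meromorphic)
and it is not constant on any connected component of `D`, which for holomorphic maps is the same
as not being constant near any point of `D`. -/
def IsConformalMap (N : ℂ → S2) (D : Set ℂ) : Prop :=
  ContinuousOn N D ∧
  (∀ z ∈ D, (N z ≠ north ∧ AnalyticAt ℂ (fun w => stereo (N w)) z) ∨
    (N z ≠ south ∧ AnalyticAt ℂ (fun w => stereoInv (N w)) z)) ∧
  ∀ z ∈ D, ¬ ∀ᶠ w in 𝓝 z, N w = N z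

/-- `|∇N|² = |∂N/∂x|² + |∂N/∂y|²`. -/
def gradSq (N : ℂ → S2) (z : ℂ) : ℝ :=
  ‖fderiv ℝ (fun w => (N w : E3)) z 1‖ ^ 2 + ‖fderiv ℝ (fun w => (N w : E3)) z Complex.I‖ ^ 2

/-- Test functions on the open set `D`: smooth with compact support contained in `D`. -/
def IsTest (D : Set ℂ) (v : ℂ → ℝ) : Prop :=
  ContDiff ℝ ∞ v ∧ HasCompactSupport v ∧ tsupport v ⊆ D

/-- `u` belongs to the Sobolev space `H¹₀(D)` and `G` is its weak gradient: both are square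
integrable on `D` and are the `L²` limits of a sequence of test functions and of their
gradients. -/
def MemH10 (D : Set ℂ) (u : ℂ → ℝ) (G : ℂ → ℂ) : Prop :=
  MemLp u 2 (volume.restrict D) ∧ MemLp G 2 (volume.restrict D) ∧
  ∃ f : ℕ → ℂ → ℝ, (∀ n, IsTest D (f n)) ∧
    Tendsto (fun n => eLpNorm (fun z => f n z - u z) 2 (volume.restrict D)) atTop (𝓝 0) ∧
    Tendsto (fun n => eLpNorm (fun z => gradient (f n) z - G z) 2 (volume.restrict D))
      atTop (𝓝 0)

/-- `l` is an eigenvalue of the Dirichlet problem `Δu + (1/2) l |∇N|² u = 0` in `D`, `u = 0` on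
`∂D`, in the weak sense: there is a nonzero `u ∈ H¹₀(D)` with
`∫_D ∇u · ∇v = l ∫_D (1/2) |∇N|² u v` for all test functions `v`. -/
def IsEigenvalue (N : ℂ → S2) (D : Set ℂ) (l : ℝ) : Prop :=
  ∃ (u : ℂ → ℝ) (G : ℂ → ℂ), MemH10 D u G ∧ ¬ (u =ᵐ[volume.restrict D] 0) ∧
    ∀ v : ℂ → ℝ, IsTest D v →
      ∫ z in D, inner ℝ (G z) (gradient v z) = l * ∫ z in D, (1 / 2) * gradSq N z * u z * v z

/-- `l` is the least eigenvalue `λ_{N,D}`. -/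
def IsLeastEigenvalue (N : ℂ → S2) (D : Set ℂ) (l : ℝ) : Prop :=
  IsLeast {m : ℝ | IsEigenvalue N D m} l

/-- `l` is the least eigenvalue `λ_Ω` of the region `Ω` of the sphere, computed with
stereographic projection from the point `rot R north`: it is `λ_{N,D}` for `N` the inverse of
that projection and `D` the projection of `Ω`. -/
def IsLeastEigenvalueSphere (R : E3 ≃ₗᵢ[ℝ] E3) (Ω : Set S2) (l : ℝ) : Prop :=
  IsLeastEigenvalue (invStereoRot R) (invStereoRot R ⁻¹' Ω) l

/-- The open subset `Ω` of the sphere has `C²` boundary: near each boundary point `p` it is the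
set where a `C²` function `ρ` is negative, and the derivative of `ρ` at `p` is nonzero in some
direction tangent to the sphere. -/
def HasC2Boundary (Ω : Set S2) : Prop :=
  ∀ p ∈ frontier Ω, ∃ ρ : E3 → ℝ, ContDiffAt ℝ 2 ρ p ∧
    (∃ v : E3, inner ℝ v (p : E3) = 0 ∧ fderiv ℝ ρ p v ≠ 0) ∧
    ∀ᶠ x : S2 in 𝓝 p, x ∈ Ω ↔ ρ x < 0

/-- The open hemisphere centred at `c`. -/
def hemisphere (c : S2) : Set S2 := {x | 0 < inner ℝ (c : E3) (x : E3)}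

end SphereEigen

end

/-!
Both eigenvalue problems are weighted Dirichlet problems `Δu + l w u = 0` whose weight is the area
density `w = |∇N|² / 2` of a conformal map. With `energy u = ∫ |∇u|²` and `mass w u = ∫ w u²`, the
least eigenvalue is the infimum of `energy / mass` over test functions. It exists because the form
`mass w` is compact relative to `energy` (`isCompactWeight_areaDensity`). For `N` this is
delicate only near `∂D`, where `w` may be unbounded. There the equation `-Δ⟨c, N⟩ = 2 w ⟨c, N⟩` is
tested with `φ²`: when `N` stays within `ε` of the point `c` on the support of `φ`, this bounds the
mass of `φ` by `4 ε²` times its energy (`mass_le_of_close`), and by uniform continuity of `N` small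
discs of a fixed size qualify. Rellich's theorem (`exists_L2_cauchy_subseq`) then turns
a minimizing sequence into an eigenfunction (`exists_eigenfunction_of_minimizing`).

For the comparison let `f` be the stereographic projection of `N`, defined on the part of `D` lying
over `Ω`. Since `N` maps `∂D` outside `Ω`, the map `f` is proper over the projection of `Ω`, and
a test function `ψ` there pulls back to the test function `ψ ∘ f`, extended by zero. As `f` is
conformal, both the energy and the mass of `ψ ∘ f` are integrals against the image of the measure
`|∇f|² / 2` under `f`. As its components are harmonic, the distributional derivatives of that image
measure vanish, so it is a multiple `c > 0` of the Lebesgue measure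
(`IsProperOver.exists_energy_mass_pullback`); the number `c` plays the role of the degree. Hence
Rayleigh quotients are preserved, and the least eigenvalue of `D` is at most that of `Ω`.

If the two were equal, the pullbacks of a minimizing sequence of nonnegative functions for `Ω` would
be minimizing on `D`. When `N` takes a value of `∂Ω` at a point of `D`, they can be supported in the
component `D₀` of that point, and, `N` being open and the boundary of `Ω` being regular, they all
vanish on some disc in `D₀` which `N` maps outside the closure of `Ω`. Their limit is a nonnegative
eigenfunction vanishing on that disc, which contradicts the strong maximum principle
(`ae_eq_zero_of_supersolution`).

For the hemisphere centred at `c`, the coordinate in the direction `c` is positive inside, vanishes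
on the boundary and solves the equation with eigenvalue `2`; its truncations show that the least
eigenvalue of the hemisphere is at most `2` (`le_two_of_rayleigh_hemisphere`), which suffices.
-/

namespace SphereEigen

/-! ### Partial derivatives and Green's identity in the plane -/

/-- The directional derivative of `F` in the direction `v`. -/
noncomputable def pd (v : ℂ) (F : ℂ → ℝ) (z : ℂ) : ℝ := fderiv ℝ F z v

/-- The pointwise product `∇F · ∇G` of gradients. -/
noncomputable def gradDot (F G : ℂ → ℝ) (z : ℂ) : ℝ :=
  pd 1 F z * pd 1 G z + pd Complex.I F z * pd Complex.I G z

/-- The Laplacian of a function of two real variables. -/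
noncomputable def lap (F : ℂ → ℝ) (z : ℂ) : ℝ :=
  pd 1 (pd 1 F) z + pd Complex.I (pd Complex.I F) z

section Calculus

variable {F G H : ℂ → ℝ} {z v : ℂ}

theorem pd_congr (h : F =ᶠ[𝓝 z] G) : pd v F z = pd v G z := by
  rw [pd, pd, h.fderiv_eq]

theorem pd_eventuallyEq (h : F =ᶠ[𝓝 z] G) : pd v F =ᶠ[𝓝 z] pd v G := by
  filter_upwards [h.eventuallyEq_nhds] with w hw using pd_congr hw

theorem gradDot_congr {F' G' : ℂ → ℝ} (h : F =ᶠ[𝓝 z] F') (h' : G =ᶠ[𝓝 z] G') :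
    gradDot F G z = gradDot F' G' z := by
  simp only [gradDot, pd_congr h, pd_congr h']

theorem lap_congr (h : F =ᶠ[𝓝 z] G) : lap F z = lap G z := by
  simp only [lap, pd_congr (pd_eventuallyEq h)]

theorem gradDot_self_nonneg (F : ℂ → ℝ) (z : ℂ) : 0 ≤ gradDot F F z :=
  add_nonneg (mul_self_nonneg _) (mul_self_nonneg _)

theorem gradDot_sq_le (F G : ℂ → ℝ) (z : ℂ) :
    gradDot F G z ^ 2 ≤ gradDot F F z * gradDot G G z := by
  simp only [gradDot]
  nlinarith [sq_nonneg (pd 1 F z * pd Complex.I G z - pd Complex.I F z * pd 1 G z)]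

theorem pd_add (hF : DifferentiableAt ℝ F z) (hG : DifferentiableAt ℝ G z) :
    pd v (fun w => F w + G w) z = pd v F z + pd v G z := by
  simp [pd, fderiv_fun_add hF hG]

theorem pd_sub (hF : DifferentiableAt ℝ F z) (hG : DifferentiableAt ℝ G z) :
    pd v (fun w => F w - G w) z = pd v F z - pd v G z := by
  simp [pd, fderiv_fun_sub hF hG]

theorem pd_mul (hF : DifferentiableAt ℝ F z) (hG : DifferentiableAt ℝ G z) :
    pd v (fun w => F w * G w) z = F z * pd v G z + G z * pd v F z := by
  simp [pd, fderiv_fun_mul hF hG]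

theorem pd_const (c : ℝ) : pd v (fun _ => c) z = 0 := by
  simp [pd]

theorem pd_const_mul (c : ℝ) (hF : DifferentiableAt ℝ F z) :
    pd v (fun w => c * F w) z = c * pd v F z := by
  simp [pd, fderiv_const_mul hF]

theorem pd_const_mul_fun (c : ℝ) (hF : ∀ᶠ w in 𝓝 z, DifferentiableAt ℝ F w) :
    pd v (fun w => c * F w) =ᶠ[𝓝 z] fun w => c * pd v F w := by
  filter_upwards [hF] with w hw using pd_const_mul c hw

theorem pd_comp_real {g : ℝ → ℝ} {g' : ℝ} (hg : HasDerivAt g g' (F z))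
    (hF : DifferentiableAt ℝ F z) : pd v (fun w => g (F w)) z = g' * pd v F z := by
  have := (hg.comp_hasFDerivAt z hF.hasFDerivAt).fderiv
  simp only [pd]
  rw [show (fun w => g (F w)) = g ∘ F from rfl, this]
  simp

theorem _root_.ContDiffAt.pd {n m : WithTop ℕ∞} (hF : ContDiffAt ℝ n F z) (h : m + 1 ≤ n) :
    ContDiffAt ℝ m (pd v F) z := by
  have := hF.fderiv_right h
  exact this.clm_apply contDiffAt_const

theorem _root_.ContDiff.pd (hF : ContDiff ℝ ∞ F) (v : ℂ) : ContDiff ℝ ∞ (pd v F) :=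
  contDiff_iff_contDiffAt.2 fun _ => hF.contDiffAt.pd (by simp)

theorem eventually_differentiableAt (hF : ContDiffAt ℝ 2 F z) :
    ∀ᶠ w in 𝓝 z, DifferentiableAt ℝ F w := by
  filter_upwards [hF.eventually (by simp)] with w hw using hw.differentiableAt (by simp)

theorem differentiableAt_pd (hF : ContDiffAt ℝ 2 F z) : DifferentiableAt ℝ (pd v F) z :=
  (hF.pd (m := 1) (by norm_num [one_add_one_eq_two])).differentiableAt (by simp)

theorem continuousAt_pd (hF : ContDiffAt ℝ 2 F z) : ContinuousAt (pd v F) z :=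
  (differentiableAt_pd hF).continuousAt

theorem continuousAt_lap (hF : ContDiffAt ℝ 2 F z) : ContinuousAt (lap F) z := by
  have h (v : ℂ) : ContDiffAt ℝ 0 (pd v (pd v F)) z :=
    (hF.pd (m := 1) (by norm_num [one_add_one_eq_two])).pd (by simp)
  exact (h 1).continuousAt.add (h _).continuousAt

theorem pd_pd_mul (hF : ContDiffAt ℝ 2 F z) (hG : ContDiffAt ℝ 2 G z) :
    pd v (pd v (fun w => F w * G w)) z =
      F z * pd v (pd v G) z + 2 * (pd v F z * pd v G z) + G z * pd v (pd v F) z := by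
  have h : pd v (fun w => F w * G w) =ᶠ[𝓝 z] fun w => F w * pd v G w + G w * pd v F w := by
    filter_upwards [eventually_differentiableAt hF, eventually_differentiableAt hG] with w h1 h2
    exact pd_mul h1 h2
  have dF := hF.differentiableAt (by simp)
  have dG := hG.differentiableAt (by simp)
  have dF' : DifferentiableAt ℝ (pd v F) z := differentiableAt_pd hF
  have dG' : DifferentiableAt ℝ (pd v G) z := differentiableAt_pd hG
  rw [pd_congr h, pd_add (dF.fun_mul dG') (dG.fun_mul dF'), pd_mul dF dG', pd_mul dG dF']
  ring

theorem lap_mul (hF : ContDiffAt ℝ 2 F z) (hG : ContDiffAt ℝ 2 G z) :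
    lap (fun w => F w * G w) z = F z * lap G z + 2 * gradDot F G z + G z * lap F z := by
  simp only [lap, gradDot, pd_pd_mul hF hG]
  ring

theorem lap_add (hF : ContDiffAt ℝ 2 F z) (hG : ContDiffAt ℝ 2 G z) :
    lap (fun w => F w + G w) z = lap F z + lap G z := by
  have h (v : ℂ) : pd v (fun w => F w + G w) =ᶠ[𝓝 z] fun w => pd v F w + pd v G w := by
    filter_upwards [eventually_differentiableAt hF, eventually_differentiableAt hG] with w h1 h2
    exact pd_add h1 h2
  simp only [lap, pd_congr (h _), pd_add (differentiableAt_pd hF) (differentiableAt_pd hG)]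
  ring

theorem lap_const (c : ℝ) : lap (fun _ => c) z = 0 := by
  have h (v : ℂ) : pd v (fun _ : ℂ => c) = fun _ => 0 := funext fun _ => pd_const c
  simp [lap, h, pd_const]

theorem lap_const_mul (c : ℝ) (hF : ContDiffAt ℝ 2 F z) :
    lap (fun w => c * F w) z = c * lap F z := by
  simp only [lap, pd_congr (pd_const_mul_fun c (eventually_differentiableAt hF)),
    pd_const_mul c (differentiableAt_pd hF)]
  ring

theorem gradient_eq_mk (F : ℂ → ℝ) (z : ℂ) : gradient F z = ⟨pd 1 F z, pd Complex.I F z⟩ := by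
  have h (y : ℂ) : inner ℝ (gradient F z) y = fderiv ℝ F z y := by
    rw [gradient, InnerProductSpace.toDual_symm_apply]
  have h1 := h 1
  have h2 := h Complex.I
  simp only [Complex.inner, Complex.mul_re, Complex.conj_re, Complex.conj_im, Complex.one_re,
    Complex.one_im, Complex.I_re, Complex.I_im] at h1 h2
  apply Complex.ext
  · simp only [pd]; rw [← h1]; ring
  · simp only [pd]; rw [← h2]; ring

theorem inner_gradient (F G : ℂ → ℝ) (z : ℂ) :
    inner ℝ (gradient F z) (gradient G z) = gradDot F G z := by
  simp only [gradient_eq_mk, Complex.inner, gradDot, Complex.mul_re, Complex.conj_re,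
    Complex.conj_im]
  ring

theorem norm_gradient_sq (F : ℂ → ℝ) (z : ℂ) : ‖gradient F z‖ ^ 2 = gradDot F F z := by
  rw [← inner_gradient, real_inner_self_eq_norm_sq]

theorem gradient_sub' (hF : DifferentiableAt ℝ F z) (hG : DifferentiableAt ℝ G z) :
    gradient (fun w => F w - G w) z = gradient F z - gradient G z := by
  simp only [gradient_eq_mk, pd_sub hF hG]
  rfl

theorem pd_comp_complex {a b : ℂ → ℝ} (ψ : ℂ → ℝ) (ha : DifferentiableAt ℝ a z)
    (hb : DifferentiableAt ℝ b z) (hψ : DifferentiableAt ℝ ψ ⟨a z, b z⟩) :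
    pd v (fun w => ψ ⟨a w, b w⟩) z =
      pd 1 ψ ⟨a z, b z⟩ * pd v a z + pd Complex.I ψ ⟨a z, b z⟩ * pd v b z := by
  have h1 : HasFDerivAt (fun w => (⟨a w, b w⟩ : ℂ))
      (Complex.equivRealProdCLM.symm.toContinuousLinearMap.comp
        ((fderiv ℝ a z).prod (fderiv ℝ b z))) z :=
    (Complex.equivRealProdCLM.symm.toContinuousLinearMap.hasFDerivAt).comp z
      (ha.hasFDerivAt.prodMk hb.hasFDerivAt)
  have h2 := (hψ.hasFDerivAt.comp z h1).fderiv
  simp only [pd]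
  rw [show (fun w => ψ ⟨a w, b w⟩) = ψ ∘ fun w => (⟨a w, b w⟩ : ℂ) from rfl, h2]
  simp only [ContinuousLinearMap.comp_apply]
  have h3 : (Complex.equivRealProdCLM.symm.toContinuousLinearMap
      (((fderiv ℝ a z).prod (fderiv ℝ b z)) v) : ℂ)
      = (fderiv ℝ a z v) • (1 : ℂ) + (fderiv ℝ b z v) • Complex.I := by
    apply Complex.ext <;> simp
  rw [h3, map_add, map_smul, map_smul, smul_eq_mul, smul_eq_mul]
  ring

end Calculus

section Parts

theorem continuous_mul_of_tsupport {u h : ℂ → ℝ} (hu : Continuous u)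
    (hh : ∀ z ∈ tsupport u, ContinuousAt h z) : Continuous fun z => u z * h z := by
  rw [continuous_iff_continuousAt]
  intro z
  by_cases hz : z ∈ tsupport u
  · exact hu.continuousAt.mul (hh z hz)
  · have : (fun z => u z * h z) =ᶠ[𝓝 z] fun _ => 0 := by
      filter_upwards [(isClosed_tsupport u).isOpen_compl.mem_nhds hz] with w hw
      rw [image_eq_zero_of_notMem_tsupport hw, zero_mul]
    exact continuousAt_const.congr this.symm

theorem integrable_mul_of_tsupport {u h : ℂ → ℝ} (hu : Continuous u) (hc : HasCompactSupport u)
    (hh : ∀ z ∈ tsupport u, ContinuousAt h z) : Integrable fun z => u z * h z :=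
  (continuous_mul_of_tsupport hu hh).integrable_of_hasCompactSupport hc.mul_right

theorem tsupport_pd_subset (v : ℂ) (u : ℂ → ℝ) : tsupport (pd v u) ⊆ tsupport u :=
  tsupport_fderiv_apply_subset ℝ v

theorem hasCompactSupport_pd {u : ℂ → ℝ} (hu : HasCompactSupport u) (v : ℂ) :
    HasCompactSupport (pd v u) :=
  hu.fderiv_apply ℝ v

/-- Green's formula; the function `F` has to be regular only on the support of `u`. -/
theorem integral_gradDot_eq_neg_integral_mul_lap {u F : ℂ → ℝ} (hu : ContDiff ℝ ∞ u)
    (hc : HasCompactSupport u) (hF : ∀ z ∈ tsupport u, ContDiffAt ℝ 2 F z) :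
    ∫ z, gradDot u F z = -∫ z, u z * lap F z := by
  have hpp (v : ℂ) {z : ℂ} (hz : z ∈ tsupport u) : ContinuousAt (pd v (pd v F)) z := by
    have : ContDiffAt ℝ 0 (pd v (pd v F)) z :=
      ((hF z hz).pd (m := 1) (by norm_num [one_add_one_eq_two])).pd (by simp)
    exact this.continuousAt
  have i1 (v : ℂ) : Integrable fun z => pd v u z * pd v F z :=
    integrable_mul_of_tsupport (hu.pd v).continuous (hasCompactSupport_pd hc v)
      fun z hz => continuousAt_pd (hF z (tsupport_pd_subset v u hz))
  have i2 (v : ℂ) : Integrable fun z => u z * pd v (pd v F) z :=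
    integrable_mul_of_tsupport hu.continuous hc fun z hz => hpp v hz
  have i3 (v : ℂ) : Integrable fun z => u z * pd v F z :=
    integrable_mul_of_tsupport hu.continuous hc fun z hz => continuousAt_pd (hF z hz)
  have key (v : ℂ) : ∫ z, u z * pd v (pd v F) z = -∫ z, pd v u z * pd v F z :=
    integral_mul_fderiv_eq_neg_fderiv_mul_of_integrable (i1 v) (i2 v) (i3 v)
      (fun z _ => hu.differentiable (by simp) z) (fun z hz => differentiableAt_pd (hF z hz))
  simp only [gradDot, lap, mul_add]
  rw [integral_add (i1 _) (i1 _), integral_add (i2 _) (i2 _), key, key]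
  ring

end Parts

/-! ### Test functions and the Poincaré inequality -/

section TestFunctions

variable {D : Set ℂ} {u v : ℂ → ℝ}

theorem IsTest.continuous (hu : IsTest D u) : Continuous u := hu.1.continuous

theorem IsTest.differentiableAt (hu : IsTest D u) (z : ℂ) : DifferentiableAt ℝ u z :=
  hu.1.differentiable (by simp) z

theorem IsTest.contDiffAt (hu : IsTest D u) (z : ℂ) : ContDiffAt ℝ 2 u z :=
  (hu.1.of_le (by norm_cast)).contDiffAt

theorem IsTest.eq_zero (hu : IsTest D u) {z : ℂ} (hz : z ∉ D) : u z = 0 :=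
  image_eq_zero_of_notMem_tsupport fun h => hz (hu.2.2 h)

theorem IsTest.isTest_pd (hu : IsTest D u) (a : ℂ) : IsTest D (pd a u) :=
  ⟨hu.1.pd a, hasCompactSupport_pd hu.2.1 a, (tsupport_pd_subset a u).trans hu.2.2⟩

theorem IsTest.mono {D' : Set ℂ} (hu : IsTest D u) (h : D ⊆ D') : IsTest D' u :=
  ⟨hu.1, hu.2.1, hu.2.2.trans h⟩

theorem IsTest.add (hu : IsTest D u) (hv : IsTest D v) : IsTest D fun z => u z + v z :=
  ⟨hu.1.add hv.1, hu.2.1.add hv.2.1,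
    (tsupport_add u v).trans (Set.union_subset hu.2.2 hv.2.2)⟩

theorem IsTest.mul_left {F : ℂ → ℝ} (hu : IsTest D u) (hF : ContDiff ℝ ∞ F) :
    IsTest D fun z => F z * u z :=
  ⟨hF.mul hu.1, hu.2.1.mul_left, (tsupport_mul_subset_right).trans hu.2.2⟩

theorem IsTest.const_mul (hu : IsTest D u) (c : ℝ) : IsTest D fun z => c * u z :=
  hu.mul_left contDiff_const

theorem IsTest.sub (hu : IsTest D u) (hv : IsTest D v) : IsTest D fun z => u z - v z := by
  simpa [sub_eq_add_neg] using hu.add (hv.const_mul (-1))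

theorem IsTest.mul (hu : IsTest D u) (hv : IsTest D v) : IsTest D fun z => u z * v z :=
  hv.mul_left hu.1

theorem IsTest.isTest_gradDot (hu : IsTest D u) (hv : IsTest D v) : IsTest D (gradDot u v) :=
  ((hu.isTest_pd 1).mul (hv.isTest_pd 1)).add ((hu.isTest_pd Complex.I).mul (hv.isTest_pd Complex.I))

theorem IsTest.integrable (hu : IsTest D u) : Integrable u :=
  hu.continuous.integrable_of_hasCompactSupport hu.2.1

theorem IsTest.memLp (hu : IsTest D u) : MemLp u 2 :=
  hu.continuous.memLp_of_hasCompactSupport hu.2.1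

theorem IsTest.comp_zero (hu : IsTest D u) {g : ℝ → ℝ} (hg : ContDiff ℝ ∞ g) (h0 : g 0 = 0) :
    IsTest D fun z => g (u z) :=
  ⟨hg.comp hu.1, hu.2.1.comp_left h0,
    (closure_mono (Function.support_comp_subset h0 u)).trans hu.2.2⟩

theorem IsTest.setIntegral_eq (hu : IsTest D u) {h : ℂ → ℝ} :
    ∫ z in D, h z * u z = ∫ z, h z * u z :=
  setIntegral_eq_integral_of_forall_compl_eq_zero fun z hz => by rw [hu.eq_zero hz, mul_zero]

theorem IsTest.gradient_eq_zero (hu : IsTest D u) {z : ℂ} (hz : z ∉ D) : gradient u z = 0 := by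
  rw [gradient_eq_mk, (hu.isTest_pd 1).eq_zero hz, (hu.isTest_pd Complex.I).eq_zero hz]; rfl

theorem IsTest.continuous_gradient (hu : IsTest D u) : Continuous (gradient u) := by
  have : gradient u = fun z => ((pd 1 u z : ℝ) : ℂ) + (pd Complex.I u z : ℝ) * Complex.I := by
    funext z
    rw [gradient_eq_mk, Complex.mk_eq_add_mul_I]
  rw [this]
  exact (Complex.continuous_ofReal.comp (hu.isTest_pd 1).continuous).add
    ((Complex.continuous_ofReal.comp (hu.isTest_pd Complex.I).continuous).mul continuous_const)

theorem IsTest.hasCompactSupport_gradient (hu : IsTest D u) : HasCompactSupport (gradient u) := by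
  refine hu.2.1.of_isClosed_subset (isClosed_tsupport _) (closure_minimal ?_ (isClosed_tsupport _))
  intro z hz
  by_contra h
  exact hz (IsTest.gradient_eq_zero (D := tsupport u) ⟨hu.1, hu.2.1, subset_rfl⟩ h)

theorem IsTest.memLp_gradient (hu : IsTest D u) : MemLp (gradient u) 2 :=
  hu.continuous_gradient.memLp_of_hasCompactSupport hu.hasCompactSupport_gradient

theorem gradDot_add_self (hu : IsTest D u) (hv : IsTest D v) (s : ℝ) (z : ℂ) :
    gradDot (fun z => u z + s * v z) (fun z => u z + s * v z) z =
      gradDot u u z + 2 * s * gradDot u v z + s ^ 2 * gradDot v v z := by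
  simp only [gradDot,
    pd_add (hu.differentiableAt z) ((hv.const_mul s).differentiableAt z),
    pd_const_mul s (hv.differentiableAt z)]
  ring

theorem gradDot_const_mul_self (hu : IsTest D u) (s : ℝ) (z : ℂ) :
    gradDot (fun z => s * u z) (fun z => s * u z) z = s ^ 2 * gradDot u u z := by
  simp only [gradDot, pd_const_mul s (hu.differentiableAt z)]
  ring

end TestFunctions

section Translation

variable {D : Set ℂ} {u : ℂ → ℝ}

/-- Jensen's inequality for the square. -/
theorem sq_integral_le_integral_sq {f : ℝ → ℝ} (hf : Continuous f) :
    (∫ t in (0:ℝ)..1, f t) ^ 2 ≤ ∫ t in (0:ℝ)..1, f t ^ 2 := by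
  set m := ∫ t in (0:ℝ)..1, f t with hm
  have h : 0 ≤ ∫ t in (0:ℝ)..1, (f t - m) ^ 2 :=
    intervalIntegral.integral_nonneg zero_le_one fun t _ => sq_nonneg _
  have h2 : ∫ t in (0:ℝ)..1, (f t - m) ^ 2 = (∫ t in (0:ℝ)..1, f t ^ 2) - m ^ 2 := by
    have : ∀ t, (f t - m) ^ 2 = f t ^ 2 - 2 * m * f t + m ^ 2 := fun t => by ring
    simp only [this]
    rw [intervalIntegral.integral_add, intervalIntegral.integral_sub,
      intervalIntegral.integral_const_mul, ← hm]
    · simp; ring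
    all_goals exact Continuous.intervalIntegrable (by fun_prop) _ _
  linarith

theorem IsTest.sub_translate_sq_le (hu : IsTest D u) (x y : ℂ) :
    (u x - u (x - y)) ^ 2 ≤ ‖y‖ ^ 2 * ∫ t in (0:ℝ)..1, gradDot u u (x - t * y) := by
  have hder (t : ℝ) : HasDerivAt (fun t : ℝ => u (x - t * y))
      (-(fderiv ℝ u (x - t * y) y)) t := by
    have h1 : HasDerivAt (fun t : ℝ => x - (t : ℂ) * y) (-y) t := by
      simpa using ((Complex.ofRealCLM.hasDerivAt (x := t)).mul_const y).const_sub x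
    have := (hu.differentiableAt (x - t * y)).hasFDerivAt.comp_hasDerivAt t h1
    simpa [Function.comp_def] using this
  have hcont : Continuous fun t : ℝ => fderiv ℝ u (x - t * y) y :=
    ((hu.isTest_pd y).continuous).comp (by fun_prop)
  have hcg : Continuous fun t : ℝ => gradDot u u (x - t * y) :=
    ((hu.isTest_gradDot hu).continuous).comp (by fun_prop)
  have h1 : u x - u (x - y) = ∫ t in (0:ℝ)..1, fderiv ℝ u (x - t * y) y := by
    have := intervalIntegral.integral_eq_sub_of_hasDerivAt (a := 0) (b := 1)
      (fun t _ => hder t) (hcont.neg.intervalIntegrable _ _)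
    rw [intervalIntegral.integral_neg] at this
    simp at this
    linarith
  rw [h1, ← intervalIntegral.integral_const_mul]
  refine (sq_integral_le_integral_sq hcont).trans ?_
  refine intervalIntegral.integral_mono_on zero_le_one
    (Continuous.intervalIntegrable (by fun_prop) _ _)
    (Continuous.intervalIntegrable (by fun_prop) _ _) fun t _ => ?_
  have e : fderiv ℝ u (x - t * y) y = y.re * pd 1 u (x - t * y)
      + y.im * pd Complex.I u (x - t * y) := by
    conv_lhs => rw [show y = y.re • (1:ℂ) + y.im • Complex.I by apply Complex.ext <;> simp]
    rw [map_add, map_smul, map_smul]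
    simp [pd]
  have hn : ‖y‖ ^ 2 = y.re ^ 2 + y.im ^ 2 := by
    rw [Complex.sq_norm, Complex.normSq_apply]; ring
  rw [e, hn]
  simp only [gradDot]
  nlinarith [sq_nonneg (y.re * pd Complex.I u (x - t * y) -
    y.im * pd 1 u (x - t * y))]

/-- The `L²` modulus of continuity of a test function is controlled by its Dirichlet integral. -/
theorem IsTest.integral_sub_translate_sq_le (hu : IsTest D u) (y : ℂ) :
    ∫ x, (u x - u (x - y)) ^ 2 ≤ ‖y‖ ^ 2 * ∫ x, gradDot u u x := by
  have hg := hu.isTest_gradDot hu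
  have hc : Continuous (gradDot u u) := hg.continuous
  have huc := hu.continuous
  have hL : ∫⁻ x, ENNReal.ofReal ((u x - u (x - y)) ^ 2) ≤
      ENNReal.ofReal (‖y‖ ^ 2) * ∫⁻ x, ENNReal.ofReal (gradDot u u x) := by
    calc ∫⁻ x, ENNReal.ofReal ((u x - u (x - y)) ^ 2)
        ≤ ∫⁻ x, ENNReal.ofReal (‖y‖ ^ 2) *
            ∫⁻ t in Set.Ioc (0:ℝ) 1, ENNReal.ofReal (gradDot u u (x - t * y)) := by
          refine lintegral_mono fun x => ?_
          refine (ENNReal.ofReal_le_ofReal (hu.sub_translate_sq_le x y)).trans ?_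
          rw [ENNReal.ofReal_mul (by positivity), intervalIntegral.integral_of_le zero_le_one,
            ofReal_integral_eq_lintegral_ofReal]
          · exact (Continuous.integrableOn_Icc (by fun_prop)).mono_set Set.Ioc_subset_Icc_self
          · exact Eventually.of_forall fun t => gradDot_self_nonneg _ _
      _ = ENNReal.ofReal (‖y‖ ^ 2) * ∫⁻ t in Set.Ioc (0:ℝ) 1,
            ∫⁻ x, ENNReal.ofReal (gradDot u u (x - t * y)) := by
          rw [lintegral_const_mul' _ _ ENNReal.ofReal_ne_top, lintegral_lintegral_swap]
          refine (Continuous.measurable ?_).aemeasurable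
          exact ENNReal.continuous_ofReal.comp (hc.comp (by fun_prop))
      _ = _ := by
          congr 1
          have (t : ℝ) : ∫⁻ x, ENNReal.ofReal (gradDot u u (x - t * y)) =
              ∫⁻ x, ENNReal.ofReal (gradDot u u x) :=
            lintegral_sub_right_eq_self (fun x => ENNReal.ofReal (gradDot u u x)) _
          simp [this]
  have hi : Integrable fun x => (u x - u (x - y)) ^ 2 := by
    have h1 : HasCompactSupport fun x => u (x - y) :=
      hu.2.1.comp_homeomorph (Homeomorph.subRight y)
    have h2 : HasCompactSupport fun x => u x - u (x - y) := hu.2.1.sub h1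
    have h3 : HasCompactSupport fun x => (u x - u (x - y)) ^ 2 := by
      simp only [pow_two]
      exact h2.mul_right (f' := fun x => u x - u (x - y))
    exact Continuous.integrable_of_hasCompactSupport (by fun_prop) h3
  rw [← ofReal_integral_eq_lintegral_ofReal hi (Eventually.of_forall fun _ => sq_nonneg _),
    ← ofReal_integral_eq_lintegral_ofReal hg.integrable
      (Eventually.of_forall fun _ => gradDot_self_nonneg _ _),
    ← ENNReal.ofReal_mul (by positivity)] at hL
  exact (ENNReal.ofReal_le_ofReal_iff (mul_nonneg (by positivity)
    (integral_nonneg fun _ => gradDot_self_nonneg _ _))).1 hL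

/-- Poincaré's inequality: a translate of a test function by more than the diameter of the region
has disjoint support. -/
theorem exists_poincare (hD : Bornology.IsBounded D) :
    ∃ P : ℝ, 0 < P ∧ ∀ u, IsTest D u → ∫ x, u x ^ 2 ≤ P * ∫ x, gradDot u u x := by
  obtain ⟨R, hR0, hR⟩ := hD.subset_ball_lt 0 0
  refine ⟨(2 * R) ^ 2, by positivity, fun u hu => ?_⟩
  have h := hu.integral_sub_translate_sq_le ((2 * R : ℝ) : ℂ)
  have huc := hu.continuous
  have e (x : ℂ) : (u x - u (x - (2 * R : ℝ))) ^ 2 = u x ^ 2 + u (x - (2 * R : ℝ)) ^ 2 := by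
    have : u x = 0 ∨ u (x - (2 * R : ℝ)) = 0 := by
      by_contra! hne
      have h1 : x ∈ D := by by_contra hx; exact hne.1 (hu.eq_zero hx)
      have h2 : x - (2 * R : ℝ) ∈ D := by by_contra hx; exact hne.2 (hu.eq_zero hx)
      have h1' := hR h1
      have h2' := hR h2
      rw [mem_ball_zero_iff] at h1' h2'
      have h3 : ‖((2 * R : ℝ) : ℂ)‖ ≤ ‖x‖ + ‖x - (2 * R : ℝ)‖ := by
        simpa using norm_sub_le x (x - (2 * R : ℝ))
      rw [Complex.norm_real, Real.norm_of_nonneg (by positivity)] at h3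
      linarith
    rcases this with h | h <;> rw [h] <;> ring
  have hi : Integrable fun x => u x ^ 2 := by simpa [pow_two] using (hu.mul hu).integrable
  have hi2 : Integrable fun x => u (x - (2 * R : ℝ)) ^ 2 := hi.comp_sub_right _
  simp only [e] at h
  rw [integral_add hi hi2, integral_sub_right_eq_self (fun x => u x ^ 2), Complex.norm_real,
    Real.norm_of_nonneg (by positivity)] at h
  have : 0 ≤ ∫ x, u x ^ 2 := integral_nonneg fun _ => sq_nonneg _
  linarith

end Translation

/-! ### Rellich compactness -/

section Rellich

theorem inner_toLp {α E : Type*} [MeasurableSpace α] {μ : Measure α} [NormedAddCommGroup E]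
    [InnerProductSpace ℝ E] {f g : α → E} (hf : MemLp f 2 μ) (hg : MemLp g 2 μ) :
    inner ℝ (hf.toLp f) (hg.toLp g) = ∫ x, inner ℝ (f x) (g x) ∂μ := by
  rw [L2.inner_def]
  refine integral_congr_ae ?_
  filter_upwards [hf.coeFn_toLp, hg.coeFn_toLp] with x h1 h2
  rw [h1, h2]

theorem norm_toLp_sq {α E : Type*} [MeasurableSpace α] {μ : Measure α} [NormedAddCommGroup E]
    [InnerProductSpace ℝ E] {f : α → E} (hf : MemLp f 2 μ) :
    ‖hf.toLp f‖ ^ 2 = ∫ x, ‖f x‖ ^ 2 ∂μ := by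
  rw [← real_inner_self_eq_norm_sq, inner_toLp]
  simp only [real_inner_self_eq_norm_sq]

/-- Bounded sequences in a separable Hilbert space have weakly convergent subsequences. -/
theorem exists_weakly_convergent_subseq {H : Type*} [NormedAddCommGroup H]
    [InnerProductSpace ℝ H] [CompleteSpace H] [TopologicalSpace.SeparableSpace H] {x : ℕ → H}
    {M : ℝ} (hx : ∀ k, ‖x k‖ ≤ M) :
    ∃ φ : ℕ → ℕ, StrictMono φ ∧ ∃ a : H, ∀ h : H,
      Tendsto (fun k => inner ℝ (x (φ k)) h) atTop (𝓝 (inner ℝ a h)) := by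
  let T : ℕ → WeakDual ℝ H := fun k => StrongDual.toWeakDual (InnerProductSpace.toDual ℝ H (x k))
  have hT (k : ℕ) : T k ∈ WeakDual.toStrongDual ⁻¹' Metric.closedBall (0 : StrongDual ℝ H) M := by
    rw [Set.mem_preimage, mem_closedBall_zero_iff]
    change ‖InnerProductSpace.toDual ℝ H (x k)‖ ≤ M
    rw [LinearIsometryEquiv.norm_map]
    exact hx k
  obtain ⟨a, -, φ, hφ, ha⟩ := WeakDual.isSeqCompact_closedBall ℝ H 0 M hT
  refine ⟨φ, hφ, (InnerProductSpace.toDual ℝ H).symm (WeakDual.toStrongDual a), fun h => ?_⟩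
  have := ((WeakDual.eval_continuous h).tendsto a).comp ha
  rw [InnerProductSpace.toDual_symm_apply]
  exact this

variable {D : Set ℂ} {v η : ℂ → ℝ} {R δ : ℝ}

/-- Jensen's inequality for the square and the probability density `η`. -/
theorem sq_integral_mul_le {η g : ℂ → ℝ} (hη : Continuous η) (hηc : HasCompactSupport η)
    (hη0 : ∀ y, 0 ≤ η y) (hη1 : ∫ y, η y = 1) (hg : Continuous g) :
    (∫ y, η y * g y) ^ 2 ≤ ∫ y, η y * g y ^ 2 := by
  set m := ∫ y, η y * g y with hm
  have h : 0 ≤ ∫ y, η y * (g y - m) ^ 2 :=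
    integral_nonneg fun y => mul_nonneg (hη0 y) (sq_nonneg _)
  have i1 : Integrable fun y => η y * g y ^ 2 :=
    (hη.mul (hg.pow 2)).integrable_of_hasCompactSupport hηc.mul_right
  have i2 : Integrable fun y => η y * g y :=
    (hη.mul hg).integrable_of_hasCompactSupport hηc.mul_right
  have i4 : Integrable fun y => η y * g y ^ 2 - 2 * m * (η y * g y) := i1.sub (i2.const_mul _)
  have i3 : Integrable η := hη.integrable_of_hasCompactSupport hηc
  have h2 : ∫ y, η y * (g y - m) ^ 2 = (∫ y, η y * g y ^ 2) - m ^ 2 := by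
    have : ∀ y, η y * (g y - m) ^ 2 = η y * g y ^ 2 - 2 * m * (η y * g y) + m ^ 2 * η y :=
      fun y => by ring
    simp only [this]
    rw [integral_add i4 (i3.const_mul _), integral_sub i1 (i2.const_mul _),
      integral_const_mul, integral_const_mul, ← hm, hη1]
    ring
  linarith

/-- Mollifying at scale `δ` moves a test function by at most `δ ‖∇v‖` in `L²`. -/
theorem integral_sub_mollify_sq_le (hv : IsTest D v) (hR : D ⊆ Metric.ball 0 R)
    (hη : Continuous η) (hη0 : ∀ y, 0 ≤ η y) (hη1 : ∫ y, η y = 1)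
    (hηs : ∀ y, y ∉ Metric.closedBall (0 : ℂ) δ → η y = 0) :
    Integrable (fun x => (v x - ∫ y, η y * v (x - y)) ^ 2) ∧
    ∫ x, (v x - ∫ y, η y * v (x - y)) ^ 2 ≤ δ ^ 2 * ∫ x, gradDot v v x := by
  have hvc := hv.continuous
  have hηc : HasCompactSupport η := HasCompactSupport.intro (isCompact_closedBall 0 δ) hηs
  have hv0 (x : ℂ) (hx : R ≤ ‖x‖) : v x = 0 := by
    refine hv.eq_zero fun h => ?_
    have := hR h
    rw [mem_ball_zero_iff] at this
    linarith
  let f : ℂ → ℂ → ℝ := fun x y => η y * (v x - v (x - y)) ^ 2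
  have hf : Continuous (Function.uncurry f) := by
    simp only [f, Function.uncurry_def]; fun_prop
  have hfc : HasCompactSupport (Function.uncurry f) := by
    refine HasCompactSupport.intro
      ((isCompact_closedBall (0 : ℂ) (R + δ)).prod (isCompact_closedBall (0 : ℂ) δ)) ?_
    rintro ⟨x, y⟩ hxy
    simp only [f, Function.uncurry_apply_pair]
    by_cases hy : y ∈ Metric.closedBall (0 : ℂ) δ
    · have hx : x ∉ Metric.closedBall (0 : ℂ) (R + δ) := fun hx => hxy ⟨hx, hy⟩
      rw [mem_closedBall_zero_iff] at hx hy
      have h1 : ‖x‖ ≤ ‖x - y‖ + ‖y‖ := by simpa using norm_add_le (x - y) y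
      have h2 : 0 ≤ ‖y‖ := norm_nonneg y
      rw [hv0 x (by linarith), hv0 (x - y) (by linarith)]
      ring
    · rw [hηs y hy, zero_mul]
  have hprod : Integrable (Function.uncurry f) ((volume : Measure ℂ).prod volume) :=
    hf.integrable_of_hasCompactSupport hfc
  have hI : Integrable fun x => ∫ y, f x y := hprod.integral_prod_left
  have hpt (x : ℂ) : (v x - ∫ y, η y * v (x - y)) ^ 2 ≤ ∫ y, f x y := by
    have e : v x - ∫ y, η y * v (x - y) = ∫ y, η y * (v x - v (x - y)) := by
      simp only [mul_sub]
      rw [integral_sub, integral_mul_const, hη1, one_mul]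
      · exact (hη.integrable_of_hasCompactSupport hηc).mul_const _
      · exact Continuous.integrable_of_hasCompactSupport (by fun_prop) hηc.mul_right
    rw [e]
    exact sq_integral_mul_le hη hηc hη0 hη1 (by fun_prop)
  have hmeas : AEStronglyMeasurable (fun x => (v x - ∫ y, η y * v (x - y)) ^ 2) volume := by
    refine (hvc.aestronglyMeasurable.sub ?_).pow 2
    have : Continuous (Function.uncurry fun x y : ℂ => η y * v (x - y)) := by
      simp only [Function.uncurry_def]; fun_prop
    exact (this.stronglyMeasurable.integral_prod_right).aestronglyMeasurable
  have hint : Integrable fun x => (v x - ∫ y, η y * v (x - y)) ^ 2 :=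
    hI.mono' hmeas (Eventually.of_forall fun x => by
      rw [Real.norm_of_nonneg (sq_nonneg _)]; exact hpt x)
  refine ⟨hint, ?_⟩
  calc ∫ x, (v x - ∫ y, η y * v (x - y)) ^ 2 ≤ ∫ x, ∫ y, f x y := integral_mono hint hI hpt
    _ = ∫ y, ∫ x, f x y := integral_integral_swap_of_hasCompactSupport hf hfc
    _ ≤ ∫ y, η y * (δ ^ 2 * ∫ x, gradDot v v x) := by
        refine integral_mono hprod.integral_prod_right
          ((hη.integrable_of_hasCompactSupport hηc).mul_const _) fun y => ?_
        simp only [f]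
        rw [integral_const_mul]
        by_cases hy : y ∈ Metric.closedBall (0 : ℂ) δ
        · refine mul_le_mul_of_nonneg_left ?_ (hη0 y)
          refine (hv.integral_sub_translate_sq_le y).trans ?_
          refine mul_le_mul_of_nonneg_right ?_ (integral_nonneg fun _ => gradDot_self_nonneg _ _)
          rw [mem_closedBall_zero_iff] at hy
          exact pow_le_pow_left₀ (norm_nonneg y) hy 2
        · simp [hηs y hy]
    _ = δ ^ 2 * ∫ x, gradDot v v x := by rw [integral_mul_const, hη1, one_mul]

theorem gradDot_sub_self_le {u v : ℂ → ℝ} (hu : IsTest D u) (hv : IsTest D v) (z : ℂ) :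
    gradDot (fun z => u z - v z) (fun z => u z - v z) z ≤
      2 * gradDot u u z + 2 * gradDot v v z := by
  simp only [gradDot, pd_sub (hu.differentiableAt z) (hv.differentiableAt z)]
  nlinarith [sq_nonneg (pd 1 u z + pd 1 v z), sq_nonneg (pd Complex.I u z + pd Complex.I v z)]

/-- The Rellich selection theorem: test functions on a bounded set with bounded Dirichlet integral
have a subsequence which is Cauchy in `L²`. A weakly convergent subsequence becomes strongly
convergent after mollification, which moves its members by a uniformly small amount. -/
theorem exists_L2_cauchy_subseq (hD : Bornology.IsBounded D) {u : ℕ → ℂ → ℝ}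
    (hu : ∀ k, IsTest D (u k)) {M : ℝ} (hM : ∀ k, ∫ z, gradDot (u k) (u k) z ≤ M) :
    ∃ φ : ℕ → ℕ, StrictMono φ ∧ ∀ ε > 0, ∃ K, ∀ k ≥ K, ∀ l ≥ K,
      ∫ z, (u (φ k) z - u (φ l) z) ^ 2 ≤ ε := by
  obtain ⟨P, hP0, hP⟩ := exists_poincare hD
  obtain ⟨R, hR0, hR⟩ := hD.subset_ball_lt 0 0
  have hM0 : 0 ≤ M := (integral_nonneg fun _ => gradDot_self_nonneg _ _).trans (hM 0)
  have hL2 (k : ℕ) : ∫ z, u k z ^ 2 ≤ P * M :=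
    (hP _ (hu k)).trans (mul_le_mul_of_nonneg_left (hM k) hP0.le)
  let X : ℕ → Lp ℝ 2 (volume : Measure ℂ) := fun k => (hu k).memLp.toLp (u k)
  have hX (k : ℕ) : ‖X k‖ ≤ Real.sqrt (P * M) := by
    refine Real.le_sqrt_of_sq_le ?_
    rw [norm_toLp_sq]
    simpa using hL2 k
  have : Fact ((2 : ENNReal) ≠ ⊤) := ⟨by simp⟩
  obtain ⟨φ, hφ, a, ha⟩ := exists_weakly_convergent_subseq hX
  refine ⟨φ, hφ, fun ε hε => ?_⟩
  obtain ⟨δ, hδ0, hδ⟩ : ∃ δ : ℝ, 0 < δ ∧ 2 * (δ ^ 2 * (4 * M)) ≤ ε / 2 := by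
    refine ⟨Real.sqrt (ε / (16 * (M + 1))), Real.sqrt_pos.2 (by positivity), ?_⟩
    rw [Real.sq_sqrt (by positivity)]
    have : ε / (16 * (M + 1)) * (M + 1) = ε / 16 := by field_simp
    have h2 : 0 ≤ ε / (16 * (M + 1)) := by positivity
    nlinarith
  let b : ContDiffBump (0 : ℂ) := ⟨δ / 2, δ, by positivity, by linarith⟩
  set η : ℂ → ℝ := b.normed volume with hηdef
  have hη : Continuous η := (b.contDiff_normed (n := 0)).continuous
  have hη0 (y : ℂ) : 0 ≤ η y := b.nonneg_normed y
  have hη1 : ∫ y, η y = 1 := b.integral_normed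
  have hηs (y : ℂ) (hy : y ∉ Metric.closedBall (0 : ℂ) δ) : η y = 0 := by
    refine image_eq_zero_of_notMem_tsupport ?_
    rw [b.tsupport_normed_eq]
    exact hy
  have hηc : HasCompactSupport η := HasCompactSupport.intro (isCompact_closedBall 0 δ) hηs
  -- the mollifications, which converge pointwise because their values are inner products with
  -- fixed functions, and boundedly
  let W : ℕ → ℂ → ℝ := fun k x => ∫ y, η y * u (φ k) (x - y)
  have hWcont (k : ℕ) : AEStronglyMeasurable (W k) volume := by
    have huc := (hu (φ k)).continuous
    have : Continuous (Function.uncurry fun x y : ℂ => η y * u (φ k) (x - y)) := by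
      simp only [Function.uncurry_def]; fun_prop
    exact (this.stronglyMeasurable.integral_prod_right).aestronglyMeasurable
  have hηx (x : ℂ) : MemLp (fun y => η (x - y)) 2 volume := by
    refine Continuous.memLp_of_hasCompactSupport (by fun_prop) ?_
    exact hηc.comp_homeomorph (Homeomorph.subLeft x)
  have hWin (k : ℕ) (x : ℂ) : W k x = inner ℝ (X (φ k)) ((hηx x).toLp _) := by
    simp only [W, X]
    rw [inner_toLp, ← integral_sub_left_eq_self (fun y => inner ℝ (u (φ k) y) (η (x - y))) volume x]
    simp [mul_comm]
  have hWb (k : ℕ) (x : ℂ) : |W k x| ≤ (P * M + ∫ y, η y ^ 2) := by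
    have h1 := abs_real_inner_le_norm (X (φ k)) ((hηx x).toLp _)
    rw [← hWin] at h1
    have h2 : ‖X (φ k)‖ ^ 2 ≤ P * M := by
      rw [norm_toLp_sq]; simpa using hL2 (φ k)
    have h3 : ‖(hηx x).toLp _‖ ^ 2 = ∫ y, η y ^ 2 := by
      rw [norm_toLp_sq]
      simp only [Real.norm_eq_abs, sq_abs]
      exact integral_sub_left_eq_self (fun y => η y ^ 2) volume x
    nlinarith [sq_nonneg (‖X (φ k)‖ - ‖(hηx x).toLp _‖), norm_nonneg (X (φ k)),
      norm_nonneg ((hηx x).toLp _)]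
  have hWs (k : ℕ) (x : ℂ) (hx : x ∉ Metric.closedBall (0 : ℂ) (R + δ)) : W k x = 0 := by
    refine integral_eq_zero_of_ae (Eventually.of_forall fun y => ?_)
    by_cases hy : y ∈ Metric.closedBall (0 : ℂ) δ
    · have : x - y ∉ D := by
        intro h
        have h' := hR h
        rw [mem_closedBall_zero_iff] at hx hy
        rw [mem_ball_zero_iff] at h'
        have h1 : ‖x‖ ≤ ‖x - y‖ + ‖y‖ := by simpa using norm_add_le (x - y) y
        linarith
      simp [(hu (φ k)).eq_zero this]
    · simp [hηs y hy]
  set B := P * M + ∫ y, η y ^ 2 with hB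
  have hWd : ∀ p : ℕ × ℕ, ∀ x, (W p.1 x - W p.2 x) ^ 2 ≤
      (Metric.closedBall (0 : ℂ) (R + δ)).indicator (fun _ => 4 * B ^ 2) x := by
    intro p x
    by_cases hx : x ∈ Metric.closedBall (0 : ℂ) (R + δ)
    · rw [Set.indicator_of_mem hx]
      have h1 := abs_le.1 (hWb p.1 x)
      have h2 := abs_le.1 (hWb p.2 x)
      nlinarith
    · rw [Set.indicator_of_notMem hx, hWs _ x hx, hWs _ x hx]; simp
  have hbi : Integrable ((Metric.closedBall (0 : ℂ) (R + δ)).indicator fun _ => 4 * B ^ 2) :=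
    (integrable_indicator_iff measurableSet_closedBall).2
      (integrableOn_const (isCompact_closedBall _ _).measure_lt_top.ne)
  have hmeas (p : ℕ × ℕ) : AEStronglyMeasurable (fun x => (W p.1 x - W p.2 x) ^ 2) volume :=
    ((hWcont p.1).sub (hWcont p.2)).pow 2
  have hlim : Tendsto (fun p : ℕ × ℕ => ∫ x, (W p.1 x - W p.2 x) ^ 2) (atTop ×ˢ atTop) (𝓝 0) := by
    have := tendsto_integral_filter_of_dominated_convergence (μ := volume)
      (l := (atTop ×ˢ atTop : Filter (ℕ × ℕ))) (f := fun _ : ℂ => (0 : ℝ))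
      (F := fun p x => (W p.1 x - W p.2 x) ^ 2) _ (Eventually.of_forall hmeas)
      (Eventually.of_forall fun p => Eventually.of_forall fun x => by
        rw [Real.norm_of_nonneg (sq_nonneg _)]; exact hWd p x) hbi
      (Eventually.of_forall fun x => ?_)
    · simpa using this
    · simp only [hWin]
      have h := ha ((hηx x).toLp _)
      simpa using ((h.comp tendsto_fst).sub (h.comp tendsto_snd)).pow 2
  rw [prod_atTop_atTop_eq] at hlim
  have hev := (hlim.eventually (gt_mem_nhds (show (0 : ℝ) < ε / 4 by positivity)))
  obtain ⟨⟨K1, K2⟩, hK⟩ := eventually_atTop.1 hev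
  refine ⟨max K1 K2, fun k hk l hl => ?_⟩
  have hkl := hK (k, l) ⟨(le_max_left _ _).trans hk, (le_max_right _ _).trans hl⟩
  simp only at hkl
  have hv := (hu (φ k)).sub (hu (φ l))
  obtain ⟨hi, hle⟩ := integral_sub_mollify_sq_le hv hR hη hη0 hη1 hηs
  have hEv : ∫ z, gradDot (fun z => u (φ k) z - u (φ l) z) (fun z => u (φ k) z - u (φ l) z) z
      ≤ 4 * M := by
    have ik := ((hu (φ k)).isTest_gradDot (hu (φ k))).integrable.const_mul 2
    have il := ((hu (φ l)).isTest_gradDot (hu (φ l))).integrable.const_mul 2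
    refine (integral_mono (hv.isTest_gradDot hv).integrable (ik.add il)
      (gradDot_sub_self_le (hu _) (hu _))).trans ?_
    simp only [Pi.add_apply]
    rw [integral_add ik il, integral_const_mul, integral_const_mul]
    linarith [hM (φ k), hM (φ l)]
  have hconv (x : ℂ) : ∫ y, η y * (u (φ k) (x - y) - u (φ l) (x - y)) = W k x - W l x := by
    have hc (k : ℕ) : Integrable fun y => η y * u (φ k) (x - y) := by
      have huc := (hu (φ k)).continuous
      exact Continuous.integrable_of_hasCompactSupport (by fun_prop) hηc.mul_right
    simp only [mul_sub, W]
    exact integral_sub (hc k) (hc l)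
  simp only [hconv] at hi hle
  have hi2 : Integrable fun x => (W k x - W l x) ^ 2 :=
    hbi.mono' (hmeas (k, l)) (Eventually.of_forall fun x => by
      rw [Real.norm_of_nonneg (sq_nonneg _)]; exact hWd (k, l) x)
  have hi3 : Integrable fun x => (u (φ k) x - u (φ l) x) ^ 2 := by
    simpa [pow_two] using (hv.mul hv).integrable
  calc ∫ z, (u (φ k) z - u (φ l) z) ^ 2
      ≤ ∫ z, (2 * (u (φ k) z - u (φ l) z - (W k z - W l z)) ^ 2 + 2 * (W k z - W l z) ^ 2) := by
        refine integral_mono hi3 ((hi.const_mul 2).add (hi2.const_mul 2)) fun z => ?_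
        nlinarith [sq_nonneg (u (φ k) z - u (φ l) z - 2 * (W k z - W l z))]
    _ = 2 * (∫ z, (u (φ k) z - u (φ l) z - (W k z - W l z)) ^ 2)
          + 2 * ∫ z, (W k z - W l z) ^ 2 := by
        rw [integral_add (hi.const_mul 2) (hi2.const_mul 2), integral_const_mul,
          integral_const_mul]
    _ ≤ 2 * (δ ^ 2 * (4 * M)) + 2 * (ε / 4) := by
        have : δ ^ 2 * (∫ z, gradDot (fun z => u (φ k) z - u (φ l) z)
            (fun z => u (φ k) z - u (φ l) z) z) ≤ δ ^ 2 * (4 * M) :=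
          mul_le_mul_of_nonneg_left hEv (sq_nonneg δ)
        linarith
    _ ≤ ε := by linarith

end Rellich

/-! ### Minimizing sequences and the least eigenvalue of a weighted problem -/

section L2

variable {α E : Type*} [MeasurableSpace α] {μ : Measure α} [NormedAddCommGroup E]

theorem tendsto_toLp {f : ℕ → α → E} {F : α → E} (hf : ∀ k, MemLp (f k) 2 μ) (hF : MemLp F 2 μ)
    (h : Tendsto (fun k => eLpNorm (fun z => f k z - F z) 2 μ) atTop (𝓝 0)) :
    Tendsto (fun k => (hf k).toLp (f k)) atTop (𝓝 (hF.toLp F)) :=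
  (Lp.tendsto_Lp_iff_tendsto_eLpNorm'' f hf F hF).2 h

theorem tendsto_integral_inner [InnerProductSpace ℝ E] {f g : ℕ → α → E} {F G : α → E} (hf : ∀ k, MemLp (f k) 2 μ)
    (hF : MemLp F 2 μ) (hg : ∀ k, MemLp (g k) 2 μ) (hG : MemLp G 2 μ)
    (h : Tendsto (fun k => eLpNorm (fun z => f k z - F z) 2 μ) atTop (𝓝 0))
    (h' : Tendsto (fun k => eLpNorm (fun z => g k z - G z) 2 μ) atTop (𝓝 0)) :
    Tendsto (fun k => ∫ z, inner ℝ (f k z) (g k z) ∂μ) atTop (𝓝 (∫ z, inner ℝ (F z) (G z) ∂μ)) := by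
  have := (tendsto_toLp hf hF h).inner (𝕜 := ℝ) (tendsto_toLp hg hG h')
  simpa only [inner_toLp] using this

theorem tendsto_eLpNorm_self_sub (F : α → E) :
    Tendsto (fun _ : ℕ => eLpNorm (fun z => F z - F z) 2 μ) atTop (𝓝 0) := by
  simp

theorem exists_L2_limit [InnerProductSpace ℝ E] [CompleteSpace E] {f : ℕ → α → E} (hf : ∀ k, MemLp (f k) 2 μ)
    (hc : ∀ ε > 0, ∃ K, ∀ k ≥ K, ∀ l ≥ K, ∫ z, ‖f k z - f l z‖ ^ 2 ∂μ ≤ ε) :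
    ∃ F, MemLp F 2 μ ∧ Tendsto (fun k => eLpNorm (fun z => f k z - F z) 2 μ) atTop (𝓝 0) := by
  have hcs : CauchySeq fun k => (hf k).toLp (f k) := by
    rw [Metric.cauchySeq_iff]
    intro ε hε
    obtain ⟨K, hK⟩ := hc ((ε / 2) ^ 2) (by positivity)
    refine ⟨K, fun k hk l hl => ?_⟩
    rw [dist_eq_norm, ← MemLp.toLp_sub]
    have h := norm_toLp_sq ((hf k).sub (hf l))
    have h2 := hK k hk l hl
    simp only [Pi.sub_apply] at h
    rw [← h] at h2
    have := abs_le_of_sq_le_sq h2 (by positivity)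
    rw [abs_of_nonneg (norm_nonneg _)] at this
    linarith
  obtain ⟨F, hF⟩ := cauchySeq_tendsto_of_complete hcs
  refine ⟨F, Lp.memLp F, ?_⟩
  rw [Lp.tendsto_Lp_iff_tendsto_eLpNorm'] at hF
  refine hF.congr fun k => eLpNorm_congr_ae ?_
  filter_upwards [(hf k).coeFn_toLp] with z hz
  simp [hz]

theorem exists_ae_tendsto_subseq {f : ℕ → α → E} {F : α → E} (hf : ∀ k, MemLp (f k) 2 μ)
    (hF : MemLp F 2 μ) (h : Tendsto (fun k => eLpNorm (fun z => f k z - F z) 2 μ) atTop (𝓝 0)) :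
    ∃ φ : ℕ → ℕ, StrictMono φ ∧ ∀ᵐ z ∂μ, Tendsto (fun k => f (φ k) z) atTop (𝓝 (F z)) :=
  (tendstoInMeasure_of_tendsto_eLpNorm (by simp) (fun k => (hf k).1) hF.1 h).exists_seq_tendsto_ae

end L2

/-- If a quadratic form is nonnegative on a line, its polar form satisfies the Cauchy-Schwarz
inequality. -/
theorem sq_le_mul_of_quadratic_nonneg {A B C : ℝ} (h : ∀ s : ℝ, 0 ≤ A + 2 * s * B + s ^ 2 * C) :
    B ^ 2 ≤ A * C := by
  have := discrim_le_zero (a := C) (b := 2 * B) (c := A) fun s => by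
    have := h s
    nlinarith
  rw [discrim] at this
  nlinarith

/-- The Dirichlet integral. -/
noncomputable def energy (u : ℂ → ℝ) : ℝ := ∫ z, gradDot u u z

/-- The weighted `L²` form `∫ w u²`. -/
noncomputable def mass (w u : ℂ → ℝ) : ℝ := ∫ z, w z * u z ^ 2

/-- A continuous nonnegative weight on `D` for which `∫ w u²` is compact relative to the Dirichlet
integral on `H¹₀(D)`. -/
def IsCompactWeight (D : Set ℂ) (w : ℂ → ℝ) : Prop :=
  ContinuousOn w D ∧ (∀ z ∈ D, 0 ≤ w z) ∧
    ∀ ε > 0, ∃ C, 0 ≤ C ∧ ∀ u, IsTest D u → mass w u ≤ ε * energy u + C * ∫ z, u z ^ 2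

/-- `l` is an eigenvalue of `Δu + l w u = 0` with Dirichlet boundary values, in the weak sense. -/
def IsWeightedEigenvalue (w : ℂ → ℝ) (D : Set ℂ) (l : ℝ) : Prop :=
  ∃ (u : ℂ → ℝ) (G : ℂ → ℂ), MemH10 D u G ∧ ¬ (u =ᵐ[volume.restrict D] 0) ∧
    ∀ v : ℂ → ℝ, IsTest D v →
      ∫ z in D, inner ℝ (G z) (gradient v z) = l * ∫ z in D, w z * u z * v z

section Forms

variable {D : Set ℂ} {w u v : ℂ → ℝ} {l : ℝ}

theorem energy_nonneg (u : ℂ → ℝ) : 0 ≤ energy u := integral_nonneg fun _ => gradDot_self_nonneg _ _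

theorem IsTest.weight_mul (hD : IsOpen D) (hw : ContinuousOn w D) (hu : IsTest D u)
    (hv : Continuous v) : Continuous (fun z => w z * u z * v z) ∧
      HasCompactSupport fun z => w z * u z * v z := by
  have e : (fun z => w z * u z * v z) = fun z => u z * (w z * v z) := by funext z; ring
  rw [e]
  exact ⟨continuous_mul_of_tsupport hu.continuous fun z hz =>
    (hw.continuousAt (hD.mem_nhds (hu.2.2 hz))).mul hv.continuousAt, hu.2.1.mul_right⟩

theorem IsTest.integrable_weight_mul (hD : IsOpen D) (hw : ContinuousOn w D) (hu : IsTest D u)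
    (hv : Continuous v) : Integrable fun z => w z * u z * v z :=
  (hu.weight_mul hD hw hv).1.integrable_of_hasCompactSupport (hu.weight_mul hD hw hv).2

theorem IsTest.integrable_weight_sq (hD : IsOpen D) (hw : ContinuousOn w D) (hu : IsTest D u) :
    Integrable fun z => w z * u z ^ 2 := by
  simpa [pow_two, mul_assoc] using hu.integrable_weight_mul hD hw hu.continuous

theorem mass_nonneg (hw : ∀ z ∈ D, 0 ≤ w z) (hu : IsTest D u) : 0 ≤ mass w u := by
  refine integral_nonneg fun z => ?_
  by_cases hz : z ∈ D
  · exact mul_nonneg (hw z hz) (sq_nonneg _)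
  · simp [hu.eq_zero hz]

theorem energy_add_mul (hu : IsTest D u) (hv : IsTest D v) (s : ℝ) :
    energy (fun z => u z + s * v z) =
      energy u + 2 * s * (∫ z, gradDot u v z) + s ^ 2 * energy v := by
  have i1 := (hu.isTest_gradDot hu).integrable
  have i2 := (hu.isTest_gradDot hv).integrable.const_mul (2 * s)
  have i3 := (hv.isTest_gradDot hv).integrable.const_mul (s ^ 2)
  have i4 : Integrable fun z => gradDot u u z + 2 * s * gradDot u v z := i1.add i2
  simp only [energy, gradDot_add_self hu hv]
  rw [integral_add i4 i3, integral_add i1 i2, integral_const_mul, integral_const_mul]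

theorem mass_add_mul (hD : IsOpen D) (hw : ContinuousOn w D) (hu : IsTest D u) (hv : IsTest D v)
    (s : ℝ) : mass w (fun z => u z + s * v z) =
      mass w u + 2 * s * (∫ z, w z * u z * v z) + s ^ 2 * mass w v := by
  have i1 := hu.integrable_weight_sq hD hw
  have i2 := (hu.integrable_weight_mul hD hw hv.continuous).const_mul (2 * s)
  have i3 := (hv.integrable_weight_sq hD hw).const_mul (s ^ 2)
  have i4 : Integrable fun z => w z * u z ^ 2 + 2 * s * (w z * u z * v z) := i1.add i2
  have e (z : ℂ) : w z * (u z + s * v z) ^ 2 =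
      w z * u z ^ 2 + 2 * s * (w z * u z * v z) + s ^ 2 * (w z * v z ^ 2) := by ring
  simp only [mass, e]
  rw [integral_add i4 i3, integral_add i1 i2, integral_const_mul, integral_const_mul]

theorem energy_const_mul (hu : IsTest D u) (s : ℝ) :
    energy (fun z => s * u z) = s ^ 2 * energy u := by
  simp only [energy, gradDot_const_mul_self hu, integral_const_mul]

theorem mass_const_mul (w u : ℂ → ℝ) (s : ℝ) : mass w (fun z => s * u z) = s ^ 2 * mass w u := by
  have e (z : ℂ) : w z * (s * u z) ^ 2 = s ^ 2 * (w z * u z ^ 2) := by ring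
  simp only [mass, e, integral_const_mul]

theorem energy_sub_add (hu : IsTest D u) (hv : IsTest D v) :
    energy (fun z => u z - v z) + energy (fun z => u z + v z) = 2 * energy u + 2 * energy v := by
  have h1 := energy_add_mul hu hv 1
  have h2 := energy_add_mul hu hv (-1)
  simp only [one_mul, neg_mul, ← sub_eq_add_neg] at h1 h2
  rw [h1, h2]; ring

theorem mass_sub_add (hD : IsOpen D) (hw : ContinuousOn w D) (hu : IsTest D u) (hv : IsTest D v) :
    mass w (fun z => u z - v z) + mass w (fun z => u z + v z) = 2 * mass w u + 2 * mass w v := by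
  have h1 := mass_add_mul hD hw hu hv 1
  have h2 := mass_add_mul hD hw hu hv (-1)
  simp only [one_mul, neg_mul, ← sub_eq_add_neg] at h1 h2
  rw [h1, h2]; ring

theorem IsTest.setIntegral_gradDot (hu : IsTest D u) (v : ℂ → ℝ) :
    ∫ z in D, gradDot u v z = ∫ z, gradDot u v z :=
  setIntegral_eq_integral_of_forall_compl_eq_zero fun z hz => by
    simp [gradDot, (hu.isTest_pd _).eq_zero hz]

theorem setIntegral_norm_gradient_sub_sq (hu : IsTest D u) (hv : IsTest D v) :
    ∫ z in D, ‖gradient u z - gradient v z‖ ^ 2 = energy fun z => u z - v z := by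
  rw [energy, ← (hu.sub hv).setIntegral_gradDot]
  refine integral_congr_ae (Eventually.of_forall fun z => ?_)
  simp only
  rw [← norm_gradient_sq, gradient_sub' (hu.differentiableAt z) (hv.differentiableAt z)]

/-- The Dirichlet integrals converge when the gradients converge in `L²`. -/
theorem tendsto_energy {f : ℕ → ℂ → ℝ} {G : ℂ → ℂ} (hf : ∀ n, IsTest D (f n))
    (hG : MemLp G 2 (volume.restrict D))
    (h : Tendsto (fun n => eLpNorm (fun z => gradient (f n) z - G z) 2 (volume.restrict D))
      atTop (𝓝 0)) :
    Tendsto (fun n => energy (f n)) atTop (𝓝 (∫ z in D, ‖G z‖ ^ 2)) := by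
  have := tendsto_integral_inner (fun n => (hf n).memLp_gradient.restrict D) hG
    (fun n => (hf n).memLp_gradient.restrict D) hG h h
  simp only [real_inner_self_eq_norm_sq, norm_gradient_sq, (hf _).setIntegral_gradDot] at this
  exact this

end Forms

section Spectral

variable {D : Set ℂ} {w : ℂ → ℝ} {l : ℝ}

/-- A minimizing sequence of the Rayleigh quotient has a subsequence which converges to an
eigenfunction: the relative compactness of `∫ w u²` makes it Cauchy for that form, and then the
parallelogram identity makes it Cauchy for the Dirichlet integral. -/
theorem exists_eigenfunction_of_minimizing (hDo : IsOpen D) (hDb : Bornology.IsBounded D)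
    (hw : IsCompactWeight D w) (hl0 : 0 ≤ l) (hl : ∀ u, IsTest D u → l * mass w u ≤ energy u)
    {u : ℕ → ℂ → ℝ} (hu : ∀ k, IsTest D (u k))
    (hm : Tendsto (fun k => mass w (u k)) atTop (𝓝 1))
    (he : Tendsto (fun k => energy (u k)) atTop (𝓝 l)) :
    ∃ φ : ℕ → ℕ, StrictMono φ ∧ ∃ (U : ℂ → ℝ) (G : ℂ → ℂ), MemH10 D U G ∧
      ¬ (U =ᵐ[volume.restrict D] 0) ∧
      (∀ v, IsTest D v →
        ∫ z in D, inner ℝ (G z) (gradient v z) = l * ∫ z in D, w z * U z * v z) ∧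
      Tendsto (fun k => eLpNorm (fun z => u (φ k) z - U z) 2 (volume.restrict D)) atTop (𝓝 0) := by
  obtain ⟨M, hM⟩ := he.bddAbove_range
  replace hM (k : ℕ) : energy (u k) ≤ M := hM ⟨k, rfl⟩
  have hM0 : 0 ≤ M := (energy_nonneg _).trans (hM 0)
  obtain ⟨φ, hφ, hcauchy⟩ := exists_L2_cauchy_subseq hDb hu hM
  have hEsub (k m : ℕ) : energy (fun z => u k z - u m z) ≤ 4 * M := by
    have := energy_sub_add (hu k) (hu m)
    linarith [energy_nonneg fun z => u k z + u m z, hM k, hM m]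
  have hmass : ∀ ε > 0, ∃ K, ∀ k ≥ K, ∀ m ≥ K,
      mass w (fun z => u (φ k) z - u (φ m) z) ≤ ε := by
    intro ε hε
    obtain ⟨C, hC0, hC⟩ := hw.2.2 (ε / (2 * (4 * M + 1))) (by positivity)
    obtain ⟨K, hK⟩ := hcauchy (ε / (2 * (C + 1))) (by positivity)
    refine ⟨K, fun k hk m hm => ?_⟩
    have h1 := hC _ ((hu (φ k)).sub (hu (φ m)))
    have h2 := hK k hk m hm
    have h3 : ε / (2 * (4 * M + 1)) * energy (fun z => u (φ k) z - u (φ m) z) ≤ ε / 2 := by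
      calc _ ≤ ε / (2 * (4 * M + 1)) * (4 * M + 1) :=
            mul_le_mul_of_nonneg_left ((hEsub _ _).trans (by linarith)) (by positivity)
        _ = ε / 2 := by field_simp
    have h4 : C * (∫ z, (u (φ k) z - u (φ m) z) ^ 2) ≤ ε / 2 := by
      calc _ ≤ (C + 1) * (ε / (2 * (C + 1))) :=
            mul_le_mul (by linarith) h2 (integral_nonneg fun _ => sq_nonneg _) (by positivity)
        _ = ε / 2 := by field_simp
    linarith
  have heφ := he.comp hφ.tendsto_atTop
  have hmφ := hm.comp hφ.tendsto_atTop
  have henergy : ∀ ε > 0, ∃ K, ∀ k ≥ K, ∀ m ≥ K,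
      energy (fun z => u (φ k) z - u (φ m) z) ≤ ε := by
    intro ε hε
    have hdiff : Tendsto (fun k => energy (u (φ k)) - l * mass w (u (φ k))) atTop (𝓝 0) := by
      simpa using heφ.sub (hmφ.const_mul l)
    obtain ⟨K1, hK1⟩ := eventually_atTop.1
      (hdiff.eventually (gt_mem_nhds (show (0 : ℝ) < ε / 8 by positivity)))
    obtain ⟨K2, hK2⟩ := hmass (ε / (2 * (l + 1))) (by positivity)
    refine ⟨max K1 K2, fun k hk m hm => ?_⟩
    have h1 := hK1 k ((le_max_left _ _).trans hk)
    have h2 := hK1 m ((le_max_left _ _).trans hm)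
    have h3 := hK2 k ((le_max_right _ _).trans hk) m ((le_max_right _ _).trans hm)
    have h4 := energy_sub_add (hu (φ k)) (hu (φ m))
    have h5 := mass_sub_add hDo hw.1 (hu (φ k)) (hu (φ m))
    have h6 := hl _ ((hu (φ k)).add (hu (φ m)))
    have h7 : l * mass w (fun z => u (φ k) z - u (φ m) z) ≤ ε / 2 := by
      calc _ ≤ (l + 1) * (ε / (2 * (l + 1))) :=
            mul_le_mul (by linarith) h3 (mass_nonneg hw.2.1 ((hu _).sub (hu _))) (by positivity)
        _ = ε / 2 := by field_simp
    have h8 : mass w (fun z => u (φ k) z + u (φ m) z) = 2 * mass w (u (φ k)) +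
      2 * mass w (u (φ m)) - mass w (fun z => u (φ k) z - u (φ m) z) := by linarith
    rw [h8] at h6
    nlinarith
  obtain ⟨U, hU, hUlim⟩ := exists_L2_limit (μ := volume.restrict D) (f := fun k => u (φ k))
    (fun k => (hu (φ k)).memLp.restrict D) (by
      intro ε hε
      obtain ⟨K, hK⟩ := hcauchy ε hε
      refine ⟨K, fun k hk m hm => le_trans ?_ (hK k hk m hm)⟩
      simp only [Real.norm_eq_abs, sq_abs]
      refine setIntegral_le_integral ?_ (Eventually.of_forall fun _ => sq_nonneg _)
      simpa [pow_two] using (((hu (φ k)).sub (hu (φ m))).mul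
        ((hu (φ k)).sub (hu (φ m)))).integrable)
  obtain ⟨G, hG, hGlim⟩ := exists_L2_limit (μ := volume.restrict D)
    (f := fun k => gradient (u (φ k))) (fun k => (hu (φ k)).memLp_gradient.restrict D) (by
      intro ε hε
      obtain ⟨K, hK⟩ := henergy ε hε
      refine ⟨K, fun k hk m hm => le_trans (le_of_eq ?_) (hK k hk m hm)⟩
      exact setIntegral_norm_gradient_sub_sq (hu _) (hu _))
  refine ⟨φ, hφ, U, G, ⟨hU, hG, fun k => u (φ k), fun k => hu _, hUlim, hGlim⟩, ?_, ?_, hUlim⟩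
  -- a vanishing limit would contradict the mass `1`, as the weight is compact
  · intro hU0
    have h1 := tendsto_integral_inner (fun k => (hu (φ k)).memLp.restrict D) hU
      (fun k => (hu (φ k)).memLp.restrict D) hU hUlim hUlim
    have h2 : ∫ z in D, inner ℝ (U z) (U z) = 0 := by
      rw [integral_eq_zero_of_ae]
      filter_upwards [hU0] with z hz
      simp [hz]
    rw [h2] at h1
    have h3 (k : ℕ) : ∫ z in D, inner ℝ (u (φ k) z) (u (φ k) z) = ∫ z, u (φ k) z ^ 2 := by
      have := (hu (φ k)).setIntegral_eq (h := u (φ k))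
      simpa [pow_two] using this
    simp only [h3] at h1
    obtain ⟨C, hC0, hC⟩ := hw.2.2 (1 / (2 * (M + 1))) (by positivity)
    have h4 : ∀ k, mass w (u (φ k)) ≤ 1 / 2 + C * ∫ z, u (φ k) z ^ 2 := fun k => by
      refine (hC _ (hu _)).trans (add_le_add_left ?_ _)
      calc _ ≤ 1 / (2 * (M + 1)) * (M + 1) :=
            mul_le_mul_of_nonneg_left ((hM _).trans (by linarith)) (by positivity)
        _ = 1 / 2 := by field_simp
    have h5 := le_of_tendsto_of_tendsto' hmφ ((h1.const_mul C).const_add (1 / 2)) h4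
    norm_num at h5
  -- the equation passes to the limit: the nonnegative form `energy - l * mass` tends to zero on the
  -- sequence, hence so does its polar form with `v`
  · intro v hv
    have hwv := hv.weight_mul hDo hw.1 (v := fun _ => 1) continuous_const
    simp only [mul_one] at hwv
    have hwvL : MemLp (fun z => w z * v z) 2 (volume.restrict D) :=
      (hwv.1.memLp_of_hasCompactSupport hwv.2).restrict D
    have l1 := tendsto_integral_inner (fun k => (hu (φ k)).memLp_gradient.restrict D) hG
      (fun _ => hv.memLp_gradient.restrict D) (hv.memLp_gradient.restrict D) hGlim
      (tendsto_eLpNorm_self_sub _)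
    have l2 := tendsto_integral_inner (fun k => (hu (φ k)).memLp.restrict D) hU
      (fun _ => hwvL) hwvL hUlim (tendsto_eLpNorm_self_sub _)
    simp only [inner_gradient, (hu _).setIntegral_gradDot] at l1
    have e2 (f : ℂ → ℝ) : ∫ z in D, inner ℝ (f z) (w z * v z) = ∫ z in D, w z * f z * v z := by
      refine integral_congr_ae (Eventually.of_forall fun z => ?_)
      simp only [RCLike.inner_apply, conj_trivial]; ring
    simp only [e2] at l2
    have e3 (k : ℕ) : ∫ z in D, w z * u (φ k) z * v z = ∫ z, w z * u (φ k) z * v z :=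
      hv.setIntegral_eq (h := fun z => w z * u (φ k) z)
    simp only [e3] at l2
    have hQ (k : ℕ) : ((∫ z, gradDot (u (φ k)) v z) - l * ∫ z, w z * u (φ k) z * v z) ^ 2 ≤
        (energy (u (φ k)) - l * mass w (u (φ k))) * (energy v - l * mass w v) := by
      refine sq_le_mul_of_quadratic_nonneg fun s => ?_
      have h := hl _ ((hu (φ k)).add (hv.const_mul s))
      rw [energy_add_mul (hu _) hv, mass_add_mul hDo hw.1 (hu _) hv] at h
      nlinarith
    have l3 : Tendsto (fun k => (energy (u (φ k)) - l * mass w (u (φ k))) *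
        (energy v - l * mass w v)) atTop (𝓝 0) := by
      have : Tendsto (fun k => energy (u (φ k)) - l * mass w (u (φ k))) atTop (𝓝 0) := by
        simpa using heφ.sub (hmφ.const_mul l)
      simpa using this.mul_const (energy v - l * mass w v)
    have l4 := squeeze_zero (fun k => sq_nonneg _) hQ l3
    have l5 := tendsto_nhds_unique l4 ((l1.sub (l2.const_mul l)).pow 2)
    have := pow_eq_zero_iff (two_ne_zero) |>.1 l5.symm
    linarith

/-- Every eigenvalue `m` is at least each lower bound `l` of the Rayleigh quotient. The weight need
not be bounded, so the eigenfunction is not directly admissible in its own equation; it is tested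
with the functions `f n` approximating it, along which `m * mass w (f n)` tends to the Dirichlet
integral of the eigenfunction. -/
theorem le_of_isWeightedEigenvalue (hDo : IsOpen D) (hDb : Bornology.IsBounded D)
    (hw : ContinuousOn w D) (hw0 : ∀ z ∈ D, 0 ≤ w z) (hl0 : 0 < l)
    (hl : ∀ u, IsTest D u → l * mass w u ≤ energy u) {m : ℝ} (hm : IsWeightedEigenvalue w D m) :
    l ≤ m := by
  obtain ⟨u, G, ⟨hu, hG, f, hf, hfu, hfG⟩, hne, heq⟩ := hm
  set e := ∫ z in D, ‖G z‖ ^ 2 with he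
  have hE : Tendsto (fun n => energy (f n)) atTop (𝓝 e) := tendsto_energy hf hG hfG
  -- by Poincaré's inequality an eigenfunction with vanishing gradient would vanish
  have he0 : 0 < e := by
    refine lt_of_le_of_ne (integral_nonneg fun _ => sq_nonneg _) fun h0 => hne ?_
    rw [← h0] at hE
    obtain ⟨P, hP0, hP⟩ := exists_poincare hDb
    have h1 : Tendsto (fun n => ∫ z, f n z ^ 2) atTop (𝓝 0) :=
      squeeze_zero (fun n => integral_nonneg fun _ => sq_nonneg _) (fun n => hP _ (hf n))
        (by have := hE.const_mul P; rw [mul_zero] at this; exact this)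
    have h2 := tendsto_integral_inner (fun k => (hf k).memLp.restrict D) hu
      (fun k => (hf k).memLp.restrict D) hu hfu hfu
    have h3 (k : ℕ) : ∫ z in D, inner ℝ (f k z) (f k z) = ∫ z, f k z ^ 2 := by
      have := (hf k).setIntegral_eq (h := f k)
      simpa [pow_two] using this
    simp only [h3] at h2
    have h4 := tendsto_nhds_unique h2 h1
    have h5 : Integrable (fun z => u z ^ 2) (volume.restrict D) := hu.integrable_sq
    have h6 : ∫ z in D, u z ^ 2 = 0 := by simpa [pow_two] using h4
    rw [integral_eq_zero_iff_of_nonneg (fun _ => sq_nonneg _) h5] at h6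
    filter_upwards [h6] with z hz
    simpa using hz
  have hpol (n : ℕ) : Tendsto (fun k => ∫ z, w z * f k z * f n z) atTop
      (𝓝 (∫ z in D, w z * u z * f n z)) := by
    have hwv := (hf n).weight_mul hDo hw (v := fun _ => 1) continuous_const
    simp only [mul_one] at hwv
    have hwvL : MemLp (fun z => w z * f n z) 2 (volume.restrict D) :=
      (hwv.1.memLp_of_hasCompactSupport hwv.2).restrict D
    have l2 := tendsto_integral_inner (fun k => (hf k).memLp.restrict D) hu
      (fun _ => hwvL) hwvL hfu (tendsto_eLpNorm_self_sub _)
    have e2 (g : ℂ → ℝ) : ∫ z in D, inner ℝ (g z) (w z * f n z) = ∫ z in D, w z * g z * f n z := by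
      refine integral_congr_ae (Eventually.of_forall fun z => ?_)
      simp only [RCLike.inner_apply, conj_trivial]; ring
    simp only [e2] at l2
    have e3 (k : ℕ) : ∫ z in D, w z * f k z * f n z = ∫ z, w z * f k z * f n z :=
      (hf n).setIntegral_eq (h := fun z => w z * f k z)
    simpa only [e3] using l2
  obtain ⟨M, hM⟩ := hE.bddAbove_range
  replace hM (k : ℕ) : energy (f k) ≤ M := hM ⟨k, rfl⟩
  have hM0 : 0 ≤ M := (energy_nonneg _).trans (hM 0)
  have hmb (u : ℂ → ℝ) (hu : IsTest D u) : mass w u ≤ energy u / l := by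
    rw [le_div_iff₀ hl0]; linarith [hl u hu]
  have hcau : ∀ ε > 0, ∃ K, ∀ n ≥ K, ∀ k ≥ K, energy (fun z => f n z - f k z) ≤ ε := by
    intro ε hε
    have hcs := (tendsto_toLp (fun n => (hf n).memLp_gradient.restrict D) hG hfG).cauchySeq
    rw [Metric.cauchySeq_iff] at hcs
    obtain ⟨K, hK⟩ := hcs (Real.sqrt ε) (Real.sqrt_pos.2 hε)
    refine ⟨K, fun n hn k hk => ?_⟩
    have h1 := (hK n hn k hk).le
    rw [dist_eq_norm, ← MemLp.toLp_sub] at h1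
    have h2 := norm_toLp_sq (((hf n).memLp_gradient.restrict D).sub
      ((hf k).memLp_gradient.restrict D))
    simp only [Pi.sub_apply, setIntegral_norm_gradient_sub_sq (hf n) (hf k)] at h2
    rw [← h2]
    exact (Real.le_sqrt (norm_nonneg _) hε.le).1 h1
  -- the masses are controlled by the energies, so the sequence is also Cauchy for the mass form
  have hdiff : Tendsto (fun n => mass w (f n) - ∫ z in D, w z * u z * f n z) atTop (𝓝 0) := by
    rw [Metric.tendsto_atTop]
    intro ε hε
    obtain ⟨K, hK⟩ := hcau (l ^ 2 * (ε / 2) ^ 2 / (M + 1)) (by positivity)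
    refine ⟨K, fun n hn => ?_⟩
    have h1 : ∀ᶠ k in atTop, |mass w (f n) - ∫ z, w z * f k z * f n z| ≤ ε / 2 := by
      filter_upwards [eventually_ge_atTop K] with k hk
      have hsub := (hf n).sub (hf k)
      have e1 : mass w (f n) - ∫ z, w z * f k z * f n z =
          ∫ z, w z * f n z * (f n z - f k z) := by
        rw [mass, ← integral_sub ((hf n).integrable_weight_sq hDo hw)
          ((hf k).integrable_weight_mul hDo hw (hf n).continuous)]
        congr 1; funext z; ring
      have hcs : (∫ z, w z * f n z * (f n z - f k z)) ^ 2 ≤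
          mass w (f n) * mass w (fun z => f n z - f k z) := by
        refine sq_le_mul_of_quadratic_nonneg fun s => ?_
        rw [← mass_add_mul hDo hw (hf n) hsub]
        exact mass_nonneg hw0 ((hf n).add (hsub.const_mul s))
      rw [e1]
      refine abs_le_of_sq_le_sq (hcs.trans ?_) (by positivity)
      have h2 : mass w (f n) ≤ (M + 1) / l := (hmb _ (hf n)).trans
        (div_le_div_of_nonneg_right ((hM n).trans (by linarith)) hl0.le)
      have h3 : mass w (fun z => f n z - f k z) ≤ l ^ 2 * (ε / 2) ^ 2 / (M + 1) / l :=
        (hmb _ hsub).trans (div_le_div_of_nonneg_right (hK n hn k hk) hl0.le)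
      calc _ ≤ (M + 1) / l * (l ^ 2 * (ε / 2) ^ 2 / (M + 1) / l) :=
            mul_le_mul h2 h3 (mass_nonneg hw0 hsub) (by positivity)
        _ = (ε / 2) ^ 2 := by field_simp
    have h2 := le_of_tendsto ((hpol n).const_sub (mass w (f n))).abs h1
    rw [Real.dist_eq, sub_zero]
    linarith
  have hGf : Tendsto (fun n => m * ∫ z in D, w z * u z * f n z) atTop (𝓝 e) := by
    have l1 := tendsto_integral_inner (fun _ => hG) hG
      (fun n => (hf n).memLp_gradient.restrict D) hG (tendsto_eLpNorm_self_sub _) hfG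
    simp only [heq _ (hf _), real_inner_self_eq_norm_sq] at l1
    exact l1
  have hmm : Tendsto (fun n => m * mass w (f n)) atTop (𝓝 e) := by
    have := hGf.add (hdiff.const_mul m)
    simp only [mul_zero, add_zero] at this
    refine this.congr fun n => by ring
  have hm0 : 0 < m := by
    by_contra! hm
    have := le_of_tendsto' hmm (b := 0) fun n =>
      mul_nonpos_of_nonpos_of_nonneg hm (mass_nonneg hw0 (hf n))
    linarith
  have h1 : Tendsto (fun n => l * (m * mass w (f n))) atTop (𝓝 (l * e)) := hmm.const_mul l
  have h2 : l * e ≤ m * e := le_of_tendsto_of_tendsto' h1 (hE.const_mul m) fun n => by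
    have := mul_le_mul_of_nonneg_left (hl _ (hf n)) hm0.le
    linarith
  exact le_of_mul_le_mul_right h2 he0

theorem exists_isTest_mass_pos (hDo : IsOpen D) (hw : ContinuousOn w D) (hw0 : ∀ z ∈ D, 0 ≤ w z)
    (hpos : ∃ z ∈ D, 0 < w z) : ∃ u, IsTest D u ∧ 0 < mass w u := by
  obtain ⟨z, hz, hwz⟩ := hpos
  obtain ⟨r, hr0, hr⟩ := Metric.isOpen_iff.1 hDo z hz
  let b : ContDiffBump z := ⟨r / 4, r / 2, by positivity, by linarith⟩
  have hb : IsTest D b := by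
    refine ⟨b.contDiff, b.hasCompactSupport, ?_⟩
    rw [b.tsupport_eq]
    exact (Metric.closedBall_subset_ball (by simp only [b]; linarith)).trans hr
  refine ⟨b, hb, ?_⟩
  have hc := hb.weight_mul hDo hw hb.continuous
  have e : (fun x => w x * b x ^ 2) = fun x => w x * b x * b x := by funext x; ring
  rw [mass, e]
  refine hc.1.integral_pos_of_hasCompactSupport_nonneg_nonzero hc.2 (fun x => ?_) (x := z) ?_
  · by_cases hx : x ∈ D
    · have := mul_nonneg (hw0 x hx) (mul_self_nonneg (b x))
      simpa [mul_assoc] using this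
    · simp [hb.eq_zero hx]
  · have : b z = 1 := b.one_of_mem_closedBall (Metric.mem_closedBall_self b.rIn_pos.le)
    simp [this, hwz.ne']

/-- Replacing a test function by the smooth approximation `√(u² + ε²) - ε` of its absolute value
does not increase the Dirichlet integral, and changes the mass little. -/
theorem exists_nonneg_isTest (hDo : IsOpen D) (hw : ContinuousOn w D) (hw0 : ∀ z ∈ D, 0 ≤ w z)
    {u : ℂ → ℝ} (hu : IsTest D u) {δ : ℝ} (hδ : 0 < δ) :
    ∃ v, IsTest D v ∧ (∀ z, 0 ≤ v z) ∧ energy v ≤ energy u ∧ mass w u - δ ≤ mass w v := by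
  have hiw : Integrable fun z => w z * |u z| := by
    have hc := hu.weight_mul hDo hw (v := fun _ => 1) continuous_const
    simp only [mul_one] at hc
    refine ((hc.1.integrable_of_hasCompactSupport hc.2).norm).congr
      (Eventually.of_forall fun z => ?_)
    by_cases hz : z ∈ D
    · simp [abs_of_nonneg (hw0 z hz)]
    · simp [hu.eq_zero hz]
  have hA0 : 0 ≤ ∫ z, w z * |u z| := integral_nonneg fun z => by
    by_cases hz : z ∈ D
    · exact mul_nonneg (hw0 z hz) (abs_nonneg _)
    · simp [hu.eq_zero hz]
  set A := ∫ z, w z * |u z| with hA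
  set ε := δ / (2 * (A + 1)) with hε
  have hε0 : 0 < ε := by positivity
  have hεA : 2 * ε * A ≤ δ := by
    have : 2 * ε * (A + 1) = δ := by rw [hε]; field_simp
    nlinarith
  let g : ℝ → ℝ := fun t => Real.sqrt (t ^ 2 + ε ^ 2) - ε
  have hpos (t : ℝ) : 0 < t ^ 2 + ε ^ 2 := by positivity
  have hg : ContDiff ℝ ∞ g :=
    (((contDiff_id.pow 2).add contDiff_const).sqrt fun t => (hpos t).ne').sub contDiff_const
  have hgd (t : ℝ) : HasDerivAt g (t / Real.sqrt (t ^ 2 + ε ^ 2)) t := by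
    have h1 : HasDerivAt (fun t : ℝ => t ^ 2 + ε ^ 2) (2 * t) t := by
      simpa using (hasDerivAt_pow 2 t).add_const (ε ^ 2)
    exact ((h1.sqrt (hpos t).ne').sub_const ε).congr_deriv (mul_div_mul_left _ _ two_ne_zero)
  have hg0 : g 0 = 0 := by simp [g, Real.sqrt_sq hε0.le]
  have hs1 (t : ℝ) : |t| ≤ Real.sqrt (t ^ 2 + ε ^ 2) := Real.abs_le_sqrt (by nlinarith)
  have hs2 (t : ℝ) : ε ≤ Real.sqrt (t ^ 2 + ε ^ 2) := Real.le_sqrt_of_sq_le (by nlinarith)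
  have hs3 (t : ℝ) : Real.sqrt (t ^ 2 + ε ^ 2) ≤ |t| + ε := by
    rw [Real.sqrt_le_left (by positivity)]
    nlinarith [sq_abs t, abs_nonneg t]
  have hv := hu.comp_zero hg hg0
  refine ⟨fun z => g (u z), hv, fun z => sub_nonneg.2 (hs2 _), ?_, ?_⟩
  · refine integral_mono (hv.isTest_gradDot hv).integrable (hu.isTest_gradDot hu).integrable
      fun z => ?_
    simp only [gradDot, pd_comp_real (hgd (u z)) (hu.differentiableAt z)]
    have h1 : (u z / Real.sqrt (u z ^ 2 + ε ^ 2)) ^ 2 ≤ 1 := by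
      rw [div_pow, div_le_one (pow_pos (hε0.trans_le (hs2 _)) 2), Real.sq_sqrt (hpos _).le]
      nlinarith
    have h2 := gradDot_self_nonneg u z
    simp only [gradDot] at h2
    nlinarith
  · have i1 := hu.integrable_weight_sq hDo hw
    have i2 := hv.integrable_weight_sq hDo hw
    have : mass w u - mass w (fun z => g (u z)) ≤ 2 * ε * A := by
      rw [mass, mass, ← integral_sub i1 i2, hA, ← integral_const_mul]
      refine integral_mono (i1.sub i2) (hiw.const_mul _) fun z => ?_
      by_cases hz : z ∈ D
      · have hwz := hw0 z hz
        have h1 := hs1 (u z)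
        have h2 := hs2 (u z)
        have h4 : u z ^ 2 - g (u z) ^ 2 ≤ 2 * ε * |u z| := by
          have : g (u z) = Real.sqrt (u z ^ 2 + ε ^ 2) - ε := rfl
          have h5 := Real.sq_sqrt (hpos (u z)).le
          have h3 := hs3 (u z)
          rw [this]
          nlinarith
        simp only
        calc w z * u z ^ 2 - w z * g (u z) ^ 2 = w z * (u z ^ 2 - g (u z) ^ 2) := by ring
          _ ≤ w z * (2 * ε * |u z|) := mul_le_mul_of_nonneg_left h4 hwz
          _ = _ := by ring
      · simp [hu.eq_zero hz, hg0]
    linarith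

/-- The infimum of the Rayleigh quotient is positive and has a nonnegative minimizing sequence. -/
theorem exists_bottom (hDo : IsOpen D) (hDb : Bornology.IsBounded D)
    (hw : IsCompactWeight D w) (hpos : ∃ z ∈ D, 0 < w z) :
    ∃ l : ℝ, 0 < l ∧ (∀ u, IsTest D u → l * mass w u ≤ energy u) ∧
      ∃ ψ : ℕ → ℂ → ℝ, (∀ k, IsTest D (ψ k)) ∧ (∀ k z, 0 ≤ ψ k z) ∧
        (∀ k, mass w (ψ k) = 1) ∧ Tendsto (fun k => energy (ψ k)) atTop (𝓝 l) := by
  set S := {e | ∃ u, IsTest D u ∧ mass w u = 1 ∧ energy u = e} with hS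
  have hnorm {u : ℂ → ℝ} (hu : IsTest D u) (hm : 0 < mass w u) :
      IsTest D (fun z => (Real.sqrt (mass w u))⁻¹ * u z) ∧
      mass w (fun z => (Real.sqrt (mass w u))⁻¹ * u z) = 1 ∧
      energy (fun z => (Real.sqrt (mass w u))⁻¹ * u z) = energy u / mass w u := by
    refine ⟨hu.const_mul _, ?_, ?_⟩
    · rw [mass_const_mul, inv_pow, Real.sq_sqrt hm.le, inv_mul_cancel₀ hm.ne']
    · rw [energy_const_mul hu, inv_pow, Real.sq_sqrt hm.le]; ring
  have hSne : S.Nonempty := by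
    obtain ⟨u, hu, hm⟩ := exists_isTest_mass_pos hDo hw.1 hw.2.1 hpos
    exact ⟨_, _, (hnorm hu hm).1, (hnorm hu hm).2.1, rfl⟩
  obtain ⟨P, hP0, hP⟩ := exists_poincare hDb
  obtain ⟨C, hC0, hC⟩ := hw.2.2 1 one_pos
  have hSb : (1 + C * P)⁻¹ ∈ lowerBounds S := by
    rintro e ⟨u, hu, hm, rfl⟩
    rw [inv_le_iff_one_le_mul₀' (by positivity)]
    have h1 := hC u hu
    have h2 := mul_le_mul_of_nonneg_left (hP u hu) hC0
    rw [hm] at h1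
    simp only [energy] at h1 ⊢
    linarith
  have hbb : BddBelow S := ⟨_, hSb⟩
  have hl0 : 0 < sInf S := lt_of_lt_of_le (by positivity) (le_csInf hSne hSb)
  refine ⟨sInf S, hl0, fun u hu => ?_, ?_⟩
  · rcases (mass_nonneg hw.2.1 hu).eq_or_lt with h | h
    · rw [← h, mul_zero]; exact energy_nonneg u
    · have := csInf_le hbb ⟨_, (hnorm hu h).1, (hnorm hu h).2.1, rfl⟩
      rw [(hnorm hu h).2.2, le_div_iff₀ h] at this
      exact this
  · have key : ∀ k : ℕ, ∃ v, IsTest D v ∧ (∀ z, 0 ≤ v z) ∧ mass w v = 1 ∧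
        energy v < sInf S + 1 / ((k : ℝ) + 1) := by
      intro k
      have hk : 0 < 1 / ((k : ℝ) + 1) := by positivity
      obtain ⟨e, ⟨u, hu, hm, rfl⟩, hlt⟩ := exists_lt_of_csInf_lt hSne
        (show sInf S < sInf S + 1 / ((k : ℝ) + 1) by linarith)
      set t := sInf S + 1 / ((k : ℝ) + 1) with ht
      have ht0 : 0 < t := by positivity
      -- the loss `δ` of mass is chosen so that `energy u < t (1 - δ)`
      have hδ : 0 < (t - energy u) / (2 * t) := div_pos (by linarith) (by positivity)
      obtain ⟨v, hv, hv0, hve, hvm⟩ := exists_nonneg_isTest hDo hw.1 hw.2.1 hu hδ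
      rw [hm] at hvm
      have h1 : t * ((t - energy u) / (2 * t)) = (t - energy u) / 2 := by field_simp
      have h2 : energy u < t * mass w v := by nlinarith
      have hvp : 0 < mass w v := by
        by_contra! h
        have := mul_nonpos_of_nonneg_of_nonpos ht0.le h
        linarith [energy_nonneg u]
      refine ⟨_, (hnorm hv hvp).1, fun z => mul_nonneg (by positivity) (hv0 z),
        (hnorm hv hvp).2.1, ?_⟩
      rw [(hnorm hv hvp).2.2, div_lt_iff₀ hvp]
      linarith
    choose ψ h1 h2 h3 h4 using key
    refine ⟨ψ, h1, h2, h3, ?_⟩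
    refine tendsto_of_tendsto_of_tendsto_of_le_of_le tendsto_const_nhds
      (h := fun k : ℕ => sInf S + 1 / ((k : ℝ) + 1)) ?_
      (fun k => csInf_le hbb ⟨_, h1 k, h3 k, rfl⟩) (fun k => (h4 k).le)
    simpa using tendsto_one_div_add_atTop_nhds_zero_nat.const_add (sInf S)

/-- The infimum of the Rayleigh quotient is attained and is the least eigenvalue. -/
theorem isLeast_isWeightedEigenvalue (hDo : IsOpen D) (hDb : Bornology.IsBounded D)
    (hw : IsCompactWeight D w) (hl0 : 0 < l) (hl : ∀ u, IsTest D u → l * mass w u ≤ energy u)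
    {ψ : ℕ → ℂ → ℝ} (hψ : ∀ k, IsTest D (ψ k)) (hm : ∀ k, mass w (ψ k) = 1)
    (he : Tendsto (fun k => energy (ψ k)) atTop (𝓝 l)) :
    IsLeast {m | IsWeightedEigenvalue w D m} l := by
  refine ⟨?_, fun m hm => le_of_isWeightedEigenvalue hDo hDb hw.1 hw.2.1 hl0 hl hm⟩
  obtain ⟨φ, -, U, G, h1, h2, h3, -⟩ := exists_eigenfunction_of_minimizing hDo hDb hw hl0.le hl hψ
    (by simp [hm]) he
  exact ⟨U, G, h1, h2, h3⟩

end Spectral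

/-! ### The strong maximum principle for weak supersolutions -/

section Barrier

variable {F : ℂ → ℝ} {z a : ℂ}

theorem lap_comp_real {g g' : ℝ → ℝ} {g'' : ℝ}
    (hg : ∀ᶠ t in 𝓝 (F z), HasDerivAt g (g' t) t) (hg' : HasDerivAt g' g'' (F z))
    (hF : ContDiffAt ℝ 2 F z) :
    lap (fun w => g (F w)) z = g'' * gradDot F F z + g' (F z) * lap F z := by
  have h (v : ℂ) : pd v (fun w => g (F w)) =ᶠ[𝓝 z] fun w => g' (F w) * pd v F w := by
    filter_upwards [hF.continuousAt.eventually hg, eventually_differentiableAt hF] with w h1 h2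
    exact pd_comp_real h1 h2
  have hd : DifferentiableAt ℝ (fun w => g' (F w)) z :=
    hg'.differentiableAt.comp z (hF.differentiableAt (by simp))
  simp only [lap, gradDot, pd_congr (h _), pd_mul hd (differentiableAt_pd hF),
    pd_comp_real hg' (hF.differentiableAt (by simp))]
  ring

theorem pd_re_sub (v : ℂ) (c : ℝ) : pd v (fun w => w.re - c) z = v.re := by
  have h : HasFDerivAt (fun w : ℂ => w.re - c) Complex.reCLM z :=
    Complex.reCLM.hasFDerivAt.sub_const c
  rw [pd, h.fderiv]; rfl

theorem pd_im_sub (v : ℂ) (c : ℝ) : pd v (fun w => w.im - c) z = v.im := by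
  have h : HasFDerivAt (fun w : ℂ => w.im - c) Complex.imCLM z :=
    Complex.imCLM.hasFDerivAt.sub_const c
  rw [pd, h.fderiv]; rfl

theorem contDiff_re_sub (c : ℝ) : ContDiff ℝ ∞ fun w : ℂ => w.re - c :=
  Complex.reCLM.contDiff.sub contDiff_const

theorem contDiff_im_sub (c : ℝ) : ContDiff ℝ ∞ fun w : ℂ => w.im - c :=
  Complex.imCLM.contDiff.sub contDiff_const

/-- The function `r² - |w - a|²`. -/
noncomputable def discFun (a : ℂ) (r : ℝ) (w : ℂ) : ℝ :=
  r ^ 2 - ((w.re - a.re) * (w.re - a.re) + (w.im - a.im) * (w.im - a.im))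

theorem discFun_eq (a : ℂ) (r : ℝ) (w : ℂ) : discFun a r w = r ^ 2 - ‖w - a‖ ^ 2 := by
  rw [discFun, Complex.sq_norm, Complex.normSq_apply]
  simp

theorem contDiff_discFun (a : ℂ) (r : ℝ) : ContDiff ℝ ∞ (discFun a r) := by
  have h1 := contDiff_re_sub a.re
  have h2 := contDiff_im_sub a.im
  exact contDiff_const.sub ((h1.mul h1).add (h2.mul h2))

theorem pd_discFun (a : ℂ) (r : ℝ) (v z : ℂ) :
    pd v (discFun a r) z = -2 * ((z.re - a.re) * v.re + (z.im - a.im) * v.im) := by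
  have h1 : DifferentiableAt ℝ (fun w : ℂ => w.re - a.re) z :=
    (contDiff_re_sub a.re).differentiable (by simp) z
  have h2 : DifferentiableAt ℝ (fun w : ℂ => w.im - a.im) z :=
    (contDiff_im_sub a.im).differentiable (by simp) z
  change pd v (fun w => r ^ 2 - ((w.re - a.re) * (w.re - a.re) + (w.im - a.im) * (w.im - a.im))) z
    = _
  rw [pd_sub (differentiableAt_const _) ((h1.fun_mul h1).fun_add (h2.fun_mul h2)),
    pd_add (h1.fun_mul h1) (h2.fun_mul h2), pd_mul h1 h1, pd_mul h2 h2, pd_const, pd_re_sub,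
    pd_im_sub]
  ring

theorem gradDot_discFun (a : ℂ) (r : ℝ) (z : ℂ) :
    gradDot (discFun a r) (discFun a r) z = 4 * ‖z - a‖ ^ 2 := by
  rw [Complex.sq_norm, Complex.normSq_apply]
  simp only [gradDot, pd_discFun]
  simp
  ring

theorem lap_discFun (a : ℂ) (r : ℝ) (z : ℂ) : lap (discFun a r) z = -4 := by
  have h (v : ℂ) : pd v (discFun a r) =
      fun w => -2 * v.re * (w.re - a.re) + -2 * v.im * (w.im - a.im) := by
    funext w; rw [pd_discFun]; ring
  have h1 : DifferentiableAt ℝ (fun w : ℂ => w.re - a.re) z :=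
    (contDiff_re_sub a.re).differentiable (by simp) z
  have h2 : DifferentiableAt ℝ (fun w : ℂ => w.im - a.im) z :=
    (contDiff_im_sub a.im).differentiable (by simp) z
  simp only [lap, h, pd_add (h1.const_mul _) (h2.const_mul _), pd_const_mul _ h1,
    pd_const_mul _ h2, pd_re_sub, pd_im_sub]
  simp
  norm_num

/-- A nonnegative function supported in a disc which is strictly subharmonic off a smaller
concentric disc. -/
theorem exists_barrier (a : ℂ) {s r : ℝ} (hs : 0 < s) (hsr : s < r) :
    ∃ v : ℂ → ℝ, IsTest (Metric.closedBall a r) v ∧ (∀ z, 0 ≤ v z) ∧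
      ∀ z, s ≤ ‖z - a‖ → ‖z - a‖ < r → 0 < lap v z := by
  have hr : 0 < r := hs.trans hsr
  -- large enough for the exponential decay to dominate the first order terms when `|z - a| ≥ s`
  set m : ℝ := 2 * r ^ 2 + r ^ 4 / s ^ 2 + 1 with hm
  have hm0 : 0 < m := by positivity
  let v : ℂ → ℝ := fun w => expNegInvGlue (discFun a r w / m)
  have hv0 (w : ℂ) (hw : r ≤ ‖w - a‖) : v w = 0 := by
    refine expNegInvGlue.zero_of_nonpos (div_nonpos_of_nonpos_of_nonneg ?_ hm0.le)
    rw [discFun_eq]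
    nlinarith
  refine ⟨v, ⟨?_, ?_, ?_⟩, fun w => expNegInvGlue.nonneg _, fun z hz1 hz2 => ?_⟩
  · exact expNegInvGlue.contDiff.comp ((contDiff_discFun a r).div_const m)
  · refine HasCompactSupport.intro (isCompact_closedBall a r) fun w hw => hv0 w ?_
    rw [mem_closedBall_iff_norm, not_le] at hw
    exact hw.le
  · refine closure_minimal (fun w hw => ?_) Metric.isClosed_closedBall
    rw [mem_closedBall_iff_norm]
    by_contra! h
    exact hw (hv0 w h.le)
  · have hx : 0 < discFun a r z := by rw [discFun_eq]; nlinarith [norm_nonneg (z - a)]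
    have hE (t : ℝ) (ht : 0 < t) :
        HasDerivAt (fun t => Real.exp (-(m * t⁻¹))) (Real.exp (-(m * t⁻¹)) * (m * (t ^ 2)⁻¹)) t := by
      refine ((hasDerivAt_inv ht.ne').const_mul m).neg.exp.congr_deriv ?_
      simp only [Pi.neg_apply]
      ring
    have hE' (t : ℝ) (ht : 0 < t) :
        HasDerivAt (fun t => Real.exp (-(m * t⁻¹)) * (m * (t ^ 2)⁻¹))
          (Real.exp (-(m * t⁻¹)) * (m ^ 2 * (t ^ 4)⁻¹ - 2 * m * (t ^ 3)⁻¹)) t := by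
      have h2 := ((hasDerivAt_pow 2 t).inv (pow_ne_zero 2 ht.ne')).const_mul m
      have := (hE t ht).mul h2
      refine this.congr_deriv ?_
      simp only [Pi.inv_apply]
      field_simp
      ring
    have hev : v =ᶠ[𝓝 z] fun w => (fun t => Real.exp (-(m * t⁻¹))) (discFun a r w) := by
      filter_upwards [(contDiff_discFun a r).continuous.continuousAt.eventually (lt_mem_nhds hx)]
        with w hw
      simp only [v, expNegInvGlue]
      rw [if_neg (not_le.2 (div_pos hw hm0)), inv_div, div_eq_mul_inv]
    have hC : ContDiffAt ℝ 2 (discFun a r) z :=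
      ((contDiff_discFun a r).of_le (by norm_cast)).contDiffAt
    rw [lap_congr hev, lap_comp_real ((lt_mem_nhds hx).mono fun t ht => hE t ht) (hE' _ hx) hC,
      gradDot_discFun, lap_discFun]
    set x := discFun a r z with hxd
    set t := ‖z - a‖ ^ 2 with ht
    have htx : t = r ^ 2 - x := by rw [hxd, discFun_eq]; ring
    have hts : s ^ 2 ≤ t := pow_le_pow_left₀ hs.le hz1 2
    have hs2 : 0 < s ^ 2 := by positivity
    have hxr : x ≤ r ^ 2 := by linarith
    have key : 0 < m * t - 2 * x * t - x ^ 2 := by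
      have h1 : r ^ 4 / s ^ 2 * s ^ 2 = r ^ 4 := by field_simp
      have h2 : r ^ 4 ≤ r ^ 4 / s ^ 2 * t := by
        calc r ^ 4 = r ^ 4 / s ^ 2 * s ^ 2 := h1.symm
          _ ≤ _ := mul_le_mul_of_nonneg_left hts (by positivity)
      have h3 : x ^ 2 ≤ r ^ 4 := by nlinarith
      have h4 : m * t - 2 * x * t - x ^ 2 =
        2 * (r ^ 2 - x) * t + (r ^ 4 / s ^ 2 * t - x ^ 2) + t := by rw [hm]; ring
      have h5 : 0 ≤ 2 * (r ^ 2 - x) * t := by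
        have : 0 ≤ r ^ 2 - x := by linarith
        have : 0 ≤ t := by linarith
        positivity
      rw [h4]; linarith
    have e : Real.exp (-(m * x⁻¹)) * (m ^ 2 * (x ^ 4)⁻¹ - 2 * m * (x ^ 3)⁻¹) * (4 * t) +
        Real.exp (-(m * x⁻¹)) * (m * (x ^ 2)⁻¹) * -4 =
        4 * m * Real.exp (-(m * x⁻¹)) * (x ^ 4)⁻¹ * (m * t - 2 * x * t - x ^ 2) := by
      field_simp
      ring
    rw [e]
    positivity

end Barrier

section MaximumPrinciple

variable {D D₀ : Set ℂ} {u : ℂ → ℝ}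

theorem IsTest.lap (hu : IsTest D u) : IsTest D (lap u) :=
  ((hu.isTest_pd 1).isTest_pd 1).add ((hu.isTest_pd Complex.I).isTest_pd Complex.I)

/-- The strong maximum principle for nonnegative square integrable supersolutions: the barrier
spreads the vanishing from a disc to each larger concentric disc. -/
theorem ae_eq_zero_of_supersolution (hD₀ : IsOpen D₀) (hc : IsPreconnected D₀) (hsub : D₀ ⊆ D)
    (hDm : MeasurableSet D) (hu : MemLp u 2 (volume.restrict D))
    (hu0 : ∀ᵐ z ∂volume.restrict D, 0 ≤ u z)
    (hs : ∀ v, IsTest D₀ v → (∀ z, 0 ≤ v z) → ∫ z in D, u z * lap v z ≤ 0)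
    {a : ℂ} {ρ : ℝ} (ha : a ∈ D₀) (hρ : 0 < ρ) (hz : ∀ᵐ z, z ∈ Metric.ball a ρ → u z = 0) :
    ∀ᵐ z, z ∈ D₀ → u z = 0 := by
  have hu0' : ∀ᵐ z, z ∈ D → 0 ≤ u z := (ae_restrict_iff' hDm).1 hu0
  -- tested with the barrier, `u * lap v` has a nonpositive integral and is itself nonnegative
  have spread {b : ℂ} {s r : ℝ} (hs0 : 0 < s) (hsr : s < r) (hb : Metric.closedBall b r ⊆ D₀)
      (hzb : ∀ᵐ z, z ∈ Metric.ball b s → u z = 0) : ∀ᵐ z, z ∈ Metric.ball b r → u z = 0 := by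
    obtain ⟨v, hv, hv0, hvl⟩ := exists_barrier b hs0 hsr
    have hint : Integrable (fun z => u z * lap v z) (volume.restrict D) :=
      hu.integrable_mul (hv.lap.memLp.restrict D)
    have hsph : ∀ᵐ z, z ∉ Metric.sphere b r := by
      rw [ae_iff]
      simp only [not_not]
      exact Measure.addHaar_sphere volume b r
    have hnn : ∀ᵐ z ∂volume.restrict D, 0 ≤ u z * lap v z := by
      rw [ae_restrict_iff' hDm]
      filter_upwards [hu0', hzb, hsph] with z h1 h2 h3 hzD
      rcases lt_or_ge ‖z - b‖ s with h | h
      · rw [h2 (by rwa [mem_ball_iff_norm]), zero_mul]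
      · rcases lt_trichotomy ‖z - b‖ r with h' | h' | h'
        · exact mul_nonneg (h1 hzD) (hvl z h h').le
        · exact absurd (mem_sphere_iff_norm.2 h') h3
        · rw [hv.lap.eq_zero (z := z) (by rw [mem_closedBall_iff_norm]; exact not_le.2 h'),
            mul_zero]
    have h0 : ∫ z in D, u z * lap v z = 0 :=
      le_antisymm (hs v (hv.mono hb) hv0) (integral_nonneg_of_ae hnn)
    rw [integral_eq_zero_iff_of_nonneg_ae hnn hint, EventuallyEq, ae_restrict_iff' hDm] at h0
    filter_upwards [h0, hzb] with z h1 h2 hzr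
    rcases lt_or_ge ‖z - b‖ s with h | h
    · exact h2 (by rwa [mem_ball_iff_norm])
    · have hzr' : ‖z - b‖ < r := mem_ball_iff_norm.1 hzr
      have := h1 (hsub (hb (Metric.ball_subset_closedBall hzr)))
      exact (mul_eq_zero.1 this).resolve_right (hvl z h hzr').ne'
  -- the points near which `u` vanishes form an open set which is closed in `D₀`
  set Z := {z : ℂ | ∃ ρ > 0, ∀ᵐ w, w ∈ Metric.ball z ρ → u w = 0} with hZ
  have hZo : IsOpen Z := by
    rw [Metric.isOpen_iff]
    rintro z ⟨ρ, hρ, h⟩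
    refine ⟨ρ / 2, by positivity, fun y hy => ⟨ρ / 2, by positivity, ?_⟩⟩
    filter_upwards [h] with w hw hwy
    refine hw (Metric.ball_subset_ball' ?_ hwy)
    rw [Metric.mem_ball] at hy
    linarith
  have hsubZ : D₀ ⊆ Z := by
    refine hc.subset_of_closure_inter_subset hZo ⟨a, ha, ρ, hρ, hz⟩ ?_
    rintro z ⟨hzc, hzD⟩
    obtain ⟨r, hr0, hr⟩ := Metric.isOpen_iff.1 hD₀ z hzD
    obtain ⟨y, ⟨s, hs0, hy⟩, hyz⟩ := Metric.mem_closure_iff.1 hzc (r / 4) (by positivity)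
    refine ⟨r / 4, by positivity, ?_⟩
    have hb : Metric.closedBall y (r / 2) ⊆ D₀ := by
      refine (Metric.closedBall_subset_ball' ?_).trans hr
      rw [dist_comm]; linarith
    have h1 := spread (b := y) (s := min s (r / 4)) (r := r / 2) (by positivity)
      ((min_le_right _ _).trans_lt (by linarith)) hb (by
        filter_upwards [hy] with w hw hwy
        exact hw (Metric.ball_subset_ball (min_le_left _ _) hwy))
    filter_upwards [h1] with w hw hwz
    refine hw (Metric.ball_subset_ball' ?_ hwz)
    linarith
  rw [ae_iff]
  refine measure_null_of_locally_null _ fun x hx => ?_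
  rw [Set.mem_ofPred_eq, Classical.not_imp] at hx
  obtain ⟨σ, hσ0, hσ⟩ := hsubZ hx.1
  refine ⟨{w | ¬ (w ∈ Metric.ball x σ → u w = 0)}, ?_, hσ⟩
  rw [mem_nhdsWithin]
  refine ⟨Metric.ball x σ, Metric.isOpen_ball, Metric.mem_ball_self hσ0, ?_⟩
  rintro w ⟨hw1, hw2⟩ h
  exact hw2 fun _ => h hw1

/-- The weak gradient of a function in `H¹₀` is its distributional gradient. -/
theorem MemH10.integral_inner_gradient {G : ℂ → ℂ} (h : MemH10 D u G) {v : ℂ → ℝ}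
    (hv : IsTest D v) : ∫ z in D, inner ℝ (G z) (gradient v z) = -∫ z in D, u z * lap v z := by
  obtain ⟨hu, hG, f, hf, hfu, hfG⟩ := h
  have l1 := tendsto_integral_inner (fun k => (hf k).memLp_gradient.restrict D) hG
    (fun _ => hv.memLp_gradient.restrict D) (hv.memLp_gradient.restrict D) hfG
    (tendsto_eLpNorm_self_sub _)
  have l2 := tendsto_integral_inner (fun k => (hf k).memLp.restrict D) hu
    (fun _ => hv.lap.memLp.restrict D) (hv.lap.memLp.restrict D) hfu (tendsto_eLpNorm_self_sub _)
  have e (g : ℂ → ℝ) : ∫ z in D, inner ℝ (g z) (lap v z) = ∫ z in D, g z * lap v z := by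
    simp [mul_comm]
  simp only [inner_gradient, (hf _).setIntegral_gradDot] at l1
  simp only [e, hv.lap.setIntegral_eq (h := f _)] at l2
  refine tendsto_nhds_unique l1 (l2.neg.congr fun n => ?_)
  rw [integral_gradDot_eq_neg_integral_mul_lap (hf n).1 (hf n).2.1 fun z _ => hv.contDiffAt z]

end MaximumPrinciple

/-! ### The equations of a conformal map to the sphere -/

/-- The coordinate of the map `N` in the direction `c`. -/
noncomputable def coord (N : ℂ → S2) (c : E3) (z : ℂ) : ℝ := inner ℝ c (N z : E3)

/-- The density `|∇N|² / 2` of the area covered by a conformal map. -/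
noncomputable def areaDensity (N : ℂ → S2) (z : ℂ) : ℝ := 1 / 2 * gradSq N z

/-- `N` is smooth at `z` and satisfies there the equations of a weakly conformal harmonic map to
the sphere, with area density `κ`, expressed through the coordinates of `N`. These equations are
invariant under all linear isometries, also those reversing the orientation. -/
def IsConformalHarmonicAt (N : ℂ → S2) (κ : ℝ) (z : ℂ) : Prop :=
  (∀ c, ContDiffAt ℝ ∞ (coord N c) z) ∧
  (∀ c d, gradDot (coord N c) (coord N d) z = κ * (inner ℝ c d - coord N c z * coord N d z)) ∧
  ∀ c, lap (coord N c) z = -2 * κ * coord N c z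

theorem inner_E3 (c d : E3) : inner ℝ c d = c 0 * d 0 + c 1 * d 1 + c 2 * d 2 := by
  rw [PiLp.inner_apply, Fin.sum_univ_three]
  simp [mul_comm]

theorem inner_single_E3 (i : Fin 3) (x : E3) :
    inner ℝ (EuclideanSpace.single i (1 : ℝ) : E3) x = x i := by
  fin_cases i <;> simp [inner_E3]

theorem norm_sq_E3 (c : E3) : ‖c‖ ^ 2 = c 0 ^ 2 + c 1 ^ 2 + c 2 ^ 2 := by
  rw [← real_inner_self_eq_norm_sq, inner_E3]; ring

theorem sphere_eq (x : S2) : (x : E3) 0 ^ 2 + (x : E3) 1 ^ 2 + (x : E3) 2 ^ 2 = 1 := by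
  rw [← norm_sq_E3, norm_eq_of_mem_sphere, one_pow]

section Equations

variable {N M : ℂ → S2} {κ : ℝ} {z : ℂ}

theorem contDiffAt_two {F : ℂ → ℝ} (h : ContDiffAt ℝ ∞ F z) : ContDiffAt ℝ 2 F z :=
  h.of_le (by norm_cast)

theorem IsConformalHarmonicAt.contDiffAt (h : IsConformalHarmonicAt N κ z) :
    ContDiffAt ℝ ∞ (fun w => (N w : E3)) z := by
  rw [contDiffAt_euclidean]
  intro i
  refine (h.1 (EuclideanSpace.single i 1)).congr_of_eventuallyEq (Eventually.of_forall fun w => ?_)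
  simp only [coord, inner_single_E3]

theorem IsConformalHarmonicAt.areaDensity_eq (h : IsConformalHarmonicAt N κ z) :
    areaDensity N z = κ := by
  have hd : DifferentiableAt ℝ (fun w => (N w : E3)) z := h.contDiffAt.differentiableAt (by simp)
  have hp (c : E3) (v : ℂ) :
      pd v (coord N c) z = inner ℝ c (fderiv ℝ (fun w => (N w : E3)) z v) := by
    have := ((innerSL ℝ c).hasFDerivAt.comp z hd.hasFDerivAt).fderiv
    rw [pd, show coord N c = (innerSL ℝ c) ∘ fun w => (N w : E3) from rfl, this]
    simp
  have hn (x : E3) : ‖x‖ ^ 2 = ∑ i : Fin 3, (inner ℝ (EuclideanSpace.single i (1 : ℝ)) x) ^ 2 := by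
    rw [norm_sq_E3, Fin.sum_univ_three]; simp only [inner_single_E3]
  have h1 (i : Fin 3) := h.2.1 (EuclideanSpace.single i 1) (EuclideanSpace.single i 1)
  have hs : ∑ i : Fin 3, coord N (EuclideanSpace.single i 1) z ^ 2 = 1 := by
    rw [Fin.sum_univ_three]; simp only [coord, inner_single_E3]; exact sphere_eq (N z)
  have h2 : gradSq N z = ∑ i : Fin 3, gradDot (coord N (EuclideanSpace.single i 1))
      (coord N (EuclideanSpace.single i 1)) z := by
    rw [gradSq, hn, hn, ← Finset.sum_add_distrib]
    simp only [gradDot, hp, pow_two]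
  have h3 : gradSq N z = 2 * κ := by
    rw [h2, Finset.sum_congr rfl fun i _ => h1 i]
    have hi (i : Fin 3) : inner ℝ (EuclideanSpace.single i (1 : ℝ) : E3)
        (EuclideanSpace.single i (1 : ℝ)) = 1 := by simp
    simp only [hi, ← pow_two, ← Finset.mul_sum, Finset.sum_sub_distrib, hs]
    simp
    ring
  rw [areaDensity, h3]; ring

theorem IsConformalHarmonicAt.nonneg (h : IsConformalHarmonicAt N κ z) : 0 ≤ κ := by
  rw [← h.areaDensity_eq, areaDensity, gradSq]; positivity

/-- The equations are preserved by precomposition of the coordinates with a map preserving inner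
products. -/
theorem IsConformalHarmonicAt.of_coord_eq (h : IsConformalHarmonicAt M κ z) {T : E3 → E3}
    (hT : ∀ c d, (inner ℝ (T c) (T d) : ℝ) = inner ℝ c d)
    (hN : ∀ c, coord N c =ᶠ[𝓝 z] coord M (T c)) : IsConformalHarmonicAt N κ z := by
  refine ⟨fun c => (h.1 (T c)).congr_of_eventuallyEq (hN c), fun c d => ?_, fun c => ?_⟩
  · rw [gradDot_congr (hN c) (hN d), h.2.1, hT, (hN c).self_of_nhds, (hN d).self_of_nhds]
  · rw [lap_congr (hN c), h.2.2, (hN c).self_of_nhds]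

/-- Inverse stereographic projection turns a weakly conformal harmonic map to the plane into a
conformal harmonic map to the sphere. -/
theorem isConformalHarmonicAt_invStereo {a b : ℂ → ℝ} {J : ℝ} (ha : ContDiffAt ℝ ∞ a z)
    (hb : ContDiffAt ℝ ∞ b z) (haa : gradDot a a z = J) (hbb : gradDot b b z = J)
    (hab : gradDot a b z = 0) (hla : lap a z = 0) (hlb : lap b z = 0) :
    IsConformalHarmonicAt (fun w => invStereo ⟨a w, b w⟩)
      (4 * J * ((1 + (a z * a z + b z * b z))⁻¹) ^ 2) z := by
  let P : ℂ → ℝ := fun w => 1 + (a w * a w + b w * b w)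
  let q : ℂ → ℝ := fun w => (P w)⁻¹
  have hP0 (w : ℂ) : 0 < P w := by
    have := mul_self_nonneg (a w); have := mul_self_nonneg (b w)
    simp only [P]; linarith
  have hPC : ContDiffAt ℝ ∞ P z := contDiffAt_const.add ((ha.mul ha).add (hb.mul hb))
  have hqC : ContDiffAt ℝ ∞ q z := hPC.inv (hP0 z).ne'
  have ha2 := contDiffAt_two ha
  have hb2 := contDiffAt_two hb
  have hP2 := contDiffAt_two hPC
  have hq2 := contDiffAt_two hqC
  have da := ha2.differentiableAt (by simp)
  have db := hb2.differentiableAt (by simp)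
  have dP := hP2.differentiableAt (by simp)
  have dq := hq2.differentiableAt (by simp)
  have pP (v : ℂ) : pd v P z = 2 * (a z * pd v a z + b z * pd v b z) := by
    change pd v (fun w => 1 + (a w * a w + b w * b w)) z = _
    rw [pd_add (differentiableAt_const _) ((da.fun_mul da).fun_add (db.fun_mul db)),
      pd_add (da.fun_mul da) (db.fun_mul db), pd_mul da da, pd_mul db db, pd_const]
    ring
  have pq (v : ℂ) : pd v q z = -(q z ^ 2) * pd v P z := by
    rw [pd_comp_real (hasDerivAt_inv (hP0 z).ne') dP, inv_pow]
  have lP : lap P z = 4 * J := by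
    change lap (fun w => 1 + (a w * a w + b w * b w)) z = _
    rw [lap_add contDiffAt_const ((ha2.mul ha2).add (hb2.mul hb2)),
      lap_add (ha2.mul ha2) (hb2.mul hb2), lap_mul ha2 ha2, lap_mul hb2 hb2, lap_const, haa, hbb,
      hla, hlb]
    ring
  have gP : gradDot P P z = 4 * J * (a z ^ 2 + b z ^ 2) := by
    simp only [gradDot] at haa hbb hab ⊢
    simp only [pP]
    linear_combination 4 * a z ^ 2 * haa + 4 * b z ^ 2 * hbb + 8 * a z * b z * hab
  have lq : lap q z = 8 * J * q z ^ 3 * (a z ^ 2 + b z ^ 2) - 4 * J * q z ^ 2 := by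
    have hd : HasDerivAt (fun t : ℝ => -(t ^ 2)⁻¹) (2 * ((P z) ^ 3)⁻¹) (P z) := by
      refine ((hasDerivAt_pow 2 (P z)).fun_inv (pow_ne_zero 2 (hP0 z).ne')).neg.congr_deriv ?_
      have := (hP0 z).ne'
      field_simp
      ring
    have := lap_comp_real (g := fun t => t⁻¹)
      ((lt_mem_nhds (hP0 z)).mono fun t ht => hasDerivAt_inv (ne_of_gt ht)) hd hP2
    rw [show q = fun w => (fun t : ℝ => t⁻¹) (P w) from rfl, this, gP, lP]
    simp only [inv_pow]
    ring
  have gaq : gradDot a q z = -2 * J * a z * q z ^ 2 := by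
    simp only [gradDot] at haa hab ⊢
    simp only [pq, pP]
    linear_combination (-2 * q z ^ 2 * a z) * haa + (-2 * q z ^ 2 * b z) * hab
  have gbq : gradDot b q z = -2 * J * b z * q z ^ 2 := by
    simp only [gradDot] at hbb hab ⊢
    simp only [pq, pP]
    linear_combination (-2 * q z ^ 2 * b z) * hbb + (-2 * q z ^ 2 * a z) * hab
  have hq : q z * (1 + (a z ^ 2 + b z ^ 2)) = 1 := by
    have : q z * P z = 1 := inv_mul_cancel₀ (hP0 z).ne'
    simp only [P] at this
    linear_combination this
  have hF (c : E3) : coord (fun w => invStereo ⟨a w, b w⟩) c = fun w =>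
      2 * c 0 * (a w * q w) + (2 * c 1 * (b w * q w) + (-2 * c 2 * q w + c 2)) := by
    funext w
    have hn : ‖(⟨a w, b w⟩ : ℂ)‖ ^ 2 = a w * a w + b w * b w := by
      rw [Complex.sq_norm, Complex.normSq_apply]
    have h1 : (1 + (a w * a w + b w * b w)) ≠ 0 := (hP0 w).ne'
    rw [coord, inner_E3]
    simp only [invStereo, hn, q, P]
    simp
    field_simp
    ring
  have d1 := da.fun_mul dq
  have d2 := db.fun_mul dq
  have c1 := ha2.mul hq2
  have c2 := hb2.mul hq2
  have pF (c : E3) (v : ℂ) : pd v (coord (fun w => invStereo ⟨a w, b w⟩) c) z =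
      2 * c 0 * (a z * pd v q z + q z * pd v a z) +
        (2 * c 1 * (b z * pd v q z + q z * pd v b z) + -2 * c 2 * pd v q z) := by
    rw [hF, pd_add (d1.const_mul _) ((d2.const_mul _).fun_add ((dq.const_mul _).add_const _)),
      pd_add (d2.const_mul _) ((dq.const_mul _).add_const _),
      pd_add (dq.const_mul _) (differentiableAt_const _), pd_const_mul _ d1, pd_const_mul _ d2,
      pd_const_mul _ dq, pd_mul da dq, pd_mul db dq, pd_const, add_zero]
  refine ⟨fun c => ?_, fun c d => ?_, fun c => ?_⟩
  · rw [hF]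
    exact (contDiffAt_const.mul (ha.mul hqC)).add ((contDiffAt_const.mul (hb.mul hqC)).add
      ((contDiffAt_const.mul hqC).add contDiffAt_const))
  · have hqz : (1 + (a z * a z + b z * b z))⁻¹ = q z := rfl
    rw [hqz]
    have ec := congrFun (hF c) z
    have ed := congrFun (hF d) z
    rw [ec, ed, inner_E3]
    simp only [gradDot] at haa hbb hab ⊢
    simp only [pF, pq, pP]
    set L := 2 * (c 0 * a z + c 1 * b z - c 2) with hL
    set L' := 2 * (d 0 * a z + d 1 * b z - d 2) with hL'
    -- the gradients of the coordinates are `A ∇a + B ∇b` and `A' ∇a + B' ∇b`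
    set A := 2 * q z * c 0 - 2 * q z ^ 2 * a z * L with hA
    set B := 2 * q z * c 1 - 2 * q z ^ 2 * b z * L with hB
    set A' := 2 * q z * d 0 - 2 * q z ^ 2 * a z * L' with hA'
    set B' := 2 * q z * d 1 - 2 * q z ^ 2 * b z * L' with hB'
    linear_combination A * A' * haa + (A * B' + A' * B) * hab + B * B' * hbb +
      4 * J * q z ^ 3 * L * L' * hq
  · have hqz : (1 + (a z * a z + b z * b z))⁻¹ = q z := rfl
    rw [hqz]
    have ec := congrFun (hF c) z
    rw [ec, hF, lap_add (contDiffAt_const.mul c1) ((contDiffAt_const.mul c2).add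
      ((contDiffAt_const.mul hq2).add contDiffAt_const)),
      lap_add (contDiffAt_const.mul c2) ((contDiffAt_const.mul hq2).add contDiffAt_const),
      lap_add (contDiffAt_const.mul hq2) contDiffAt_const, lap_const_mul _ c1, lap_const_mul _ c2,
      lap_const_mul _ hq2, lap_mul ha2 hq2, lap_mul hb2 hq2, lap_const, gaq, gbq, lq, hla, hlb]
    linear_combination (16 * J * q z ^ 2 * (c 0 * a z + c 1 * b z - c 2)) * hq

/-- Stereographic projection turns a conformal harmonic map to the sphere into a weakly conformal
harmonic map to the plane. Here `e` is the pole, and `c`, `d` are orthogonal to it. -/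
theorem IsConformalHarmonicAt.stereographic (h : IsConformalHarmonicAt N κ z) {e : E3}
    (he : ‖e‖ = 1) (hz : coord N e z ≠ 1) :
    (∀ c, ContDiffAt ℝ ∞ (fun w => coord N c w * (1 - coord N e w)⁻¹) z) ∧
    (∀ c d, (inner ℝ c e : ℝ) = 0 → (inner ℝ d e : ℝ) = 0 →
      gradDot (fun w => coord N c w * (1 - coord N e w)⁻¹)
        (fun w => coord N d w * (1 - coord N e w)⁻¹) z =
        κ * (1 - coord N e z)⁻¹ ^ 2 * inner ℝ c d) ∧
    ∀ c, (inner ℝ c e : ℝ) = 0 → lap (fun w => coord N c w * (1 - coord N e w)⁻¹) z = 0 := by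
  have hh0 : 1 - coord N e z ≠ 0 := sub_ne_zero.2 (Ne.symm hz)
  let H : ℂ → ℝ := fun w => 1 - coord N e w
  let q : ℂ → ℝ := fun w => (H w)⁻¹
  have hHC : ContDiffAt ℝ ∞ H z := contDiffAt_const.sub (h.1 e)
  have hqC : ContDiffAt ℝ ∞ q z := hHC.inv hh0
  have hH2 := contDiffAt_two hHC
  have hq2 := contDiffAt_two hqC
  have hc2 (c : E3) := contDiffAt_two (h.1 c)
  have dc (c : E3) := (hc2 c).differentiableAt (by simp)
  have dH := hH2.differentiableAt (by simp)
  have dq := hq2.differentiableAt (by simp)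
  have hee : (inner ℝ e e : ℝ) = 1 := by rw [real_inner_self_eq_norm_sq, he, one_pow]
  have pH (v : ℂ) : pd v H z = -pd v (coord N e) z := by
    change pd v (fun w => 1 - coord N e w) z = _
    rw [pd_sub (differentiableAt_const _) (dc e), pd_const, zero_sub]
  have pq (v : ℂ) : pd v q z = q z ^ 2 * pd v (coord N e) z := by
    rw [pd_comp_real (hasDerivAt_inv hh0) dH, pH]
    simp only [q, inv_pow, H]; ring
  have gH : gradDot H H z = κ * (1 - coord N e z ^ 2) := by
    have := h.2.1 e e
    rw [hee] at this
    simp only [gradDot] at this ⊢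
    simp only [pH]
    linear_combination this
  have lH : lap H z = 2 * κ * coord N e z := by
    have e1 : H = fun w => 1 + -1 * coord N e w := by funext w; simp only [H]; ring
    rw [e1, lap_add contDiffAt_const (contDiffAt_const.mul (hc2 e)), lap_const,
      lap_const_mul _ (hc2 e), h.2.2]
    ring
  have hqH : q z * (1 - coord N e z) = 1 := inv_mul_cancel₀ hh0
  have lq : lap q z = 2 * q z ^ 3 * (κ * (1 - coord N e z ^ 2)) -
      q z ^ 2 * (2 * κ * coord N e z) := by
    have hd : HasDerivAt (fun t : ℝ => -(t ^ 2)⁻¹) (2 * ((H z) ^ 3)⁻¹) (H z) := by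
      refine ((hasDerivAt_pow 2 (H z)).fun_inv (pow_ne_zero 2 hh0)).neg.congr_deriv ?_
      have : H z ≠ 0 := hh0
      field_simp
      ring
    have := lap_comp_real (g := fun t => t⁻¹)
      (eventually_of_mem (isOpen_ne.mem_nhds hh0) fun t ht => hasDerivAt_inv ht) hd hH2
    rw [show q = fun w => (fun t : ℝ => t⁻¹) (H w) from rfl, this, gH, lH]
    simp only [inv_pow]
    ring
  change (∀ c, ContDiffAt ℝ ∞ (fun w => coord N c w * q w) z) ∧
    (∀ c d, (inner ℝ c e : ℝ) = 0 → (inner ℝ d e : ℝ) = 0 →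
      gradDot (fun w => coord N c w * q w) (fun w => coord N d w * q w) z =
        κ * q z ^ 2 * inner ℝ c d) ∧
    ∀ c, (inner ℝ c e : ℝ) = 0 → lap (fun w => coord N c w * q w) z = 0
  refine ⟨fun c => (h.1 c).mul hqC, fun c d hc hd => ?_, fun c hc => ?_⟩
  · have h1 := h.2.1 c d
    have h2 := h.2.1 c e
    have h3 := h.2.1 d e
    have h4 := h.2.1 e e
    rw [hc] at h2
    rw [hd] at h3
    rw [hee] at h4
    simp only [gradDot] at h1 h2 h3 h4 ⊢
    simp only [pd_mul (dc _) dq, pq]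
    linear_combination q z ^ 2 * h1 + q z ^ 3 * coord N d z * h2 + q z ^ 3 * coord N c z * h3 +
      q z ^ 4 * coord N c z * coord N d z * h4 +
      coord N c z * coord N d z * κ * q z ^ 2 * (q z * (1 + coord N e z) + 1) * hqH
  · have h2 := h.2.1 c e
    rw [hc] at h2
    have gcq : gradDot (coord N c) q z = -q z ^ 2 * κ * coord N c z * coord N e z := by
      simp only [gradDot] at h2 ⊢
      simp only [pq]
      linear_combination q z ^ 2 * h2
    rw [lap_mul (hc2 c) hq2, lq, gcq, h.2.2]
    linear_combination 2 * κ * coord N c z * q z * (q z * (1 + coord N e z) + 1) * hqH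

end Equations

/-! ### Conformal maps in charts and the compactness of the area density -/

section Charts

variable {N : ℂ → S2} {D : Set ℂ} {z : ℂ}

theorem pd_re_comp {g : ℂ → ℂ} (hg : DifferentiableAt ℂ g z) (v : ℂ) :
    pd v (fun w => (g w).re) z = (deriv g z * v).re := by
  have h := hg.hasDerivAt.hasFDerivAt.restrictScalars ℝ
  have := (Complex.reCLM.hasFDerivAt.comp z h).fderiv
  rw [pd, show (fun w => (g w).re) = Complex.reCLM ∘ g from rfl, this]
  simp [mul_comm]

theorem pd_im_comp {g : ℂ → ℂ} (hg : DifferentiableAt ℂ g z) (v : ℂ) :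
    pd v (fun w => (g w).im) z = (deriv g z * v).im := by
  have h := hg.hasDerivAt.hasFDerivAt.restrictScalars ℝ
  have := (Complex.imCLM.hasFDerivAt.comp z h).fderiv
  rw [pd, show (fun w => (g w).im) = Complex.imCLM ∘ g from rfl, this]
  simp [mul_comm]

/-- An analytic function is a weakly conformal harmonic map to the plane, by the Cauchy-Riemann
equations; so inverse stereographic projection makes it a conformal harmonic map to the sphere. -/
theorem exists_isConformalHarmonicAt_invStereo_comp {g : ℂ → ℂ} (hg : AnalyticAt ℂ g z) :
    ∃ κ, IsConformalHarmonicAt (fun w => invStereo (g w)) κ z := by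
  have hd : ∀ᶠ w in 𝓝 z, DifferentiableAt ℂ g w := by
    filter_upwards [hg.eventually_analyticAt] with w hw using hw.differentiableAt
  have hdz := hg.differentiableAt
  have hd' : DifferentiableAt ℂ (deriv g) z := hg.deriv.differentiableAt
  have hC : ContDiffAt ℝ ∞ g z := (hg.contDiffAt (n := ∞)).restrict_scalars ℝ
  have hre : ContDiffAt ℝ ∞ (fun w => (g w).re) z := Complex.reCLM.contDiff.contDiffAt.comp z hC
  have him : ContDiffAt ℝ ∞ (fun w => (g w).im) z := Complex.imCLM.contDiff.contDiffAt.comp z hC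
  have e1 (v : ℂ) : pd v (fun w => (g w).re) =ᶠ[𝓝 z] fun w => (deriv g w * v).re := by
    filter_upwards [hd] with w hw using pd_re_comp hw v
  have e2 (v : ℂ) : pd v (fun w => (g w).im) =ᶠ[𝓝 z] fun w => (deriv g w * v).im := by
    filter_upwards [hd] with w hw using pd_im_comp hw v
  have hv (v : ℂ) : deriv (fun w => deriv g w * v) z = deriv (deriv g) z * v :=
    deriv_mul_const hd' v
  refine ⟨_, isConformalHarmonicAt_invStereo (J := ‖deriv g z‖ ^ 2) hre him ?_ ?_ ?_ ?_ ?_⟩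
  · simp only [gradDot, pd_re_comp hdz, Complex.sq_norm, Complex.normSq_apply]; simp
  · simp only [gradDot, pd_im_comp hdz, Complex.sq_norm, Complex.normSq_apply]; simp; ring
  · simp only [gradDot, pd_re_comp hdz, pd_im_comp hdz]; simp; ring
  · simp only [lap, pd_congr (e1 _), pd_re_comp (hd'.mul_const _), hv]; simp
  · simp only [lap, pd_congr (e2 _), pd_im_comp (hd'.mul_const _), hv]; simp

theorem coord_two_ne_one {x : S2} (hx : x ≠ north) : (x : E3) 2 ≠ 1 := by
  intro h
  apply hx
  have hs := sphere_eq x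
  rw [h] at hs
  have h0 : (x : E3) 0 = 0 := by nlinarith [sq_nonneg ((x : E3) 0), sq_nonneg ((x : E3) 1)]
  have h1 : (x : E3) 1 = 0 := by nlinarith [sq_nonneg ((x : E3) 0), sq_nonneg ((x : E3) 1)]
  apply Subtype.ext
  ext i
  fin_cases i <;> simp [north, h, h0, h1]

theorem stereo_eq_mk (x : S2) :
    stereo x = ⟨(x : E3) 0 * (1 - (x : E3) 2)⁻¹, (x : E3) 1 * (1 - (x : E3) 2)⁻¹⟩ := by
  have e : (1 - ((x : E3) 2 : ℂ)) = ((1 - (x : E3) 2 : ℝ) : ℂ) := by push_cast; ring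
  rw [stereo, e, div_eq_mul_inv, ← Complex.ofReal_inv]
  apply Complex.ext
  · rw [Complex.re_mul_ofReal]; simp
  · rw [Complex.im_mul_ofReal]; simp

theorem invStereo_stereo {x : S2} (hx : x ≠ north) : invStereo (stereo x) = x := by
  have h2 : 1 - (x : E3) 2 ≠ 0 := sub_ne_zero.2 (coord_two_ne_one hx).symm
  have hs := sphere_eq x
  have hn : ‖stereo x‖ ^ 2 = (1 + (x : E3) 2) * (1 - (x : E3) 2)⁻¹ := by
    rw [stereo_eq_mk, Complex.sq_norm, Complex.normSq_apply]
    field_simp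
    linear_combination hs
  have hp : 1 + (1 + (x : E3) 2) * (1 - (x : E3) 2)⁻¹ = 2 * (1 - (x : E3) 2)⁻¹ := by
    field_simp; ring
  apply Subtype.ext
  ext i
  simp only [invStereo, hn, hp]
  fin_cases i
  · simp [stereo_eq_mk]; field_simp
  · simp [stereo_eq_mk]; field_simp
  · simp; field_simp; ring

theorem stereo_invStereo (y : ℂ) : stereo (invStereo y) = y := by
  have h : 1 + ‖y‖ ^ 2 ≠ 0 := by positivity
  rw [stereo_eq_mk]
  apply Complex.ext
  · simp [invStereo]; field_simp; ring
  · simp [invStereo]; field_simp; ring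

/-- The rotation by the angle `π` about the first axis, which interchanges the poles. -/
def halfTurn (c : E3) : E3 := !₂[c 0, -c 1, -c 2]

theorem inner_halfTurn (c d : E3) : (inner ℝ (halfTurn c) (halfTurn d) : ℝ) = inner ℝ c d := by
  simp [inner_E3, halfTurn]

theorem inner_halfTurn_invStereo_stereoInv {x : S2} (hx : x ≠ south) (c : E3) :
    (inner ℝ (halfTurn c) (invStereo (stereoInv x) : E3) : ℝ) = inner ℝ c (x : E3) := by
  let y : S2 := ⟨halfTurn x, by
    rw [mem_sphere_zero_iff_norm, ← sq_eq_sq₀ (norm_nonneg _) zero_le_one, norm_sq_E3]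
    have := sphere_eq x
    simp only [halfTurn]
    simp
    linarith⟩
  have hy : y ≠ north := by
    intro h
    apply hx
    have h' : halfTurn x = (north : E3) := congrArg Subtype.val h
    apply Subtype.ext
    ext i
    have h0 := congrArg (fun u : E3 => u 0) h'
    have h1 := congrArg (fun u : E3 => u 1) h'
    have h2 := congrArg (fun u : E3 => u 2) h'
    simp [halfTurn, north] at h0 h1 h2
    fin_cases i <;> simp [south, h0, h1]
    linarith
  have hs : stereoInv x = stereo y := by
    simp [stereoInv, stereo, y, halfTurn, sub_eq_add_neg]
  rw [hs, invStereo_stereo hy]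
  exact inner_halfTurn c x

theorem IsConformalMap.isConformalHarmonicAt (hN : IsConformalMap N D) (hD : IsOpen D)
    (hz : z ∈ D) : IsConformalHarmonicAt N (areaDensity N z) z := by
  have hc : ContinuousAt N z := hN.1.continuousAt (hD.mem_nhds hz)
  suffices ∃ κ, IsConformalHarmonicAt N κ z by
    obtain ⟨κ, h⟩ := this
    rwa [h.areaDensity_eq]
  rcases hN.2.1 z hz with ⟨hne, han⟩ | ⟨hne, han⟩
  · obtain ⟨κ, h⟩ := exists_isConformalHarmonicAt_invStereo_comp han
    refine ⟨κ, h.of_coord_eq (T := id) (fun _ _ => rfl) fun c => ?_⟩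
    filter_upwards [hc.eventually (isOpen_ne.mem_nhds hne)] with w hw
    simp [coord, invStereo_stereo hw]
  · obtain ⟨κ, h⟩ := exists_isConformalHarmonicAt_invStereo_comp han
    refine ⟨κ, h.of_coord_eq inner_halfTurn fun c => ?_⟩
    filter_upwards [hc.eventually (isOpen_ne.mem_nhds hne)] with w hw
    simp only [coord]
    exact (inner_halfTurn_invStereo_stereoInv hw c).symm

theorem isConformalHarmonicAt_invStereoRot (R : E3 ≃ₗᵢ[ℝ] E3) (z : ℂ) :
    IsConformalHarmonicAt (invStereoRot R) (4 * ((1 + ‖z‖ ^ 2)⁻¹) ^ 2) z := by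
  have h := isConformalHarmonicAt_invStereo (z := z) (a := fun w => w.re) (b := fun w => w.im)
    (J := 1) Complex.reCLM.contDiff.contDiffAt Complex.imCLM.contDiff.contDiffAt
  have p1 (v w : ℂ) : pd v (fun w => w.re) w = v.re := by simpa using pd_re_sub (z := w) v 0
  have p2 (v w : ℂ) : pd v (fun w => w.im) w = v.im := by simpa using pd_im_sub (z := w) v 0
  have p1' (v : ℂ) : pd v (fun w => w.re) = fun _ => v.re := funext (p1 v)
  have p2' (v : ℂ) : pd v (fun w => w.im) = fun _ => v.im := funext (p2 v)
  have h' := h (by simp [gradDot, p1]) (by simp [gradDot, p2]) (by simp [gradDot, p1, p2])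
    (by simp [lap, p1', pd_const]) (by simp [lap, p2', pd_const])
  have e : ‖z‖ ^ 2 = z.re * z.re + z.im * z.im := by rw [Complex.sq_norm, Complex.normSq_apply]
  rw [e]
  rw [mul_one] at h'
  refine h'.of_coord_eq (T := R.symm) (fun c d => R.symm.inner_map_map c d) fun c =>
    Eventually.of_forall fun w => ?_
  simp only [coord, invStereoRot, rot]
  rw [← R.symm.inner_map_map, R.symm_apply_apply]

theorem areaDensity_invStereoRot (R : E3 ≃ₗᵢ[ℝ] E3) (z : ℂ) :
    areaDensity (invStereoRot R) z = 4 * ((1 + ‖z‖ ^ 2)⁻¹) ^ 2 :=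
  (isConformalHarmonicAt_invStereoRot R z).areaDensity_eq

end Charts

section Hardy

variable {N : ℂ → S2} {D : Set ℂ}

theorem continuousOn_areaDensity (hN : ∀ z ∈ D, IsConformalHarmonicAt N (areaDensity N z) z) :
    ContinuousOn (areaDensity N) D := by
  intro z hz
  have h : ContDiffAt ℝ 0 (fderiv ℝ fun w => (N w : E3)) z :=
    (hN z hz).contDiffAt.fderiv_right (by simp)
  have hc (v : ℂ) : ContinuousAt (fun w => fderiv ℝ (fun w => (N w : E3)) w v) z :=
    h.continuousAt.clm_apply continuousAt_const
  exact (continuousAt_const.mul (((hc 1).norm.pow 2).add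
    ((hc Complex.I).norm.pow 2))).continuousWithinAt

/-- A Hardy type inequality: where the map `N` stays close to the point `c`, the function
`⟨c, N⟩` is a supersolution with small gradient, and testing its equation with `φ²` bounds the
weighted mass by a small multiple of the Dirichlet integral. -/
theorem mass_le_of_close (hD : IsOpen D)
    (hN : ∀ z ∈ D, IsConformalHarmonicAt N (areaDensity N z) z) {φ : ℂ → ℝ} (hφ : IsTest D φ)
    {c : S2} {ε : ℝ} (hε1 : ε ≤ 1)
    (hc : ∀ z, φ z ≠ 0 → ‖(N z : E3) - c‖ ≤ ε) :
    mass (areaDensity N) φ ≤ 4 * ε ^ 2 * energy φ := by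
  have hw := continuousOn_areaDensity hN
  set w := areaDensity N
  set F := coord N c with hF
  have hφ2 := hφ.mul hφ
  have hFC (z : ℂ) (hz : z ∈ D) : ContDiffAt ℝ 2 F z := contDiffAt_two ((hN z hz).1 c)
  have green := integral_gradDot_eq_neg_integral_mul_lap hφ2.1 hφ2.2.1
    fun z hz => hFC z (hφ2.2.2 hz)
  have hint : Integrable fun z => gradDot (fun z => φ z * φ z) F z := by
    have i (v : ℂ) : Integrable fun z => pd v (fun z => φ z * φ z) z * pd v F z :=
      integrable_mul_of_tsupport (hφ2.isTest_pd v).continuous (hφ2.isTest_pd v).2.1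
        fun z hz => continuousAt_pd (hFC z ((hφ2.isTest_pd v).2.2 hz))
    exact (i 1).add (i Complex.I)
  have hint2 : Integrable fun z => φ z * φ z * lap F z :=
    integrable_mul_of_tsupport hφ2.continuous hφ2.2.1
      fun z hz => continuousAt_lap (hFC z (hφ2.2.2 hz))
  have him := hφ.integrable_weight_sq hD hw
  have hie := (hφ.isTest_gradDot hφ).integrable
  have hdist (z : ℂ) : ‖(N z : E3) - c‖ ^ 2 = 2 - 2 * F z := by
    rw [norm_sub_sq_real, norm_eq_of_mem_sphere, norm_eq_of_mem_sphere, real_inner_comm]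
    simp only [hF, coord]; ring
  -- `|N - c| ≤ 1` means `F ≥ 1 / 2`, so that `-lap F = 2 * w * F ≥ w`
  have h1 : mass w φ ≤ -∫ z, φ z * φ z * lap F z := by
    rw [mass, ← integral_neg]
    refine integral_mono him hint2.neg fun z => ?_
    simp only
    by_cases hz : φ z = 0
    · simp [hz]
    · have hzD : z ∈ D := by by_contra h; exact hz (hφ.eq_zero h)
      rw [(hN z hzD).2.2 c]
      have hw0 : 0 ≤ w z := (hN z hzD).nonneg
      have hn : ‖(N z : E3) - c‖ ^ 2 ≤ 1 :=
        pow_le_one₀ (norm_nonneg _) ((hc z hz).trans hε1)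
      rw [hdist] at hn
      have h2 : 0 ≤ w z * φ z ^ 2 * (2 * F z - 1) :=
        mul_nonneg (mul_nonneg hw0 (sq_nonneg _)) (by linarith)
      nlinarith
  have h2 : ∫ z, gradDot (fun z => φ z * φ z) F z ≤ 1 / 2 * mass w φ + 2 * ε ^ 2 * energy φ := by
    rw [mass, energy, ← integral_const_mul, ← integral_const_mul,
      ← integral_add (him.const_mul _) (hie.const_mul _)]
    refine integral_mono hint ((him.const_mul _).add (hie.const_mul _)) fun z => ?_
    have e : gradDot (fun z => φ z * φ z) F z = 2 * φ z * gradDot φ F z := by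
      simp only [gradDot, pd_mul (hφ.differentiableAt z) (hφ.differentiableAt z)]; ring
    simp only [e]
    have hE := gradDot_self_nonneg φ z
    by_cases hz : φ z = 0
    · rw [hz]
      have : 0 ≤ 2 * ε ^ 2 * gradDot φ φ z := by positivity
      simpa using this
    · have hzD : z ∈ D := by by_contra h; exact hz (hφ.eq_zero h)
      have hw0 : 0 ≤ w z := (hN z hzD).nonneg
      have hFF := (hN z hzD).2.1 c c
      have hcc : (inner ℝ (c : E3) (c : E3) : ℝ) = 1 := by
        rw [real_inner_self_eq_norm_sq, norm_eq_of_mem_sphere, one_pow]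
      rw [hcc] at hFF
      have hn : ‖(N z : E3) - c‖ ^ 2 ≤ ε ^ 2 := pow_le_pow_left₀ (norm_nonneg _) (hc z hz) 2
      rw [hdist] at hn
      -- `1 - F ^ 2 ≤ 2 * (1 - F) = |N - c| ^ 2`
      have hFw : gradDot F F z ≤ w z * ε ^ 2 := by
        rw [hFF]
        refine mul_le_mul_of_nonneg_left ?_ hw0
        nlinarith [sq_nonneg (1 - F z)]
      have hX := (gradDot_sq_le φ F z).trans (mul_le_mul_of_nonneg_left hFw hE)
      refine (le_abs_self _).trans (abs_le_of_sq_le_sq ?_ (by positivity))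
      have h3 := mul_le_mul_of_nonneg_left hX (sq_nonneg (2 * φ z))
      nlinarith [sq_nonneg (1 / 2 * (w z * φ z ^ 2) - 2 * ε ^ 2 * gradDot φ φ z)]
  rw [← green] at h1
  linarith

/-- Averaging the integrals of `g * h (· - a)` over all translations `a`. -/
theorem integral_integral_translate {μ : Measure ℂ} [IsFiniteMeasureOnCompacts μ] [SFinite μ]
    {g h : ℂ → ℝ} (hg : Continuous g) (hgc : HasCompactSupport g) (hh : Continuous h)
    (hhc : HasCompactSupport h) :
    Integrable (fun a => ∫ z, g z * h (z - a) ∂μ) ∧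
      ∫ a, ∫ z, g z * h (z - a) ∂μ = (∫ z, g z ∂μ) * ∫ z, h z := by
  let f : ℂ → ℂ → ℝ := fun a z => g z * h (z - a)
  have hf : Continuous (Function.uncurry f) := by
    simp only [f, Function.uncurry_def]; fun_prop
  have hfc : HasCompactSupport (Function.uncurry f) := by
    refine HasCompactSupport.intro (((IsCompact.prod hgc hhc).image continuous_sub).prod
      (show IsCompact (tsupport g) from hgc)) ?_
    rintro ⟨a, z⟩ haz
    simp only [f, Function.uncurry_apply_pair]
    by_contra hne
    have h1 : z ∈ tsupport g := by
      by_contra h0; exact hne (by rw [image_eq_zero_of_notMem_tsupport h0, zero_mul])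
    have h2 : z - a ∈ tsupport h := by
      by_contra h0; exact hne (by rw [image_eq_zero_of_notMem_tsupport h0, mul_zero])
    exact haz ⟨⟨(z, z - a), ⟨h1, h2⟩, by simp⟩, h1⟩
  have hprod : Integrable (Function.uncurry f) ((volume : Measure ℂ).prod μ) :=
    hf.integrable_of_hasCompactSupport hfc
  refine ⟨hprod.integral_prod_left, ?_⟩
  have := integral_integral_swap_of_hasCompactSupport (μ := volume) (ν := μ) hf hfc
  simp only [f] at this
  rw [this]
  simp only [integral_const_mul]
  have e (z : ℂ) : ∫ a, h (z - a) = ∫ a, h a := integral_sub_left_eq_self h volume z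
  simp only [e, integral_mul_const]

theorem pd_comp_sub (v a z : ℂ) (b : ℂ → ℝ) : pd v (fun z => b (z - a)) z = pd v b (z - a) := by
  simp only [pd]
  rw [fderiv_comp_sub]

/-- The area density of a conformal map which is continuous up to the boundary is a compact weight,
although it need not be integrable: the Hardy type inequality is localized to small discs, on which
the oscillation of the map is small by uniform continuity, and averaged over all discs. -/
theorem isCompactWeight_areaDensity (hD : IsOpen D) (hDb : Bornology.IsBounded D)
    (hN : ∀ z ∈ D, IsConformalHarmonicAt N (areaDensity N z) z) (hNc : ContinuousOn N (closure D)) :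
    IsCompactWeight D (areaDensity N) := by
  have hw := continuousOn_areaDensity hN
  refine ⟨hw, fun z hz => (hN z hz).nonneg, fun ε hε => ?_⟩
  set w := areaDensity N
  obtain ⟨ε₁, hε₁0, hε₁1, hε₁⟩ : ∃ ε₁ : ℝ, 0 < ε₁ ∧ ε₁ ≤ 1 ∧ 8 * ε₁ ^ 2 ≤ ε := by
    refine ⟨min 1 (Real.sqrt (ε / 8)), by positivity, min_le_left _ _, ?_⟩
    have h1 : min 1 (Real.sqrt (ε / 8)) ^ 2 ≤ Real.sqrt (ε / 8) ^ 2 :=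
      pow_le_pow_left₀ (by positivity) (min_le_right _ _) 2
    rw [Real.sq_sqrt (by positivity)] at h1
    linarith
  have huc := hDb.isCompact_closure.uniformContinuousOn_of_continuous hNc
  obtain ⟨δ, hδ0, hδ⟩ := Metric.uniformContinuousOn_iff.1 huc ε₁ hε₁0
  let b : ContDiffBump (0 : ℂ) := ⟨δ / 8, δ / 4, by positivity, by linarith⟩
  have hbT : IsTest Set.univ b := ⟨b.contDiff, b.hasCompactSupport, Set.subset_univ _⟩
  have hb2 := hbT.mul hbT
  have hb' := hbT.isTest_gradDot hbT
  set K := ∫ z, b z * b z with hK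
  set K' := ∫ z, gradDot b b z with hK'
  have hK0 : 0 < K := by
    refine hb2.continuous.integral_pos_of_hasCompactSupport_nonneg_nonzero hb2.2.1
      (fun x => mul_self_nonneg _) (x := 0) ?_
    rw [b.one_of_mem_closedBall (Metric.mem_closedBall_self b.rIn_pos.le)]
    simp
  have hK'0 : 0 ≤ K' := integral_nonneg fun _ => gradDot_self_nonneg _ _
  -- averaging over `a` multiplies the integrals of `φ` by `K`; the gradient of the cutoff function
  -- contributes the term with `K'`
  refine ⟨8 * ε₁ ^ 2 * (K' / K), by positivity, fun φ hφ => ?_⟩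
  have hba (a : ℂ) : ContDiff ℝ ∞ fun z => b (z - a) :=
    b.contDiff.comp (contDiff_id.sub contDiff_const)
  have hφa (a : ℂ) : IsTest D fun z => b (z - a) * φ z := hφ.mul_left (hba a)
  have hloc (a : ℂ) : mass w (fun z => b (z - a) * φ z) ≤
      4 * ε₁ ^ 2 * energy fun z => b (z - a) * φ z := by
    by_cases hne : ∃ p, b (p - a) * φ p ≠ 0
    · obtain ⟨p, hp⟩ := hne
      have hball {z : ℂ} (hz : b (z - a) * φ z ≠ 0) : z ∈ D ∧ dist z a ≤ δ / 4 := by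
        refine ⟨by by_contra h; exact hz (by rw [hφ.eq_zero h, mul_zero]), ?_⟩
        by_contra! h
        refine hz ?_
        rw [b.zero_of_le_dist (by rw [dist_zero_right, ← dist_eq_norm]; exact h.le), zero_mul]
      refine mass_le_of_close hD hN (hφa a) (c := N p) hε₁1 fun z hz => ?_
      have h1 := hball hz
      have h2 := hball hp
      have h3 := hδ z (subset_closure h1.1) p (subset_closure h2.1) (by
        have := dist_triangle_right z p a
        linarith)
      rw [Subtype.dist_eq, dist_eq_norm] at h3
      exact h3.le
    · push Not at hne
      have h0 : (fun z => b (z - a) * φ z) = fun _ => 0 := funext hne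
      rw [h0]
      have := mul_nonneg (by positivity : 0 ≤ 4 * ε₁ ^ 2) (energy_nonneg fun _ : ℂ => (0 : ℝ))
      simpa [mass] using this
  have hwφ := hφ.weight_mul hD hw hφ.continuous
  have hg := hφ.isTest_gradDot hφ
  have hφ2 := hφ.mul hφ
  obtain ⟨i1, e1⟩ := integral_integral_translate (μ := volume) hwφ.1 hwφ.2 hb2.continuous hb2.2.1
  obtain ⟨i2, e2⟩ := integral_integral_translate (μ := volume) hg.continuous hg.2.1 hb2.continuous hb2.2.1
  obtain ⟨i3, e3⟩ := integral_integral_translate (μ := volume) hφ2.continuous hφ2.2.1 hb'.continuous hb'.2.1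
  have hm : ∫ z, w z * φ z * φ z = mass w φ := by
    simp only [mass, pow_two, mul_assoc]
  have hle (a : ℂ) : ∫ z, w z * φ z * φ z * (b (z - a) * b (z - a)) ≤
      8 * ε₁ ^ 2 * (∫ z, gradDot φ φ z * (b (z - a) * b (z - a))) +
        8 * ε₁ ^ 2 * ∫ z, φ z * φ z * gradDot b b (z - a) := by
    have j2 : Integrable fun z => gradDot φ φ z * (b (z - a) * b (z - a)) :=
      (hg.continuous.mul ((hba a).continuous.mul (hba a).continuous)).integrable_of_hasCompactSupport
        hg.2.1.mul_right
    have j3 : Integrable fun z => φ z * φ z * gradDot b b (z - a) :=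
      (hφ2.continuous.mul (hb'.continuous.comp
        (continuous_id.sub continuous_const))).integrable_of_hasCompactSupport hφ2.2.1.mul_right
    have h1 : ∫ z, w z * φ z * φ z * (b (z - a) * b (z - a)) =
        mass w fun z => b (z - a) * φ z := by
      rw [mass]; congr 1; funext z; ring
    have h2 : energy (fun z => b (z - a) * φ z) ≤
        2 * (∫ z, gradDot φ φ z * (b (z - a) * b (z - a))) +
          2 * ∫ z, φ z * φ z * gradDot b b (z - a) := by
      rw [energy, ← integral_const_mul, ← integral_const_mul,
        ← integral_add (j2.const_mul _) (j3.const_mul _)]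
      refine integral_mono ((hφa a).isTest_gradDot (hφa a)).integrable
        ((j2.const_mul _).add (j3.const_mul _)) fun z => ?_
      have hd : DifferentiableAt ℝ (fun z => b (z - a)) z := (hba a).differentiable (by simp) z
      simp only [gradDot, pd_mul hd (hφ.differentiableAt z), pd_comp_sub]
      nlinarith [sq_nonneg (b (z - a) * pd 1 φ z - φ z * pd 1 b (z - a)),
        sq_nonneg (b (z - a) * pd Complex.I φ z - φ z * pd Complex.I b (z - a))]
    rw [h1]
    have h3 := mul_le_mul_of_nonneg_left h2 (by positivity : 0 ≤ 4 * ε₁ ^ 2)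
    linarith [hloc a]
  have htot := integral_mono i1 ((i2.const_mul (8 * ε₁ ^ 2)).add (i3.const_mul (8 * ε₁ ^ 2))) hle
  simp only [Pi.add_apply] at htot
  rw [e1, integral_add (i2.const_mul _) (i3.const_mul _), integral_const_mul, integral_const_mul,
    e2, e3, hm, ← hK, ← hK'] at htot
  have hE0 := energy_nonneg φ
  have h4 : mass w φ ≤ 8 * ε₁ ^ 2 * energy φ + 8 * ε₁ ^ 2 * (K' / K) * ∫ z, φ z * φ z := by
    have : K * mass w φ ≤ K * (8 * ε₁ ^ 2 * energy φ +
        8 * ε₁ ^ 2 * (K' / K) * ∫ z, φ z * φ z) := by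
      calc K * mass w φ = mass w φ * K := mul_comm _ _
        _ ≤ _ := htot
        _ = _ := by rw [energy]; field_simp
    exact le_of_mul_le_mul_left this hK0
  have h5 : 8 * ε₁ ^ 2 * energy φ ≤ ε * energy φ := mul_le_mul_of_nonneg_right hε₁ hE0
  simp only [pow_two (φ _)]
  linarith

end Hardy

/-! ### Measures whose distributional derivatives vanish -/

section Degree

variable {U : Set ℂ} {μ : Measure ℂ} {ψ η : ℂ → ℝ} {x₀ : ℂ} {r s : ℝ}

theorem IsTest.setIntegral_eq_integral {K : Set ℂ} (hψ : IsTest K ψ) :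
    ∫ x in K, ψ x ∂μ = ∫ x, ψ x ∂μ :=
  setIntegral_eq_integral_of_forall_compl_eq_zero fun _ hx => hψ.eq_zero hx

theorem IsTest.comp_sub {V : Set ℂ} (hψ : IsTest U ψ) (a : ℂ) (h : ∀ x ∈ U, x + a ∈ V) :
    IsTest V fun x => ψ (x - a) := by
  refine ⟨hψ.1.comp (contDiff_id.sub contDiff_const),
    hψ.2.1.comp_homeomorph (Homeomorph.subRight a), ?_⟩
  intro x hx
  have h1 : x ∈ (Homeomorph.subRight a) ⁻¹' tsupport ψ := by
    rw [← tsupport_comp_eq_preimage]; exact hx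
  simpa using h _ (hψ.2.2 h1)

/-- A measure whose distributional derivatives vanish is invariant under small translations. -/
theorem integral_translate_eq (hμK : ∀ K ⊆ U, IsCompact K → μ K < ⊤)
    (hμ : ∀ ψ, IsTest U ψ → ∀ v, ∫ x, pd v ψ x ∂μ = 0) (hU : Metric.closedBall x₀ (r + s) ⊆ U)
    (hψ : IsTest (Metric.closedBall x₀ r) ψ) {y : ℂ} (hy : ‖y‖ ≤ s) :
    ∫ x, ψ (x - y) ∂μ = ∫ x, ψ x ∂μ := by
  set K := Metric.closedBall x₀ (r + s) with hK
  have : IsFiniteMeasure (μ.restrict K) :=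
    isFiniteMeasure_restrict.2 (hμK K hU (isCompact_closedBall _ _)).ne
  have hs0 : 0 ≤ s := (norm_nonneg y).trans hy
  have htr (t : ℝ) (ht : t ∈ Set.Icc (0 : ℝ) 1) : IsTest K fun x => ψ (x - t * y) := by
    refine hψ.comp_sub _ fun x hx => ?_
    rw [hK, mem_closedBall_iff_norm] at *
    have h1 : ‖(t : ℂ) * y‖ ≤ s := by
      rw [norm_mul, Complex.norm_real, Real.norm_of_nonneg ht.1]
      calc t * ‖y‖ ≤ 1 * s := mul_le_mul ht.2 hy (norm_nonneg y) zero_le_one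
        _ = s := one_mul s
    calc ‖x + t * y - x₀‖ = ‖(x - x₀) + t * y‖ := by ring_nf
      _ ≤ r + s := (norm_add_le _ _).trans (add_le_add hx h1)
  have hpc : Continuous (pd y ψ) := (hψ.isTest_pd y).continuous
  obtain ⟨C, hC⟩ := (hψ.isTest_pd y).2.1.exists_bound_of_continuous hpc
  have hψc := hψ.continuous
  obtain ⟨B, hB⟩ := hψ.2.1.exists_bound_of_continuous hψc
  have hder (t₀ : ℝ) : HasDerivAt (fun t : ℝ => ∫ x in K, ψ (x - t * y) ∂μ)
      (∫ x in K, -pd y ψ (x - t₀ * y) ∂μ) t₀ := by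
    refine (hasDerivAt_integral_of_dominated_loc_of_deriv_le (s := Set.univ) univ_mem
      (bound := fun _ => C) (F' := fun (t : ℝ) x => -pd y ψ (x - t * y))
      (Eventually.of_forall fun t => ?_) ?_ ?_ ?_ (integrable_const C) ?_).2
    · exact Continuous.aestronglyMeasurable (by fun_prop)
    · exact Integrable.of_bound (Continuous.aestronglyMeasurable (by fun_prop)) B
        (Eventually.of_forall fun x => hB _)
    · exact Continuous.aestronglyMeasurable (by fun_prop)
    · exact Eventually.of_forall fun x t _ => by rw [norm_neg]; exact hC _
    · refine Eventually.of_forall fun x t _ => ?_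
      have h1 : HasDerivAt (fun t : ℝ => x - (t : ℂ) * y) (-y) t := by
        simpa using ((Complex.ofRealCLM.hasDerivAt (x := t)).mul_const y).const_sub x
      have := (hψ.differentiableAt (x - t * y)).hasFDerivAt.comp_hasDerivAt t h1
      simpa [Function.comp_def, pd] using this
  have hzero (t : ℝ) (ht : t ∈ Set.Icc (0 : ℝ) 1) : ∫ x in K, -pd y ψ (x - t * y) ∂μ = 0 := by
    have h1 := hμ _ ((htr t ht).mono hU) y
    have h2 := ((htr t ht).isTest_pd y).setIntegral_eq_integral (μ := μ)
    simp only [pd_comp_sub] at h1 h2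
    rw [integral_neg, h2, h1, neg_zero]
  have hconst := constant_of_has_deriv_right_zero (a := (0 : ℝ)) (b := 1)
    (f := fun t : ℝ => ∫ x in K, ψ (x - t * y) ∂μ)
    (fun t _ => (hder t).continuousAt.continuousWithinAt)
    (fun t ht => by
      have := (hder t).hasDerivWithinAt (s := Set.Ici t)
      rwa [hzero t (Set.Ico_subset_Icc_self ht)] at this) 1 (by simp)
  have e1 := (htr 1 (by simp)).setIntegral_eq_integral (μ := μ)
  have e0 := (htr 0 (by simp)).setIntegral_eq_integral (μ := μ)
  rw [e1, e0] at hconst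
  simpa using hconst

/-- The uniqueness of Haar measure, localized: if the integrals of test functions supported near
`x₀` are invariant under small translations, they are proportional to the Lebesgue integrals. -/
theorem exists_local_density (hμK : ∀ K ⊆ U, IsCompact K → μ K < ⊤)
    (hμ : ∀ ψ, IsTest U ψ → ∀ v, ∫ x, pd v ψ x ∂μ = 0) (hr : 0 < r)
    (hU : Metric.closedBall x₀ (r + r) ⊆ U) :
    ∃ c : ℝ, ∀ ψ, IsTest (Metric.closedBall x₀ r) ψ → ∫ x, ψ x ∂μ = c * ∫ x, ψ x := by
  set K := Metric.closedBall x₀ (r + r) with hK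
  have : IsFiniteMeasure (μ.restrict K) :=
    isFiniteMeasure_restrict.2 (hμK K hU (isCompact_closedBall _ _)).ne
  -- the double integral of `η a * ψ (x - x₀ - a)` is computed in two ways, and is symmetric in
  -- `η` and `ψ` by the substitution of `x - x₀ - a` for `a`
  have key {η ψ : ℂ → ℝ} (hη : IsTest (Metric.closedBall 0 r) η)
      (hψ : IsTest (Metric.closedBall 0 r) ψ) :
      ∫ a, ∫ x in K, η a * ψ (x - x₀ - a) ∂μ = (∫ a, η a) * ∫ x, ψ (x - x₀) ∂μ := by
    have hψ' : IsTest (Metric.closedBall x₀ r) fun x => ψ (x - x₀) :=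
      hψ.comp_sub x₀ fun x hx => by
        rw [mem_closedBall_iff_norm] at *; simpa using hx
    rw [← integral_mul_const]
    congr 1
    funext a
    by_cases ha : a ∈ Metric.closedBall (0 : ℂ) r
    · have hψa : IsTest K fun x => ψ (x - x₀ - a) := by
        have := hψ'.comp_sub (V := K) a fun x hx => by
          rw [hK]
          rw [mem_closedBall_iff_norm] at *
          rw [sub_zero] at ha
          calc ‖x + a - x₀‖ = ‖(x - x₀) + a‖ := by ring_nf
            _ ≤ r + r := (norm_add_le _ _).trans (add_le_add hx ha)
        simpa [sub_right_comm] using this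
      rw [integral_const_mul, hψa.setIntegral_eq_integral]
      have h1 := integral_translate_eq hμK hμ hU hψ' (y := a)
        (by simpa [mem_closedBall_iff_norm] using ha)
      simp only [sub_right_comm _ a x₀] at h1
      rw [h1]
    · simp [hη.eq_zero ha]
  have symm {η ψ : ℂ → ℝ} (hη : IsTest (Metric.closedBall 0 r) η)
      (hψ : IsTest (Metric.closedBall 0 r) ψ) :
      (∫ a, η a) * ∫ x, ψ (x - x₀) ∂μ = (∫ a, ψ a) * ∫ x, η (x - x₀) ∂μ := by
    have swap {η ψ : ℂ → ℝ} (hη : IsTest (Metric.closedBall 0 r) η)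
        (hψ : IsTest (Metric.closedBall 0 r) ψ) :
        ∫ a, ∫ x in K, η a * ψ (x - x₀ - a) ∂μ = ∫ x in K, (∫ a, η a * ψ (x - x₀ - a)) ∂μ := by
      have hηc := hη.continuous
      have hψc := hψ.continuous
      have hf : Continuous (Function.uncurry fun a x : ℂ => η a * ψ (x - x₀ - a)) := by
        simp only [Function.uncurry_def]; fun_prop
      refine integral_integral_swap_of_hasCompactSupport (μ := volume) (ν := μ.restrict K) hf ?_
      refine HasCompactSupport.intro
        ((isCompact_closedBall (0 : ℂ) r).prod (isCompact_closedBall x₀ (r + r))) ?_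
      rintro ⟨a, x⟩ hax
      simp only [Function.uncurry_apply_pair]
      by_cases ha : a ∈ Metric.closedBall (0 : ℂ) r
      · have hx : x ∉ Metric.closedBall x₀ (r + r) := fun hx => hax ⟨ha, hx⟩
        rw [hψ.eq_zero, mul_zero]
        intro h
        rw [mem_closedBall_iff_norm] at ha h hx
        rw [sub_zero] at ha h
        refine hx ?_
        calc ‖x - x₀‖ = ‖(x - x₀ - a) + a‖ := by ring_nf
          _ ≤ r + r := (norm_add_le _ _).trans (add_le_add h ha)
      · rw [hη.eq_zero ha, zero_mul]
    rw [← key hη hψ, ← key hψ hη, swap hη hψ, swap hψ hη]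
    congr 1
    funext x
    rw [← integral_sub_left_eq_self (fun a => ψ a * η (x - x₀ - a)) volume (x - x₀)]
    simp [mul_comm]
  let b : ContDiffBump (0 : ℂ) := ⟨r / 2, r, by positivity, by linarith⟩
  have hb : IsTest (Metric.closedBall 0 r) (b.normed volume) := by
    refine ⟨b.contDiff_normed, b.hasCompactSupport_normed, ?_⟩
    rw [b.tsupport_normed_eq]
  refine ⟨∫ x, b.normed volume (x - x₀) ∂μ, fun ψ hψ => ?_⟩
  have hψ' : IsTest (Metric.closedBall 0 r) fun x => ψ (x - -x₀) :=
    hψ.comp_sub (-x₀) fun x hx => by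
      rw [mem_closedBall_iff_norm] at *; simpa [sub_eq_add_neg] using hx
  have h := symm hb hψ'
  rw [b.integral_normed, one_mul, integral_sub_right_eq_self] at h
  simp only [sub_neg_eq_add, sub_add_cancel] at h
  rw [h, mul_comm]

theorem eq_of_local_density {c c' : ℝ} (hr : 0 < r) (hs : 0 < s)
    (h : ∀ ψ, IsTest (Metric.ball x₀ r) ψ → ∫ x, ψ x ∂μ = c * ∫ x, ψ x)
    (h' : ∀ ψ, IsTest (Metric.ball x₀ s) ψ → ∫ x, ψ x ∂μ = c' * ∫ x, ψ x) : c = c' := by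
  have hm : 0 < min r s := lt_min hr hs
  let b : ContDiffBump x₀ := ⟨min r s / 4, min r s / 2, by positivity, by linarith⟩
  have hb {t : ℝ} (ht : min r s ≤ t) : IsTest (Metric.ball x₀ t) (b.normed volume) := by
    refine ⟨b.contDiff_normed, b.hasCompactSupport_normed, ?_⟩
    rw [b.tsupport_normed_eq]
    exact Metric.closedBall_subset_ball (by simp only [b]; linarith)
  have h1 := h _ (hb (min_le_left _ _))
  have h2 := h' _ (hb (min_le_right _ _))
  rw [b.integral_normed] at h1 h2
  linarith

/-- A measure on a connected open set whose distributional derivatives vanish is a constant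
multiple of Lebesgue measure. -/
theorem exists_integral_eq_const_mul (hU : IsOpen U) (hc : IsPreconnected U)
    (hμK : ∀ K ⊆ U, IsCompact K → μ K < ⊤)
    (hμ : ∀ ψ, IsTest U ψ → ∀ v, ∫ x, pd v ψ x ∂μ = 0) :
    ∃ c : ℝ, ∀ ψ, IsTest U ψ → ∫ x, ψ x ∂μ = c * ∫ x, ψ x := by
  -- `L x c`: the measure is `c` times the Lebesgue measure near `x`
  let L : ℂ → ℝ → Prop := fun x c => ∃ r > 0, ∀ ψ, IsTest (Metric.ball x r) ψ →
    ∫ x, ψ x ∂μ = c * ∫ x, ψ x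
  have hex (x : ℂ) (hx : x ∈ U) : ∃ c, L x c := by
    obtain ⟨r, hr0, hr⟩ := Metric.isOpen_iff.1 hU x hx
    obtain ⟨c, hc⟩ := exists_local_density (x₀ := x) (r := r / 4) hμK hμ (by positivity)
      ((Metric.closedBall_subset_ball (by linarith)).trans hr)
    exact ⟨c, r / 4, by positivity, fun ψ hψ => hc ψ (hψ.mono Metric.ball_subset_closedBall)⟩
  have huniq {x : ℂ} {c c' : ℝ} : L x c → L x c' → c = c' := by
    rintro ⟨r, hr, h⟩ ⟨s, hs, h'⟩
    exact eq_of_local_density hr hs h h'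
  have hloc {x : ℂ} {c : ℝ} : L x c → ∀ᶠ y in 𝓝 x, L y c := by
    rintro ⟨r, hr, h⟩
    filter_upwards [Metric.ball_mem_nhds x (half_pos hr)] with y hy
    refine ⟨r / 2, by positivity, fun ψ hψ => h ψ (hψ.mono (Metric.ball_subset_ball' ?_))⟩
    rw [Metric.mem_ball] at hy
    linarith
  rcases U.eq_empty_or_nonempty with rfl | ⟨x₁, hx₁⟩
  · refine ⟨0, fun ψ hψ => ?_⟩
    have : ψ = fun _ => 0 := funext fun x => hψ.eq_zero (Set.notMem_empty x)
    simp [this]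
  obtain ⟨c, hc₁⟩ := hex x₁ hx₁
  have hall (x : ℂ) (hx : x ∈ U) : L x c := by
    refine hc.induction₂ (fun x y => ∀ c, L x c → L y c) (fun x hx => ?_)
      (fun x y z _ _ _ h1 h2 c h => h2 c (h1 c h)) (fun x y hx hy h c hcy => ?_) hx₁ hx c hc₁
    · obtain ⟨c₀, hc₀⟩ := hex x hx
      filter_upwards [mem_nhdsWithin_of_mem_nhds (hloc hc₀)] with y hy c hcx
      rwa [huniq hcx hc₀]
    · obtain ⟨c₀, hc₀⟩ := hex x hx
      rwa [huniq hcy (h c₀ hc₀)]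
  choose! r hr0 hr using hall
  refine ⟨c, fun ψ hψ => ?_⟩
  set K := tsupport ψ with hKdef
  have hK : IsCompact K := hψ.2.1
  obtain ⟨δ, hδ0, hδ⟩ := lebesgue_number_lemma_of_metric (s := K) (ι := U)
    (c := fun x => Metric.ball (x : ℂ) (r x)) hK (fun _ => Metric.isOpen_ball) (fun x hx =>
      Set.mem_iUnion.2 ⟨⟨x, hψ.2.2 hx⟩, Metric.mem_ball_self (hr0 x (hψ.2.2 hx))⟩)
  -- instead of a partition of unity, `ψ` is averaged over all translates of a small bump
  let b : ContDiffBump (0 : ℂ) := ⟨δ / 8, δ / 4, by positivity, by linarith⟩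
  have : IsFiniteMeasure (μ.restrict K) := isFiniteMeasure_restrict.2 (hμK K hψ.2.2 hK).ne
  have hbc : Continuous (b.normed volume) := (b.contDiff_normed (n := 0)).continuous
  have e1 := (integral_integral_translate (μ := μ.restrict K) hψ.continuous hψ.2.1 hbc
    b.hasCompactSupport_normed).2
  have e2 := (integral_integral_translate (μ := volume) hψ.continuous hψ.2.1 hbc
    b.hasCompactSupport_normed).2
  rw [b.integral_normed, mul_one] at e1 e2
  have hψK : IsTest K ψ := ⟨hψ.1, hψ.2.1, subset_rfl⟩
  rw [hψK.setIntegral_eq_integral] at e1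
  rw [← e1, ← e2, ← integral_const_mul]
  congr 1
  funext a
  have hT : IsTest K fun z => b.normed volume (z - a) * ψ z :=
    hψK.mul_left (b.contDiff_normed.comp (contDiff_id.sub contDiff_const))
  have hsupp : tsupport (fun z => b.normed volume (z - a) * ψ z) ⊆ Metric.closedBall a (δ / 4) := by
    refine closure_minimal (fun z hz => ?_) Metric.isClosed_closedBall
    have h1 : z - a ∈ Function.support (b.normed volume) := fun h0 => hz (by simp [h0])
    rw [b.support_normed_eq, mem_ball_zero_iff] at h1
    rw [mem_closedBall_iff_norm]
    exact h1.le
  have hT' := hT.setIntegral_eq_integral (μ := μ)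
  simp only [mul_comm (b.normed volume _)] at hT' hT hsupp
  rw [hT']
  by_cases hne : ∃ p, p ∈ tsupport fun z => ψ z * b.normed volume (z - a)
  · obtain ⟨p, hp⟩ := hne
    obtain ⟨x, hx⟩ := hδ p (hT.2.2 hp)
    refine hr x x.2 _ ⟨hT.1, hT.2.1, fun z hz => hx ?_⟩
    have h1 := hsupp hz
    have h2 := hsupp hp
    rw [Metric.mem_closedBall] at h1 h2
    rw [Metric.mem_ball]
    have := dist_triangle_right z p a
    linarith
  · push Not at hne
    have (z : ℂ) : ψ z * b.normed volume (z - a) = 0 :=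
      image_eq_zero_of_notMem_tsupport (f := fun z => ψ z * b.normed volume (z - a)) (hne z)
    simp [this]

end Degree

/-! ### Pulling back test functions through a conformal map -/

section Stereographic

variable {R : E3 ≃ₗᵢ[ℝ] E3}

/-- Stereographic projection from the point `rot R north`. -/
noncomputable def stereoRot (R : E3 ≃ₗᵢ[ℝ] E3) (x : S2) : ℂ := stereo (rot R.symm x)

/-- The point of projection, as a vector. -/
noncomputable def poleVec (R : E3 ≃ₗᵢ[ℝ] E3) : E3 := R (EuclideanSpace.single 2 1)

/-- The vector of the plane of projection corresponding to the complex number `v`. -/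
noncomputable def planeVec (R : E3 ≃ₗᵢ[ℝ] E3) (v : ℂ) : E3 := R !₂[v.re, v.im, 0]

theorem rot_symm_ne_north {x : S2} (hx : x ≠ rot R north) : rot R.symm x ≠ north := by
  intro h
  apply hx
  rw [← h]
  exact Subtype.ext (R.apply_symm_apply x).symm

theorem invStereoRot_stereoRot {x : S2} (hx : x ≠ rot R north) :
    invStereoRot R (stereoRot R x) = x := by
  rw [invStereoRot, stereoRot, invStereo_stereo (rot_symm_ne_north hx)]
  exact Subtype.ext (R.apply_symm_apply x)

theorem stereoRot_invStereoRot (y : ℂ) : stereoRot R (invStereoRot R y) = y := by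
  rw [stereoRot, invStereoRot]
  have : rot R.symm (rot R (invStereo y)) = invStereo y := Subtype.ext (R.symm_apply_apply _)
  rw [this, stereo_invStereo]

theorem inner_planeVec (v w : ℂ) :
    (inner ℝ (planeVec R v) (planeVec R w) : ℝ) = v.re * w.re + v.im * w.im := by
  rw [planeVec, planeVec, R.inner_map_map, inner_E3]; simp

theorem inner_planeVec_poleVec (v : ℂ) : (inner ℝ (planeVec R v) (poleVec R) : ℝ) = 0 := by
  rw [planeVec, poleVec, R.inner_map_map, inner_E3]; simp

theorem norm_poleVec : ‖poleVec R‖ = 1 := by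
  rw [poleVec, R.norm_map]; simp

theorem rot_symm_apply (x : S2) (i : Fin 3) :
    (rot R.symm x : E3) i = inner ℝ (R (EuclideanSpace.single i 1)) (x : E3) := by
  rw [← R.symm.inner_map_map, R.symm_apply_apply, inner_single_E3]; rfl

theorem inner_poleVec_ne_one {x : S2} (hx : x ≠ rot R north) :
    (inner ℝ (poleVec R) (x : E3) : ℝ) ≠ 1 := by
  rw [poleVec, ← rot_symm_apply]
  exact coord_two_ne_one (rot_symm_ne_north hx)

theorem stereoRot_eq_mk (x : S2) : stereoRot R x =
    ⟨inner ℝ (planeVec R 1) (x : E3) * (1 - inner ℝ (poleVec R) (x : E3))⁻¹,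
      inner ℝ (planeVec R Complex.I) (x : E3) * (1 - inner ℝ (poleVec R) (x : E3))⁻¹⟩ := by
  have h0 : planeVec R 1 = R (EuclideanSpace.single 0 1) := by
    rw [planeVec]; congr 1; ext i; fin_cases i <;> simp
  have h1 : planeVec R Complex.I = R (EuclideanSpace.single 1 1) := by
    rw [planeVec]; congr 1; ext i; fin_cases i <;> simp
  rw [stereoRot, stereo_eq_mk, rot_symm_apply, rot_symm_apply, rot_symm_apply, h0, h1]
  rfl

theorem continuous_invStereo : Continuous invStereo := by
  refine Continuous.subtype_mk ?_ _
  have h (z : ℂ) : 1 + ‖z‖ ^ 2 ≠ 0 := by positivity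
  have hd : Continuous fun z : ℂ => 1 + ‖z‖ ^ 2 := by fun_prop
  refine (PiLp.continuous_toLp 2 _).comp (continuous_pi fun i => ?_)
  fin_cases i
  · exact (continuous_const.mul Complex.continuous_re).div hd h
  · exact (continuous_const.mul Complex.continuous_im).div hd h
  · exact (Continuous.sub (by fun_prop) continuous_const).div hd h

theorem continuous_rot : Continuous (rot R) :=
  Continuous.subtype_mk (R.continuous.comp continuous_subtype_val) _

theorem continuous_invStereoRot : Continuous (invStereoRot R) :=
  continuous_rot.comp continuous_invStereo

theorem continuousAt_stereoRot {x : S2} (hx : x ≠ rot R north) :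
    ContinuousAt (stereoRot R) x := by
  have hi (c : E3) : ContinuousAt (fun x : S2 => (inner ℝ c (x : E3) : ℝ)) x := by fun_prop
  have hq : ContinuousAt (fun x : S2 => (1 - inner ℝ (poleVec R) (x : E3) : ℝ)⁻¹) x :=
    (continuousAt_const.sub (hi _)).inv₀ (sub_ne_zero.2 (inner_poleVec_ne_one hx).symm)
  have e : stereoRot R = fun x : S2 =>
      ((inner ℝ (planeVec R 1) (x : E3) * (1 - inner ℝ (poleVec R) (x : E3))⁻¹ : ℝ) : ℂ) +
      ((inner ℝ (planeVec R Complex.I) (x : E3) *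
        (1 - inner ℝ (poleVec R) (x : E3))⁻¹ : ℝ) : ℂ) * Complex.I := by
    funext x
    rw [stereoRot_eq_mk, Complex.mk_eq_add_mul_I]
  rw [e]
  exact (Complex.continuous_ofReal.continuousAt.comp ((hi _).mul hq)).add
    ((Complex.continuous_ofReal.continuousAt.comp ((hi _).mul hq)).mul continuousAt_const)

/-- Away from the point of projection the projected region is bounded, open and connected. -/
theorem preimage_invStereoRot {Ω : Set S2} (hΩ : IsOpen Ω) (hc : IsConnected Ω)
    (hR : rot R north ∉ closure Ω) :
    IsOpen (invStereoRot R ⁻¹' Ω) ∧ Bornology.IsBounded (invStereoRot R ⁻¹' Ω) ∧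
      IsConnected (invStereoRot R ⁻¹' Ω) := by
  have hne {x : S2} (hx : x ∈ closure Ω) : x ≠ rot R north := fun h => hR (h ▸ hx)
  have hcont : ContinuousOn (stereoRot R) (closure Ω) := fun x hx =>
    (continuousAt_stereoRot (hne hx)).continuousWithinAt
  have him : invStereoRot R ⁻¹' Ω = stereoRot R '' Ω := by
    ext y
    constructor
    · exact fun hy => ⟨_, hy, stereoRot_invStereoRot y⟩
    · rintro ⟨x, hx, rfl⟩
      rw [Set.mem_preimage, invStereoRot_stereoRot (hne (subset_closure hx))]
      exact hx
  refine ⟨hΩ.preimage continuous_invStereoRot, ?_, ?_⟩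
  · rw [him]
    exact (isClosed_closure.isCompact.image_of_continuousOn hcont).isBounded.subset
      (Set.image_mono subset_closure)
  · rw [him]
    exact hc.image _ (hcont.mono subset_closure)

theorem isCompactWeight_invStereoRot (R : E3 ≃ₗᵢ[ℝ] E3) (U : Set ℂ) (hU : IsOpen U) :
    IsCompactWeight U (areaDensity (invStereoRot R)) := by
  have hw : ContinuousOn (areaDensity (invStereoRot R)) U := continuousOn_areaDensity fun z _ => by
    rw [areaDensity_invStereoRot]; exact isConformalHarmonicAt_invStereoRot R z
  refine ⟨hw, fun z _ => by rw [areaDensity_invStereoRot]; positivity, fun ε hε =>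
    ⟨4, by norm_num, fun u hu => ?_⟩⟩
  have h1 : mass (areaDensity (invStereoRot R)) u ≤ 4 * ∫ z, u z ^ 2 := by
    rw [mass, ← integral_const_mul]
    have hu2 : Integrable fun z => u z ^ 2 := by simpa [pow_two] using (hu.mul hu).integrable
    refine integral_mono (hu.integrable_weight_sq hU hw) (hu2.const_mul 4) fun z => ?_
    simp only [areaDensity_invStereoRot]
    have h2 : (1 + ‖z‖ ^ 2)⁻¹ ≤ 1 := inv_le_one_of_one_le₀ (by nlinarith [norm_nonneg z])
    have h3 : ((1 + ‖z‖ ^ 2)⁻¹) ^ 2 ≤ 1 := pow_le_one₀ (by positivity) h2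
    nlinarith [sq_nonneg (u z)]
  have h4 := mul_nonneg hε.le (energy_nonneg u)
  linarith

end Stereographic

section Pullback

variable {N : ℂ → S2} {D : Set ℂ} {Ω : Set S2} {R : E3 ≃ₗᵢ[ℝ] E3} {ψ : ℂ → ℝ} {z : ℂ}

/-- The composition of a test function on the projection of `Ω` with the projection of `N`,
extended by zero. -/
noncomputable def pullback (N : ℂ → S2) (D : Set ℂ) (Ω : Set S2) (R : E3 ≃ₗᵢ[ℝ] E3) (ψ : ℂ → ℝ) :
    ℂ → ℝ :=
  (D ∩ N ⁻¹' Ω).indicator fun z => ψ (stereoRot R (N z))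

/-- The factor by which the projection of the conformal map `N` multiplies areas. -/
noncomputable def projDensity (N : ℂ → S2) (R : E3 ≃ₗᵢ[ℝ] E3) (z : ℂ) : ℝ :=
  areaDensity N z * ((1 - coord N (poleVec R) z)⁻¹) ^ 2

/-- The region `D` lies properly over `Ω`: the map `N` is a conformal harmonic map on `D`, and the
inverse image of a compact subset of `Ω` is compact. -/
structure IsProperOver (N : ℂ → S2) (D : Set ℂ) (Ω : Set S2) : Prop where
  isOpen : IsOpen D
  isOpen_target : IsOpen Ω
  continuousOn : ContinuousOn N D
  harmonic : ∀ z ∈ D, IsConformalHarmonicAt N (areaDensity N z) z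
  isCompact_preimage : ∀ K ⊆ Ω, IsCompact K → IsCompact (D ∩ N ⁻¹' K)

/-- Properness holds because the boundary values of `N` avoid `Ω`. -/
theorem IsProperOver.of_frontier (hD : IsOpen D) (hDb : Bornology.IsBounded D) (hΩ : IsOpen Ω)
    (hN : ∀ z ∈ D, IsConformalHarmonicAt N (areaDensity N z) z) (hNc : ContinuousOn N (closure D))
    (hfr : (N '' frontier D) ∩ Ω = ∅) : IsProperOver N D Ω where
  isOpen := hD
  isOpen_target := hΩ
  continuousOn := hNc.mono subset_closure
  harmonic := hN
  isCompact_preimage := by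
    intro K hK hKc
    have h : D ∩ N ⁻¹' K = closure D ∩ N ⁻¹' K := by
      refine Set.Subset.antisymm (Set.inter_subset_inter_left _ subset_closure) ?_
      rintro z ⟨hz, hzK⟩
      refine ⟨?_, hzK⟩
      by_contra hzD
      have : N z ∈ (N '' frontier D) ∩ Ω :=
        ⟨⟨z, ⟨hz, by rwa [hD.interior_eq]⟩, rfl⟩, hK hzK⟩
      rw [hfr] at this
      exact this
    rw [h]
    exact hDb.isCompact_closure.of_isClosed_subset
      (hNc.preimage_isClosed_of_isClosed isClosed_closure hKc.isClosed) Set.inter_subset_left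

theorem IsProperOver.isOpen_inter (hP : IsProperOver N D Ω) : IsOpen (D ∩ N ⁻¹' Ω) :=
  hP.continuousOn.isOpen_inter_preimage hP.isOpen hP.isOpen_target

theorem coord_poleVec_ne_one (hR : rot R north ∉ closure Ω) (hz : z ∈ D ∩ N ⁻¹' Ω) : coord N (poleVec R) z ≠ 1 :=
  inner_poleVec_ne_one fun h => hR (h ▸ subset_closure hz.2)

/-- The equations of the projection of `N`; its component in the direction `v` is the function
`coord N (planeVec R v) * (1 - coord N (poleVec R))⁻¹`. -/
theorem IsProperOver.projection (hP : IsProperOver N D Ω)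
    (hR : rot R north ∉ closure Ω) (hz : z ∈ D ∩ N ⁻¹' Ω) :
    (∀ c, ContDiffAt ℝ ∞ (fun w => coord N c w * (1 - coord N (poleVec R) w)⁻¹) z) ∧
    (∀ v w : ℂ, gradDot (fun y => coord N (planeVec R v) y * (1 - coord N (poleVec R) y)⁻¹)
        (fun y => coord N (planeVec R w) y * (1 - coord N (poleVec R) y)⁻¹) z =
        projDensity N R z * (v.re * w.re + v.im * w.im)) ∧
    ∀ v : ℂ, lap (fun y => coord N (planeVec R v) y * (1 - coord N (poleVec R) y)⁻¹) z = 0 := by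
  obtain ⟨h1, h2, h3⟩ := (hP.harmonic z hz.1).stereographic (norm_poleVec (R := R))
    (coord_poleVec_ne_one hR hz)
  refine ⟨h1, fun v w => ?_, fun v => h3 _ (inner_planeVec_poleVec v)⟩
  rw [h2 _ _ (inner_planeVec_poleVec v) (inner_planeVec_poleVec w), inner_planeVec, projDensity]

theorem areaDensity_eq_projDensity_mul (hR : rot R north ∉ closure Ω) (hz : z ∈ D ∩ N ⁻¹' Ω) :
    areaDensity N z =
    projDensity N R z * areaDensity (invStereoRot R) (stereoRot R (N z)) := by
  have hne := coord_poleVec_ne_one hR hz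
  have hh : 1 - coord N (poleVec R) z ≠ 0 := sub_ne_zero.2 hne.symm
  have hs := sphere_eq (rot R.symm (N z))
  have hpole : (rot R.symm (N z) : E3) 2 = coord N (poleVec R) z := by
    rw [rot_symm_apply]; rfl
  have hn : 1 + ‖stereoRot R (N z)‖ ^ 2 = 2 * (1 - coord N (poleVec R) z)⁻¹ := by
    rw [stereoRot, stereo_eq_mk, Complex.sq_norm, Complex.normSq_apply, hpole]
    rw [hpole] at hs
    field_simp
    linear_combination hs
  rw [areaDensity_invStereoRot, hn, projDensity]
  field_simp
  norm_num

theorem IsProperOver.isCompact_inter (hP : IsProperOver N D Ω)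
    (hR : rot R north ∉ closure Ω) {K : Set ℂ} (hK : IsCompact K)
    (hKU : K ⊆ invStereoRot R ⁻¹' Ω) :
    IsCompact (D ∩ N ⁻¹' (invStereoRot R '' K)) ∧
      D ∩ N ⁻¹' (invStereoRot R '' K) ⊆ D ∩ N ⁻¹' Ω ∧
      ∀ z ∈ D ∩ N ⁻¹' Ω, stereoRot R (N z) ∈ K → z ∈ D ∩ N ⁻¹' (invStereoRot R '' K) := by
  have hsub : invStereoRot R '' K ⊆ Ω := Set.image_subset_iff.2 hKU
  refine ⟨hP.isCompact_preimage _ hsub (hK.image continuous_invStereoRot),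
    Set.inter_subset_inter_right _ (Set.preimage_mono hsub), fun z hz hzK => ⟨hz.1, _, hzK, ?_⟩⟩
  exact invStereoRot_stereoRot fun h => hR (h ▸ subset_closure hz.2)

theorem IsProperOver.isTest_pullback (hP : IsProperOver N D Ω)
    (hR : rot R north ∉ closure Ω) (hψ : IsTest (invStereoRot R ⁻¹' Ω) ψ) :
    IsTest (D ∩ N ⁻¹' Ω) (pullback N D Ω R ψ) := by
  obtain ⟨hSc, hSV, hS⟩ := hP.isCompact_inter hR hψ.2.1 hψ.2.2
  set S := D ∩ N ⁻¹' (invStereoRot R '' tsupport ψ)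
  have hzero (z : ℂ) (hz : z ∉ S) : pullback N D Ω R ψ z = 0 := by
    rw [pullback]
    by_cases hzV : z ∈ D ∩ N ⁻¹' Ω
    · rw [Set.indicator_of_mem hzV]
      exact image_eq_zero_of_notMem_tsupport fun h => hz (hS z hzV h)
    · exact Set.indicator_of_notMem hzV _
  have hts : tsupport (pullback N D Ω R ψ) ⊆ S :=
    closure_minimal (fun z hz => by by_contra h; exact hz (hzero z h)) hSc.isClosed
  refine ⟨contDiff_iff_contDiffAt.2 fun z => ?_, HasCompactSupport.intro hSc hzero,
    hts.trans hSV⟩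
  by_cases hz : z ∈ S
  · have hev : pullback N D Ω R ψ =ᶠ[𝓝 z] fun w => ψ (stereoRot R (N w)) := by
      filter_upwards [hP.isOpen_inter.mem_nhds (hSV hz)] with w hw
      exact Set.indicator_of_mem hw _
    refine ContDiffAt.congr_of_eventuallyEq ?_ hev
    refine hψ.1.contDiffAt.comp z ?_
    have e : (fun w => stereoRot R (N w)) = fun w => Complex.equivRealProdCLM.symm
        (coord N (planeVec R 1) w * (1 - coord N (poleVec R) w)⁻¹,
          coord N (planeVec R Complex.I) w * (1 - coord N (poleVec R) w)⁻¹) := by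
      funext w
      rw [stereoRot_eq_mk]
      apply Complex.ext <;> simp [coord]
    rw [e]
    have hp := (hP.projection hR (hSV hz)).1
    exact Complex.equivRealProdCLM.symm.contDiff.contDiffAt.comp z
      ((hp (planeVec R 1)).prodMk (hp (planeVec R Complex.I)))
  · refine (contDiffAt_const (c := (0 : ℝ))).congr_of_eventuallyEq ?_
    filter_upwards [hSc.isClosed.isOpen_compl.mem_nhds hz] with w hw using hzero w hw

theorem IsProperOver.pd_pullback (hP : IsProperOver N D Ω)
    (hR : rot R north ∉ closure Ω) (hψ : IsTest (invStereoRot R ⁻¹' Ω) ψ) (hz : z ∈ D ∩ N ⁻¹' Ω)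
    (v : ℂ) : pd v (pullback N D Ω R ψ) z =
      pd 1 ψ (stereoRot R (N z)) *
        pd v (fun w => coord N (planeVec R 1) w * (1 - coord N (poleVec R) w)⁻¹) z +
      pd Complex.I ψ (stereoRot R (N z)) *
        pd v (fun w => coord N (planeVec R Complex.I) w * (1 - coord N (poleVec R) w)⁻¹) z := by
  have hp := (hP.projection hR hz).1
  have hev : pullback N D Ω R ψ =ᶠ[𝓝 z] fun w =>
      ψ ⟨coord N (planeVec R 1) w * (1 - coord N (poleVec R) w)⁻¹,
        coord N (planeVec R Complex.I) w * (1 - coord N (poleVec R) w)⁻¹⟩ := by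
    filter_upwards [hP.isOpen_inter.mem_nhds hz] with w hw
    rw [pullback, Set.indicator_of_mem hw, stereoRot_eq_mk]
    rfl
  rw [pd_congr hev, pd_comp_complex ψ ((hp _).differentiableAt (by simp))
    ((hp _).differentiableAt (by simp)) (hψ.differentiableAt _), stereoRot_eq_mk]
  rfl

/-- The Dirichlet integrand is conformally invariant. -/
theorem IsProperOver.gradDot_pullback (hP : IsProperOver N D Ω)
    (hR : rot R north ∉ closure Ω) (hψ : IsTest (invStereoRot R ⁻¹' Ω) ψ)
    (hz : z ∈ D ∩ N ⁻¹' Ω) : gradDot (pullback N D Ω R ψ) (pullback N D Ω R ψ) z =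
      projDensity N R z * gradDot ψ ψ (stereoRot R (N z)) := by
  have h11 := (hP.projection hR hz).2.1 1 1
  have h1I := (hP.projection hR hz).2.1 1 Complex.I
  have hII := (hP.projection hR hz).2.1 Complex.I Complex.I
  simp only [gradDot, Complex.one_re, Complex.one_im, Complex.I_re, Complex.I_im]
    at h11 h1I hII ⊢
  simp only [hP.pd_pullback hR hψ hz]
  set y := stereoRot R (N z)
  linear_combination pd 1 ψ y ^ 2 * h11 + 2 * pd 1 ψ y * pd Complex.I ψ y * h1I +
    pd Complex.I ψ y ^ 2 * hII

theorem IsProperOver.gradDot_pullback_projection (hP : IsProperOver N D Ω)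
    (hR : rot R north ∉ closure Ω) (hψ : IsTest (invStereoRot R ⁻¹' Ω) ψ)
    (hz : z ∈ D ∩ N ⁻¹' Ω) (v : ℂ) : gradDot (pullback N D Ω R ψ)
      (fun y => coord N (planeVec R v) y * (1 - coord N (poleVec R) y)⁻¹) z =
      projDensity N R z * pd v ψ (stereoRot R (N z)) := by
  have h1 := (hP.projection hR hz).2.1 1 v
  have hI := (hP.projection hR hz).2.1 Complex.I v
  have e : pd v ψ (stereoRot R (N z)) = v.re * pd 1 ψ (stereoRot R (N z)) +
      v.im * pd Complex.I ψ (stereoRot R (N z)) := by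
    simp only [pd]
    conv_lhs => rw [show v = v.re • (1:ℂ) + v.im • Complex.I by apply Complex.ext <;> simp]
    rw [map_add, map_smul, map_smul]
    simp
  rw [e]
  simp only [gradDot, Complex.one_re, Complex.one_im, Complex.I_re, Complex.I_im] at h1 hI ⊢
  simp only [hP.pd_pullback hR hψ hz]
  set y := stereoRot R (N z)
  linear_combination pd 1 ψ y * h1 + pd Complex.I ψ y * hI

theorem IsProperOver.continuousOn_projDensity (hP : IsProperOver N D Ω)
    (hR : rot R north ∉ closure Ω) :
    ContinuousOn (projDensity N R) (D ∩ N ⁻¹' Ω) := by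
  intro z hz
  have h1 : ContinuousWithinAt (areaDensity N) (D ∩ N ⁻¹' Ω) z :=
    (continuousOn_areaDensity hP.harmonic z hz.1).mono Set.inter_subset_left
  have h2 : ContinuousAt (coord N (poleVec R)) z := ((hP.harmonic z hz.1).1 _).continuousAt
  exact h1.mul (((continuousAt_const.sub h2).inv₀
    (sub_ne_zero.2 (coord_poleVec_ne_one hR hz).symm)).pow 2).continuousWithinAt

theorem IsProperOver.projDensity_nonneg (hP : IsProperOver N D Ω) (hz : z ∈ D ∩ N ⁻¹' Ω) : 0 ≤ projDensity N R z :=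
  mul_nonneg (hP.harmonic z hz.1).nonneg (sq_nonneg _)

theorem IsProperOver.continuousOn_stereoRot_comp (hP : IsProperOver N D Ω)
    (hR : rot R north ∉ closure Ω) :
    ContinuousOn (fun z => stereoRot R (N z)) (D ∩ N ⁻¹' Ω) := fun z hz =>
  ContinuousAt.comp_continuousWithinAt (f := N)
    (continuousAt_stereoRot fun h => hR (h ▸ subset_closure hz.2))
    ((hP.continuousOn z hz.1).mono Set.inter_subset_left)

/-- The map `N` covers `Ω` with constant multiplicity: the image under its projection of the
measure with density `projDensity N R` is a constant multiple of the Lebesgue measure. Its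
distributional derivatives vanish because the components of the projection are harmonic. -/
theorem IsProperOver.exists_degree (hP : IsProperOver N D Ω)
    (hR : rot R north ∉ closure Ω) (hΩ : IsConnected Ω) :
    ∃ c : ℝ, ∀ ψ, IsTest (invStereoRot R ⁻¹' Ω) ψ →
      ∫ z in D ∩ N ⁻¹' Ω, projDensity N R z * ψ (stereoRot R (N z)) = c * ∫ y, ψ y := by
  set V := D ∩ N ⁻¹' Ω with hV
  have hVo : IsOpen V := hP.isOpen_inter
  have hVm := hVo.measurableSet
  have hJc : ContinuousOn (projDensity N R) V := hP.continuousOn_projDensity hR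
  have hJm : AEMeasurable (projDensity N R) (volume.restrict V) := hJc.aemeasurable hVm
  have hJm' : AEMeasurable (fun z => (projDensity N R z).toNNReal) (volume.restrict V) :=
    hJm.real_toNNReal
  let κ : Measure ℂ := (volume.restrict V).withDensity
    fun z => ((projDensity N R z).toNNReal : ENNReal)
  have hf : AEMeasurable (fun z => stereoRot R (N z)) κ :=
    ((hP.continuousOn_stereoRot_comp hR).aemeasurable hVm).mono_ac
      (withDensity_absolutelyContinuous _ _)
  let μ : Measure ℂ := κ.map fun z => stereoRot R (N z)
  have hμ (ψ : ℂ → ℝ) (hψ : Continuous ψ) :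
      ∫ y, ψ y ∂μ = ∫ z in V, projDensity N R z * ψ (stereoRot R (N z)) := by
    simp only [μ, κ]
    rw [integral_map hf hψ.aestronglyMeasurable, integral_withDensity_eq_integral_smul₀ hJm']
    refine setIntegral_congr_fun hVm fun z hz => ?_
    simp only [NNReal.smul_def, smul_eq_mul, Real.coe_toNNReal _ (hP.projDensity_nonneg hz)]
  obtain ⟨hUo, -, hUc⟩ := preimage_invStereoRot hP.isOpen_target hΩ hR
  suffices h : (∀ K ⊆ invStereoRot R ⁻¹' Ω, IsCompact K → μ K < ⊤) ∧
      ∀ ψ, IsTest (invStereoRot R ⁻¹' Ω) ψ → ∀ v, ∫ x, pd v ψ x ∂μ = 0 by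
    obtain ⟨c, hc⟩ := exists_integral_eq_const_mul hUo hUc.isPreconnected h.1 h.2
    exact ⟨c, fun ψ hψ => by rw [← hμ ψ hψ.continuous]; exact hc ψ hψ⟩
  refine ⟨fun K hKU hK => ?_, fun ψ hψ v => ?_⟩
  · obtain ⟨hSc, hSV, hS⟩ := hP.isCompact_inter hR hK hKU
    set S := D ∩ N ⁻¹' (invStereoRot R '' K)
    have h1 : μ K ≤ κ S + κ Vᶜ := by
      simp only [μ]
      rw [Measure.map_apply_of_aemeasurable hf hK.measurableSet]
      refine (measure_mono ?_).trans (measure_union_le S Vᶜ)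
      intro z hz
      by_cases hzV : z ∈ V
      · exact Or.inl (hS z hzV hz)
      · exact Or.inr hzV
    have h2 : κ Vᶜ = 0 := withDensity_absolutelyContinuous _ _ (by simp [hVm])
    have h3 : κ S < ⊤ := by
      simp only [κ]
      rw [withDensity_apply _ hSc.measurableSet, Measure.restrict_restrict hSc.measurableSet,
        Set.inter_eq_left.2 hSV]
      exact ((hJc.mono hSV).integrableOn_compact hSc).lintegral_lt_top
    rw [h2, add_zero] at h1
    exact h1.trans_lt h3
  · rw [hμ _ (hψ.isTest_pd v).continuous]
    have hu := hP.isTest_pullback hR hψ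
    have hp (z : ℂ) (hz : z ∈ V) := hP.projection hR hz
    have hgreen := integral_gradDot_eq_neg_integral_mul_lap hu.1 hu.2.1
      (F := fun y => coord N (planeVec R v) y * (1 - coord N (poleVec R) y)⁻¹)
      fun z hz => contDiffAt_two ((hp z (hu.2.2 hz)).1 _)
    have h0 : ∫ z, pullback N D Ω R ψ z *
        lap (fun y => coord N (planeVec R v) y * (1 - coord N (poleVec R) y)⁻¹) z = 0 := by
      refine integral_eq_zero_of_ae (Eventually.of_forall fun z => ?_)
      by_cases hz : z ∈ V
      · simp [(hp z hz).2.2 v]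
      · simp [hu.eq_zero hz]
    rw [h0, neg_zero, ← hu.setIntegral_gradDot] at hgreen
    rw [← hgreen]
    exact setIntegral_congr_fun hVm fun z hz => (hP.gradDot_pullback_projection hR hψ hz v).symm

/-- Pulling back test functions multiplies both quadratic forms by the degree. -/
theorem IsProperOver.exists_energy_mass_pullback (hP : IsProperOver N D Ω)
    (hR : rot R north ∉ closure Ω) (hΩ : IsConnected Ω)
    (hpos : ∃ z ∈ D ∩ N ⁻¹' Ω, 0 < areaDensity N z) :
    ∃ c : ℝ, 0 < c ∧ ∀ ψ, IsTest (invStereoRot R ⁻¹' Ω) ψ →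
      energy (pullback N D Ω R ψ) = c * energy ψ ∧
      mass (areaDensity N) (pullback N D Ω R ψ) = c * mass (areaDensity (invStereoRot R)) ψ := by
  obtain ⟨c, hc⟩ := hP.exists_degree hR hΩ
  have hVm : MeasurableSet (D ∩ N ⁻¹' Ω) := hP.isOpen_inter.measurableSet
  have hρ : ContDiff ℝ ∞ (areaDensity (invStereoRot R)) := by
    have : areaDensity (invStereoRot R) = fun z => 4 * ((1 + ‖z‖ ^ 2)⁻¹) ^ 2 :=
      funext (areaDensity_invStereoRot R)
    rw [this]
    exact contDiff_const.mul (((contDiff_const.add (contDiff_norm_sq ℝ)).inv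
      fun z => by positivity).pow 2)
  have hmass {ψ : ℂ → ℝ} (hψ : IsTest (invStereoRot R ⁻¹' Ω) ψ) :
      mass (areaDensity N) (pullback N D Ω R ψ) = c * mass (areaDensity (invStereoRot R)) ψ := by
    have hu := hP.isTest_pullback hR hψ
    have h1 := hc _ ((hψ.mul hψ).mul_left hρ)
    simp only [mass, pow_two]
    have h2 := hu.setIntegral_eq (h := fun z => areaDensity N z * pullback N D Ω R ψ z)
    simp only [mul_assoc] at h2
    rw [← h1, ← h2]
    refine setIntegral_congr_fun hVm fun z hz => ?_
    simp only [pullback, Set.indicator_of_mem hz]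
    rw [areaDensity_eq_projDensity_mul hR hz]
    ring
  refine ⟨c, ?_, fun ψ hψ => ⟨?_, hmass hψ⟩⟩
  -- the pullback of a bump function has positive mass
  · obtain ⟨z, hz, hwz⟩ := hpos
    set y := stereoRot R (N z) with hy
    have hUo := hP.isOpen_target.preimage (continuous_invStereoRot (R := R))
    have hyU : y ∈ invStereoRot R ⁻¹' Ω := by
      rw [Set.mem_preimage, hy, invStereoRot_stereoRot fun h => hR (h ▸ subset_closure hz.2)]
      exact hz.2
    obtain ⟨r, hr0, hr⟩ := Metric.isOpen_iff.1 hUo y hyU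
    let b : ContDiffBump y := ⟨r / 4, r / 2, by positivity, by linarith⟩
    have hb : IsTest (invStereoRot R ⁻¹' Ω) b := by
      refine ⟨b.contDiff, b.hasCompactSupport, ?_⟩
      rw [b.tsupport_eq]
      exact (Metric.closedBall_subset_ball (by simp only [b]; linarith)).trans hr
    have hw := continuousOn_areaDensity hP.harmonic
    have hu := (hP.isTest_pullback hR hb).mono Set.inter_subset_left
    have hm : 0 < mass (areaDensity N) (pullback N D Ω R b) := by
      have hcs := hu.weight_mul hP.isOpen hw hu.continuous
      have e : (fun x => areaDensity N x * pullback N D Ω R b x ^ 2) =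
        fun x => areaDensity N x * pullback N D Ω R b x * pullback N D Ω R b x := by
        funext x; ring
      rw [mass, e]
      refine hcs.1.integral_pos_of_hasCompactSupport_nonneg_nonzero hcs.2 (fun x => ?_) (x := z) ?_
      · by_cases hx : x ∈ D
        · have := mul_nonneg (hP.harmonic x hx).nonneg (mul_self_nonneg (pullback N D Ω R b x))
          simpa [mul_assoc] using this
        · simp [hu.eq_zero hx]
      · have : pullback N D Ω R b z = 1 := by
          rw [pullback, Set.indicator_of_mem hz]
          exact b.one_of_mem_closedBall (Metric.mem_closedBall_self b.rIn_pos.le)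
        simp [this, hwz.ne']
    rw [hmass hb] at hm
    have hm0 : 0 ≤ mass (areaDensity (invStereoRot R)) b :=
      mass_nonneg (D := invStereoRot R ⁻¹' Ω)
        (fun x _ => by rw [areaDensity_invStereoRot]; positivity) hb
    by_contra! h
    have := mul_nonpos_of_nonpos_of_nonneg h hm0
    linarith
  · have hu := hP.isTest_pullback hR hψ
    rw [energy, energy, ← hc _ (hψ.isTest_gradDot hψ), ← hu.setIntegral_gradDot]
    exact setIntegral_congr_fun hVm fun z hz => hP.gradDot_pullback hR hψ hz

end Pullback

/-! ### Openness of conformal maps and the exterior of the boundary -/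

section Openness

variable {N : ℂ → S2} {D : Set ℂ} {z : ℂ}

theorem continuousAt_stereo {x : S2} (hx : x ≠ north) : ContinuousAt stereo x := by
  have hi (i : Fin 3) : ContinuousAt (fun x : S2 => (((x : E3) i : ℝ) : ℂ)) x := by fun_prop
  refine ((hi 0).add ((hi 1).mul continuousAt_const)).div (continuousAt_const.sub (hi 2)) ?_
  rw [← Complex.ofReal_one, ← Complex.ofReal_sub, Complex.ofReal_ne_zero]
  exact sub_ne_zero.2 (coord_two_ne_one hx).symm

theorem coord_two_ne_neg_one {x : S2} (hx : x ≠ south) : (x : E3) 2 ≠ -1 := by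
  intro h
  apply hx
  have hs := sphere_eq x
  rw [h] at hs
  have h0 : (x : E3) 0 = 0 := by nlinarith [sq_nonneg ((x : E3) 0), sq_nonneg ((x : E3) 1)]
  have h1 : (x : E3) 1 = 0 := by nlinarith [sq_nonneg ((x : E3) 0), sq_nonneg ((x : E3) 1)]
  apply Subtype.ext
  ext i
  fin_cases i <;> simp [south, h, h0, h1]

theorem continuousAt_stereoInv {x : S2} (hx : x ≠ south) : ContinuousAt stereoInv x := by
  have hi (i : Fin 3) : ContinuousAt (fun x : S2 => (((x : E3) i : ℝ) : ℂ)) x := by fun_prop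
  refine ((hi 0).sub ((hi 1).mul continuousAt_const)).div (continuousAt_const.add (hi 2)) ?_
  rw [← Complex.ofReal_one, ← Complex.ofReal_add, Complex.ofReal_ne_zero]
  intro h
  exact coord_two_ne_neg_one hx (by linarith)

/-- The chart `stereoInv` has an inverse away from the south pole. -/
theorem exists_invStereoInv :
    ∃ τ : ℂ → S2, ∀ x : S2, x ≠ south → τ (stereoInv x) = x := by
  refine ⟨fun y => ⟨halfTurn (invStereo y), ?_⟩, fun x hx => ?_⟩
  · rw [mem_sphere_zero_iff_norm, ← sq_eq_sq₀ (norm_nonneg _) zero_le_one,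
      ← real_inner_self_eq_norm_sq, inner_halfTurn, real_inner_self_eq_norm_sq,
      norm_eq_of_mem_sphere]
  · refine Subtype.ext (ext_inner_left ℝ fun c => ?_)
    rw [← inner_halfTurn_invStereo_stereoInv hx c]
    simp [inner_E3, halfTurn]

/-- A map which is given by a nonconstant analytic function in a chart is open. -/
theorem nhds_le_map_of_chart {σ : S2 → ℂ} {τ : ℂ → S2} (hσ : ContinuousAt σ (N z))
    (hτ : ∀ᶠ x in 𝓝 (N z), τ (σ x) = x) (hN : ContinuousAt N z)
    (han : AnalyticAt ℂ (fun w => σ (N w)) z) (hnc : ¬ ∀ᶠ w in 𝓝 z, N w = N z) :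
    𝓝 (N z) ≤ map N (𝓝 z) := by
  have hev : ∀ᶠ w in 𝓝 z, τ (σ (N w)) = N w := hN.eventually hτ
  rcases han.eventually_constant_or_nhds_le_map_nhds with h | h
  · refine absurd ?_ hnc
    filter_upwards [h, hev] with w hw hw'
    rw [← hw', hw, hev.self_of_nhds]
  · calc 𝓝 (N z) = map (fun x => τ (σ x)) (𝓝 (N z)) := 
          (map_id.symm.trans (map_congr (hτ.mono fun x hx => hx.symm)))
      _ = map τ (map σ (𝓝 (N z))) := map_map.symm
      _ ≤ map τ (𝓝 (σ (N z))) := map_mono hσ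
      _ ≤ map τ (map (fun w => σ (N w)) (𝓝 z)) := map_mono h
      _ = map N (𝓝 z) := by rw [map_map]; exact map_congr hev

theorem IsConformalMap.nhds_le_map (hN : IsConformalMap N D) (hD : IsOpen D) (hz : z ∈ D) :
    𝓝 (N z) ≤ map N (𝓝 z) := by
  have hc : ContinuousAt N z := hN.1.continuousAt (hD.mem_nhds hz)
  rcases hN.2.1 z hz with ⟨hne, han⟩ | ⟨hne, han⟩
  · refine nhds_le_map_of_chart (continuousAt_stereo hne) (τ := invStereo) ?_ hc han (hN.2.2 z hz)
    filter_upwards [isOpen_ne.mem_nhds hne] with x hx using invStereo_stereo hx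
  · obtain ⟨τ, hτ⟩ := exists_invStereoInv
    refine nhds_le_map_of_chart (continuousAt_stereoInv hne) (τ := τ) ?_ hc han (hN.2.2 z hz)
    filter_upwards [isOpen_ne.mem_nhds hne] with x hx using hτ x hx

/-- If the density vanished on an open set, then `N` would be constant there. -/
theorem IsConformalMap.exists_areaDensity_pos (hN : IsConformalMap N D) (hD : IsOpen D)
    {V : Set ℂ} (hV : IsOpen V) (hVD : V ⊆ D) (hne : V.Nonempty) :
    ∃ z ∈ V, 0 < areaDensity N z := by
  by_contra! h
  obtain ⟨a, ha⟩ := hne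
  obtain ⟨r, hr0, hr⟩ := Metric.isOpen_iff.1 hV a ha
  refine hN.2.2 a (hVD ha) ?_
  have hd (z : ℂ) (hz : z ∈ D) : DifferentiableAt ℝ (fun w => (N w : E3)) z :=
    (hN.isConformalHarmonicAt hD hz).contDiffAt.differentiableAt (by simp)
  have h0 : (Metric.ball a r).EqOn (fderiv ℝ fun w => (N w : E3)) 0 := by
    intro z hz
    have h1 := h z (hr hz)
    rw [areaDensity, gradSq] at h1
    have h2 : fderiv ℝ (fun w => (N w : E3)) z 1 = 0 := by
      rw [← norm_eq_zero]
      nlinarith [sq_nonneg ‖fderiv ℝ (fun w => (N w : E3)) z 1‖,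
        sq_nonneg ‖fderiv ℝ (fun w => (N w : E3)) z Complex.I‖]
    have h3 : fderiv ℝ (fun w => (N w : E3)) z Complex.I = 0 := by
      rw [← norm_eq_zero]
      nlinarith [sq_nonneg ‖fderiv ℝ (fun w => (N w : E3)) z 1‖,
        sq_nonneg ‖fderiv ℝ (fun w => (N w : E3)) z Complex.I‖]
    ext1 v
    have hv : v = v.re • (1 : ℂ) + v.im • Complex.I := by apply Complex.ext <;> simp
    rw [hv, map_add, map_smul, map_smul, h2, h3]
    simp
  filter_upwards [Metric.ball_mem_nhds a hr0] with w hw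
  exact Subtype.ext (Metric.isOpen_ball.is_const_of_fderiv_eq_zero
    (convex_ball a r).isPreconnected
    (fun z hz => (hd z (hVD (hr hz))).differentiableWithinAt) h0 hw (Metric.mem_ball_self hr0))

end Openness

/-- Points outside the closure of the region accumulate at each boundary point: otherwise `ρ` would
have a local maximum at `p` on a curve in the sphere through `p` in the direction `v`. -/
theorem HasC2Boundary.frequently_notMem_closure {Ω : Set S2} (hΩ : IsOpen Ω)
    (h : HasC2Boundary Ω) {p : S2} (hp : p ∈ frontier Ω) : ∃ᶠ x in 𝓝 p, x ∉ closure Ω := by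
  obtain ⟨ρ, hρ, ⟨v, hv, hdv⟩, hev⟩ := h p hp
  intro hcl
  simp only [not_not] at hcl
  have hpΩ : p ∉ Ω := by
    have := hp.2
    rwa [hΩ.interior_eq] at this
  have hρp : 0 ≤ ρ p := by
    have := hev.self_of_nhds
    exact not_lt.1 fun h => hpΩ (this.2 h)
  have hle : ∀ᶠ x : S2 in 𝓝 p, ρ x ≤ 0 := by
    have hc : ∀ᶠ x : S2 in 𝓝 p, ContinuousAt (fun y : S2 => ρ y) x := by
      have h1 : ∀ᶠ x : E3 in 𝓝 (p : E3), ContDiffAt ℝ 2 ρ x := hρ.eventually (by simp)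
      have h2 : ∀ᶠ x : S2 in 𝓝 p, ContDiffAt ℝ 2 ρ x :=
        continuous_subtype_val.continuousAt.eventually h1
      filter_upwards [h2] with x hx
      exact hx.continuousAt.comp (f := fun y : S2 => (y : E3)) continuous_subtype_val.continuousAt
    filter_upwards [hcl, hc, eventually_eventually_nhds.2 hev] with x hx1 hx2 hx3
    by_contra! hpos
    obtain ⟨y, hy1, hy2, hy3⟩ := ((mem_closure_iff_frequently.1 hx1).and_eventually
      (hx3.and (hx2.eventually (lt_mem_nhds hpos)))).exists
    exact absurd (hy2.1 hy1) (not_lt.2 hy3.le)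
  -- the normalised line `t ↦ p + t v`
  have hn (t : ℝ) : ‖(p : E3) + t • v‖ ^ 2 = 1 + t ^ 2 * ‖v‖ ^ 2 := by
    rw [norm_add_sq_real, inner_smul_right, real_inner_comm, hv, norm_smul, norm_eq_of_mem_sphere]
    rw [mul_pow, Real.norm_eq_abs, sq_abs]; ring
  have hne (t : ℝ) : (p : E3) + t • v ≠ 0 := by
    intro h0
    have := hn t
    rw [h0, norm_zero] at this
    nlinarith [sq_nonneg (t * ‖v‖)]
  let s : ℝ → ℝ := fun t => (Real.sqrt (1 + t ^ 2 * ‖v‖ ^ 2))⁻¹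
  have hs (t : ℝ) : s t = ‖(p : E3) + t • v‖⁻¹ := by
    simp only [s]
    rw [← hn, Real.sqrt_sq (norm_nonneg _)]
  let γ : ℝ → S2 := fun t => ⟨s t • ((p : E3) + t • v), by
    rw [mem_sphere_zero_iff_norm, norm_smul, hs, norm_inv, norm_norm,
      inv_mul_cancel₀ (norm_ne_zero_iff.2 (hne t))]⟩
  have hs0 : s 0 = 1 := by simp [s]
  have hds : HasDerivAt s 0 0 := by
    have h1 : HasDerivAt (fun t : ℝ => 1 + t ^ 2 * ‖v‖ ^ 2) 0 0 := by
      simpa using ((hasDerivAt_pow 2 (0 : ℝ)).mul_const (‖v‖ ^ 2)).const_add 1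
    have h2 := h1.sqrt (by simp)
    have h3 := h2.inv (by simp)
    rw [zero_div] at h3
    rw [neg_zero, zero_div] at h3
    exact h3
  have hdγ : HasDerivAt (fun t => (γ t : E3)) v 0 := by
    have h1 : HasDerivAt (fun t : ℝ => (p : E3) + t • v) v 0 := by
      simpa using ((hasDerivAt_id (0 : ℝ)).smul_const v).const_add (p : E3)
    have := hds.smul h1
    rw [hs0, one_smul, zero_smul, add_zero] at this
    exact this
  have hγ0 : γ 0 = p := Subtype.ext (by simp [γ, hs0])
  have hγc : ContinuousAt γ 0 := by
    rw [Topology.IsInducing.subtypeVal.continuousAt_iff]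
    exact hdγ.continuousAt
  have hmax : IsLocalMax (fun t => ρ (γ t)) 0 := by
    have h1 : ∀ᶠ t in 𝓝 (0 : ℝ), ρ (γ t) ≤ 0 := by
      rw [← hγ0] at hle
      exact hγc.eventually hle
    filter_upwards [h1] with t ht
    rw [hγ0]
    exact ht.trans hρp
  have hfd : HasFDerivAt ρ (fderiv ℝ ρ p) ((γ 0 : S2) : E3) := by
    rw [hγ0]
    exact (hρ.differentiableAt (by simp)).hasFDerivAt
  exact hdv (hmax.hasDerivAt_eq_zero (hfd.comp_hasDerivAt (0 : ℝ) hdγ))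

/-! ### Comparison of the least eigenvalues -/

section Comparison

variable {N : ℂ → S2} {D D₀ : Set ℂ} {Ω : Set S2} {R : E3 ≃ₗᵢ[ℝ] E3} {l : ℝ}

/-- A minimizing sequence on the projection of `Ω` pulls back to one on `D`. -/
theorem IsProperOver.exists_minimizing (hP : IsProperOver N D Ω) (hR : rot R north ∉ closure Ω)
    (hΩ : IsConnected Ω) (hpos : ∃ z ∈ D ∩ N ⁻¹' Ω, 0 < areaDensity N z) {ψ : ℕ → ℂ → ℝ}
    (hψ : ∀ k, IsTest (invStereoRot R ⁻¹' Ω) (ψ k)) (hψ0 : ∀ k z, 0 ≤ ψ k z)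
    (hm : ∀ k, mass (areaDensity (invStereoRot R)) (ψ k) = 1)
    (he : Tendsto (fun k => energy (ψ k)) atTop (𝓝 l)) :
    ∃ u : ℕ → ℂ → ℝ, (∀ k, IsTest (D ∩ N ⁻¹' Ω) (u k)) ∧ (∀ k z, 0 ≤ u k z) ∧
      (∀ k, mass (areaDensity N) (u k) = 1) ∧ Tendsto (fun k => energy (u k)) atTop (𝓝 l) := by
  obtain ⟨c, hc0, hc⟩ := hP.exists_energy_mass_pullback hR hΩ hpos
  have hs : (Real.sqrt c)⁻¹ ^ 2 * c = 1 := by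
    rw [inv_pow, Real.sq_sqrt hc0.le, inv_mul_cancel₀ hc0.ne']
  have hu (k : ℕ) := hP.isTest_pullback hR (hψ k)
  refine ⟨fun k z => (Real.sqrt c)⁻¹ * pullback N D Ω R (ψ k) z, fun k => (hu k).const_mul _,
    fun k z => mul_nonneg (by positivity) (Set.indicator_nonneg (fun w _ => hψ0 k _) z),
    fun k => ?_, ?_⟩
  · rw [mass_const_mul, (hc _ (hψ k)).2, hm, mul_one, hs]
  · refine he.congr fun k => ?_
    rw [energy_const_mul (hu k), (hc _ (hψ k)).1, ← mul_assoc, hs, one_mul]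

/-- If a minimizing sequence consists of nonnegative functions vanishing outside `D₀` and on a disc
in `D₀`, then so does the ground state obtained as its limit, contradicting the strong maximum
principle. -/
theorem not_le_energy_of_vanishing {w : ℂ → ℝ} (hDo : IsOpen D) (hDb : Bornology.IsBounded D)
    (hw : IsCompactWeight D w) (hl0 : 0 ≤ l) (hD₀ : IsOpen D₀) (hc : IsPreconnected D₀)
    (hsub : D₀ ⊆ D) {a : ℂ} {r : ℝ} (ha : a ∈ D₀) (hr : 0 < r) {u : ℕ → ℂ → ℝ}
    (hu : ∀ k, IsTest D₀ (u k)) (hu0 : ∀ k z, 0 ≤ u k z)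
    (hua : ∀ k, ∀ z ∈ Metric.ball a r, u k z = 0) (hm : ∀ k, mass w (u k) = 1)
    (he : Tendsto (fun k => energy (u k)) atTop (𝓝 l)) :
    ¬ ∀ v, IsTest D v → l * mass w v ≤ energy v := by
  intro hl
  have huD (k : ℕ) : IsTest D (u k) := (hu k).mono hsub
  obtain ⟨φ, -, U, G, hU, hne, heq, hlim⟩ := exists_eigenfunction_of_minimizing hDo hDb hw hl0 hl
    huD (by simp [hm]) he
  obtain ⟨χ, -, hae⟩ := exists_ae_tendsto_subseq (fun k => (huD (φ k)).memLp.restrict D) hU.1 hlim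
  have hDm := hDo.measurableSet
  have hae' := (ae_restrict_iff' hDm).1 hae
  have hU0 : ∀ᵐ z ∂volume.restrict D, 0 ≤ U z := by
    filter_upwards [hae] with z hz using ge_of_tendsto' hz fun k => hu0 _ z
  have hUz (z : ℂ) (hz : Tendsto (fun k => u (φ (χ k)) z) atTop (𝓝 (U z)))
      (h : ∀ k, u k z = 0) : U z = 0 := by
    simp only [h] at hz
    exact tendsto_nhds_unique hz tendsto_const_nhds
  obtain ⟨ρ, hρ0, hρ⟩ := Metric.isOpen_iff.1 (hD₀.inter Metric.isOpen_ball) a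
    ⟨ha, Metric.mem_ball_self hr⟩
  have hD₀U : ∀ᵐ z, z ∈ D₀ → U z = 0 := by
    refine ae_eq_zero_of_supersolution hD₀ hc hsub hDm hU.1 hU0 (fun v hv hv0 => ?_) ha hρ0 ?_
    · have h1 := hU.integral_inner_gradient (hv.mono hsub)
      rw [heq v (hv.mono hsub)] at h1
      have h2 : 0 ≤ ∫ z in D, w z * U z * v z := by
        refine integral_nonneg_of_ae ?_
        filter_upwards [hU0, ae_restrict_mem hDm] with z hz hzD
        exact mul_nonneg (mul_nonneg (hw.2.1 z hzD) hz) (hv0 z)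
      linarith [mul_nonneg hl0 h2]
    · filter_upwards [hae'] with z hz hza
      exact hUz z (hz (hsub (hρ hza).1)) fun k => hua k z (hρ hza).2
  refine hne ((ae_restrict_iff' hDm).2 ?_)
  filter_upwards [hD₀U, hae'] with z hz hz' hzD
  by_cases h : z ∈ D₀
  · exact hz h
  · exact hUz z (hz' hzD) fun k => (hu k).eq_zero h

theorem frontier_connectedComponentIn_subset {a : ℂ} (hD : IsOpen D) (ha : a ∈ D) :
    frontier (connectedComponentIn D a) ⊆ frontier D := by
  rintro z ⟨hz, hz'⟩
  refine ⟨closure_mono (connectedComponentIn_subset D a) hz, fun hzD => hz' ?_⟩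
  rw [hD.interior_eq] at hzD
  rw [hD.connectedComponentIn.interior_eq]
  have hpc : IsPreconnected (insert z (connectedComponentIn D a)) :=
    isPreconnected_connectedComponentIn.subset_closure (Set.subset_insert _ _)
      (Set.insert_subset hz subset_closure)
  exact hpc.subset_connectedComponentIn (Or.inr (mem_connectedComponentIn ha))
    (Set.insert_subset hzD (connectedComponentIn_subset D a)) (Or.inl rfl)

/-- The comparison of least eigenvalues. The last conjunct records that the least eigenvalue of the
region of the sphere is a lower bound of its Rayleigh quotients. -/
theorem exists_isLeastEigenvalue_le (hDo : IsOpen D) (hDb : Bornology.IsBounded D)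
    (hN : IsConformalMap N D) (hNc : ContinuousOn N (closure D)) (hΩo : IsOpen Ω)
    (hΩc : IsConnected Ω) (hC2 : HasC2Boundary Ω) (hsub : Ω ⊆ N '' D)
    (hfr : (N '' frontier D) ∩ Ω = ∅) (hR : rot R north ∉ closure Ω) :
    ∃ lD lΩ : ℝ, IsLeastEigenvalue N D lD ∧ IsLeastEigenvalueSphere R Ω lΩ ∧ lD ≤ lΩ ∧
      ((N ⁻¹' frontier Ω ∩ D).Nonempty → lD < lΩ) ∧
      ∀ u, IsTest (invStereoRot R ⁻¹' Ω) u →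
        lΩ * mass (areaDensity (invStereoRot R)) u ≤ energy u := by
  obtain ⟨hUo, hUb, hUne, -⟩ := preimage_invStereoRot hΩo hΩc hR
  have hwU := isCompactWeight_invStereoRot R _ hUo
  have hharm (z : ℂ) (hz : z ∈ D) := hN.isConformalHarmonicAt hDo hz
  have hwD := isCompactWeight_areaDensity hDo hDb hharm hNc
  obtain ⟨x, hx⟩ := hΩc.nonempty
  obtain ⟨z, hz, rfl⟩ := hsub hx
  have hP := IsProperOver.of_frontier hDo hDb hΩo hharm hNc hfr
  have hpos := hN.exists_areaDensity_pos hDo hP.isOpen_inter Set.inter_subset_left ⟨z, hz, hx⟩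
  obtain ⟨lD, hlD0, hlD, f, hf, -, hfm, hfe⟩ := exists_bottom hDo hDb hwD
    (hpos.imp fun y hy => ⟨hy.1.1, hy.2⟩)
  obtain ⟨lΩ, hlΩ0, hlΩ, ψ, hψ, hψ0, hψm, hψe⟩ := exists_bottom hUo hUb hwU
    (hUne.imp fun y hy => ⟨hy, by rw [areaDensity_invStereoRot]; positivity⟩)
  refine ⟨lD, lΩ, isLeast_isWeightedEigenvalue hDo hDb hwD hlD0 hlD hf hfm hfe,
    isLeast_isWeightedEigenvalue hUo hUb hwU hlΩ0 hlΩ hψ hψm hψe, ?_, ?_, hlΩ⟩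
  · obtain ⟨u, hu, -, hum, hue⟩ := hP.exists_minimizing hR hΩc hpos hψ hψ0 hψm hψe
    refine ge_of_tendsto' hue fun k => ?_
    have := hlD _ ((hu k).mono Set.inter_subset_left)
    rwa [hum, mul_one] at this
  · rintro ⟨a, haΩ, ha⟩
    set D₀ := connectedComponentIn D a with hD₀
    have hD₀o : IsOpen D₀ := hDo.connectedComponentIn
    have hD₀D : D₀ ⊆ D := connectedComponentIn_subset D a
    have haD₀ : a ∈ D₀ := mem_connectedComponentIn ha
    have hmap := hN.nhds_le_map hDo ha
    have hnear {p : S2 → Prop} (h : ∃ᶠ x in 𝓝 (N a), p x) : ∃ b ∈ D₀, p (N b) := by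
      have h1 : ∃ᶠ b in 𝓝 a, p (N b) := h.filter_mono hmap
      obtain ⟨b, hb, hb'⟩ := (h1.and_eventually (hD₀o.mem_nhds haD₀)).exists
      exact ⟨b, hb', hb⟩
    obtain ⟨b, hb, hbΩ⟩ := hnear (mem_closure_iff_frequently.1 haΩ.1)
    obtain ⟨e, he, heΩ⟩ := hnear (hC2.frequently_notMem_closure hΩo haΩ)
    have hP₀ : IsProperOver N D₀ Ω := IsProperOver.of_frontier hD₀o (hDb.subset hD₀D) hΩo
      (fun z hz => hharm z (hD₀D hz)) (hNc.mono (closure_mono hD₀D))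
      (Set.subset_eq_empty (Set.inter_subset_inter_left _
        (Set.image_mono (frontier_connectedComponentIn_subset hDo ha))) hfr)
    have hpos₀ := hN.exists_areaDensity_pos hDo hP₀.isOpen_inter
      (Set.inter_subset_left.trans hD₀D) ⟨b, hb, hbΩ⟩
    obtain ⟨u, hu, hu0, hum, hue⟩ := hP₀.exists_minimizing hR hΩc hpos₀ hψ hψ0 hψm hψe
    obtain ⟨r, hr0, hr⟩ := Metric.isOpen_iff.1
      (hP₀.continuousOn.isOpen_inter_preimage hD₀o isClosed_closure.isOpen_compl) e ⟨he, heΩ⟩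
    -- if `lΩ ≤ lD`, then `lΩ` is a lower bound of the Rayleigh quotients on `D` as well
    by_contra! hle
    refine not_le_energy_of_vanishing hDo hDb hwD hlΩ0.le hD₀o
      isPreconnected_connectedComponentIn hD₀D he hr0 (fun k => (hu k).mono Set.inter_subset_left)
      hu0 (fun k z hz => (hu k).eq_zero fun h => (hr hz).2 (subset_closure h.2)) hum hue
      fun v hv => ?_
    exact (mul_le_mul_of_nonneg_right hle (mass_nonneg hwD.2.1 hv)).trans (hlD v hv)

end Comparison

/-! ### The hemisphere -/

section Hemisphere

variable {c : S2} {R : E3 ≃ₗᵢ[ℝ] E3}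

theorem inner_self_sphere (c : S2) : (inner ℝ (c : E3) (c : E3) : ℝ) = 1 := by
  rw [real_inner_self_eq_norm_sq, norm_eq_of_mem_sphere, one_pow]

theorem isOpen_hemisphere (c : S2) : IsOpen (hemisphere c) :=
  isOpen_lt continuous_const (by fun_prop)

theorem closure_hemisphere_subset (c : S2) :
    closure (hemisphere c) ⊆ {x : S2 | 0 ≤ (inner ℝ (c : E3) (x : E3) : ℝ)} :=
  closure_minimal (fun _ hx => (show (0 : ℝ) < _ from hx).le) (isClosed_le continuous_const (by fun_prop))

/-- The hemisphere is the radial projection of a half-space. -/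
theorem isConnected_hemisphere (c : S2) : IsConnected (hemisphere c) := by
  have hc : c ∈ hemisphere c := by
    rw [hemisphere, Set.mem_ofPred_eq, inner_self_sphere]; exact one_pos
  refine ⟨⟨c, hc⟩, ?_⟩
  have hS : IsPreconnected {x : E3 | 0 < (inner ℝ (c : E3) x : ℝ)} :=
    (convex_halfSpace_gt (innerSL ℝ (c : E3)).isBoundedLinearMap.toIsLinearMap 0).isPreconnected
  have hne {x : E3} (hx : 0 < (inner ℝ (c : E3) x : ℝ)) : x ≠ 0 := by
    rintro rfl
    simp at hx
  have him : ((↑) : S2 → E3) '' hemisphere c =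
      (fun x : E3 => ‖x‖⁻¹ • x) '' {x : E3 | 0 < (inner ℝ (c : E3) x : ℝ)} := by
    ext y
    constructor
    · rintro ⟨x, hx, rfl⟩
      exact ⟨x, hx, by simp [norm_eq_of_mem_sphere]⟩
    · rintro ⟨x, hx, rfl⟩
      have h0 := norm_pos_iff.2 (hne hx)
      refine ⟨⟨‖x‖⁻¹ • x, ?_⟩, ?_, rfl⟩
      · rw [mem_sphere_zero_iff_norm, norm_smul, norm_inv, norm_norm, inv_mul_cancel₀ h0.ne']
      · rw [hemisphere, Set.mem_ofPred_eq, inner_smul_right]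
        exact mul_pos (inv_pos.2 h0) hx
  rw [← Topology.IsInducing.subtypeVal.isPreconnected_image, him]
  refine hS.image _ fun x hx => ContinuousAt.continuousWithinAt ?_
  exact (continuousAt_id.norm.inv₀ (norm_ne_zero_iff.2 (hne hx))).smul continuousAt_id

theorem hasC2Boundary_hemisphere (c : S2) : HasC2Boundary (hemisphere c) := by
  intro p hp
  have hp0 : (inner ℝ (c : E3) (p : E3) : ℝ) = 0 := by
    refine le_antisymm (not_lt.1 fun h => hp.2 ?_) (closure_hemisphere_subset c hp.1)
    rw [(isOpen_hemisphere c).interior_eq]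
    exact h
  refine ⟨fun x => (-innerSL ℝ (c : E3)) x, (-innerSL ℝ (c : E3)).contDiff.contDiffAt,
    ⟨c, hp0, ?_⟩, Eventually.of_forall fun x => ?_⟩
  · rw [ContinuousLinearMap.fderiv]
    simp
  · simp [hemisphere]

theorem exists_rot_north_notMem_closure (c : S2) :
    ∃ R : E3 ≃ₗᵢ[ℝ] E3, rot R north ∉ closure (hemisphere c) := by
  have hn : ‖(north : E3)‖ = ‖-(c : E3)‖ := by
    rw [norm_neg, norm_eq_of_mem_sphere, norm_eq_of_mem_sphere]
  -- the reflection which maps the north pole to `-c`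
  refine ⟨Submodule.reflection (Submodule.span ℝ {(north : E3) - -(c : E3)})ᗮ, fun h => ?_⟩
  have h1 := closure_hemisphere_subset c h
  simp only [rot, Set.mem_ofPred_eq, Submodule.reflection_sub hn, inner_neg_right,
    inner_self_sphere] at h1
  linarith

/-- Smooth approximations `θ k` of the positive part that vanish in a neighbourhood of the negative
half-line, with derivatives `θ' k`. -/
theorem exists_smooth_posPart : ∃ (θ θ' : ℕ → ℝ → ℝ) (C : ℝ),
    (∀ k, ContDiff ℝ ∞ (θ k)) ∧ (∀ k s, HasDerivAt (θ k) (θ' k s) s) ∧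
    (∀ k, Continuous (θ' k)) ∧ (∀ k, ∃ δ > 0, ∀ s < δ, θ k s = 0 ∧ θ' k s = 0) ∧
    (∀ k s, |θ k s| ≤ |s|) ∧ (∀ k s, |θ' k s| ≤ C) ∧
    (∀ s > 0, Tendsto (fun k => θ k s) atTop (𝓝 s)) ∧
    ∀ s > 0, Tendsto (fun k => θ' k s) atTop (𝓝 1) := by
  -- `T` is a smooth function with `T x = 0` for `x ≤ 0` and `T x = x + 1` for `x ≥ 1`, to be rescaled
  let T : ℝ → ℝ := fun x => (x + 1) * Real.smoothTransition x
  have hT : ContDiff ℝ ∞ T := (contDiff_id.add contDiff_const).mul Real.smoothTransition.contDiff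
  have hdT : Continuous (deriv T) := hT.continuous_deriv (by simp)
  have hT0 {x : ℝ} (hx : x < 0) : T x = 0 := by
    simp [T, Real.smoothTransition.zero_of_nonpos hx.le]
  have hT1 {x : ℝ} (hx : 1 < x) : T x = x + 1 := by
    simp [T, Real.smoothTransition.one_of_one_le hx.le]
  have hd0 {x : ℝ} (hx : x < 0) : deriv T x = 0 := by
    have : T =ᶠ[𝓝 x] fun _ => 0 := by
      filter_upwards [gt_mem_nhds hx] with y hy using hT0 hy
    rw [this.deriv_eq, deriv_const]
  have hd1 {x : ℝ} (hx : 1 < x) : deriv T x = 1 := by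
    have : T =ᶠ[𝓝 x] fun y => y + 1 := by
      filter_upwards [lt_mem_nhds hx] with y hy using hT1 hy
    rw [this.deriv_eq]
    simp
  obtain ⟨C, hC⟩ := (isCompact_Icc (a := (0 : ℝ)) (b := 1)).exists_bound_of_continuousOn
    hdT.continuousOn
  have hk (k : ℕ) : (0 : ℝ) < k + 1 := by positivity
  have hlarge {s : ℝ} (hs : 0 < s) : ∀ᶠ k : ℕ in atTop, 1 < ((k : ℝ) + 1) * s - 1 := by
    obtain ⟨n, hn⟩ := exists_nat_gt (2 / s)
    filter_upwards [eventually_ge_atTop n] with k hk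
    have h1 : (n : ℝ) ≤ k := by exact_mod_cast hk
    have h2 : 2 < n * s := (div_lt_iff₀ hs).1 hn
    nlinarith
  refine ⟨fun k s => ((k : ℝ) + 1)⁻¹ * T (((k : ℝ) + 1) * s - 1),
    fun k s => deriv T (((k : ℝ) + 1) * s - 1), max C 1, fun k => ?_, fun k s => ?_, fun k => ?_,
    fun k => ⟨((k : ℝ) + 1)⁻¹, inv_pos.2 (hk k), fun s hs => ?_⟩, fun k s => ?_, fun k s => ?_,
    fun s hs => ?_, fun s hs => ?_⟩
  · exact contDiff_const.mul (hT.comp ((contDiff_const.mul contDiff_id).sub contDiff_const))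
  · have h1 : HasDerivAt (fun s : ℝ => ((k : ℝ) + 1) * s - 1) ((k : ℝ) + 1) s := by
      simpa using ((hasDerivAt_id s).const_mul ((k : ℝ) + 1)).sub_const 1
    have h2 := (((hT.differentiable (by simp) _).hasDerivAt.comp s h1).const_mul ((k : ℝ) + 1)⁻¹)
    have e : ((k : ℝ) + 1)⁻¹ * (deriv T (((k : ℝ) + 1) * s - 1) * ((k : ℝ) + 1)) =
        deriv T (((k : ℝ) + 1) * s - 1) := by
      have := (hk k).ne'
      field_simp
    rw [e] at h2
    exact h2
  · exact hdT.comp (by fun_prop)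
  · have h1 : ((k : ℝ) + 1) * s - 1 < 0 := by
      have := mul_lt_mul_of_pos_left hs (hk k)
      rw [mul_inv_cancel₀ (hk k).ne'] at this
      linarith
    exact ⟨by simp only [hT0 h1, mul_zero], hd0 h1⟩
  · have e : ((k : ℝ) + 1)⁻¹ * T (((k : ℝ) + 1) * s - 1) =
        s * Real.smoothTransition (((k : ℝ) + 1) * s - 1) := by
      have := (hk k).ne'
      simp only [T]
      field_simp
      ring
    simp only [e]
    rw [abs_mul, abs_of_nonneg (Real.smoothTransition.nonneg _)]
    exact mul_le_of_le_one_right (abs_nonneg s) (Real.smoothTransition.le_one _)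
  · change |deriv T (((k : ℝ) + 1) * s - 1)| ≤ _
    set x := ((k : ℝ) + 1) * s - 1
    rcases lt_or_ge x 0 with hx | hx
    · simp [hd0 hx]
    rcases lt_or_ge 1 x with hx' | hx'
    · simp [hd1 hx']
    · exact (hC x ⟨hx, hx'⟩).trans (le_max_left _ _)
  · refine tendsto_const_nhds.congr' ?_
    filter_upwards [hlarge hs] with k hk'
    have := (hk k).ne'
    rw [hT1 hk']
    field_simp
    ring
  · refine tendsto_const_nhds.congr' ?_
    filter_upwards [hlarge hs] with k hk'
    rw [hd1 hk']

/-- Dominated convergence for integrands `h k ∘ f` where `f` is positive. -/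
theorem tendsto_setIntegral_comp_mul {U : Set ℂ} (hU : MeasurableSet U) (hUf : volume U ≠ ⊤)
    {f q : ℂ → ℝ} (hf : Continuous f) (hf0 : ∀ z ∈ U, 0 < f z) (hq : Continuous q) {B C : ℝ}
    (hB : ∀ z ∈ U, |q z| ≤ B) {h : ℕ → ℝ → ℝ} {g : ℝ → ℝ} (hh : ∀ k, Continuous (h k))
    (hC : ∀ k, ∀ z ∈ U, |h k (f z)| ≤ C)
    (hlim : ∀ s > 0, Tendsto (fun k => h k s) atTop (𝓝 (g s))) :
    Tendsto (fun k => ∫ z in U, h k (f z) * q z) atTop (𝓝 (∫ z in U, g (f z) * q z)) := by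
  refine tendsto_integral_of_dominated_convergence (fun _ => C * B)
    (fun k => (((hh k).comp hf).mul hq).aestronglyMeasurable) (integrableOn_const hUf)
    (fun k => ?_) ?_
  · filter_upwards [ae_restrict_mem hU] with z hz
    rw [norm_mul]
    exact mul_le_mul (hC k z hz) (hB z hz) (norm_nonneg _) ((abs_nonneg _).trans (hC k z hz))
  · filter_upwards [ae_restrict_mem hU] with z hz
    exact (hlim _ (hf0 z hz)).mul_const _

/-- The coordinate of the sphere in the direction `c` is an eigenfunction of the hemisphere centred
at `c` with eigenvalue `2`, so the Rayleigh quotients of its truncations tend to `2`. -/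
theorem le_two_of_rayleigh_hemisphere (hR : rot R north ∉ closure (hemisphere c)) {l : ℝ}
    (hl : ∀ u, IsTest (invStereoRot R ⁻¹' hemisphere c) u →
      l * mass (areaDensity (invStereoRot R)) u ≤ energy u) : l ≤ 2 := by
  obtain ⟨hUo, hUb, hUc⟩ :=
    preimage_invStereoRot (isOpen_hemisphere c) (isConnected_hemisphere c) hR
  set U := invStereoRot R ⁻¹' hemisphere c with hU
  set w := areaDensity (invStereoRot R) with hw
  set f := coord (invStereoRot R) c with hf
  have hwz (z : ℂ) : w z = 4 * ((1 + ‖z‖ ^ 2)⁻¹) ^ 2 := areaDensity_invStereoRot R z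
  have hwc : Continuous w := by
    rw [show w = fun z => 4 * ((1 + ‖z‖ ^ 2)⁻¹) ^ 2 from funext hwz]
    exact continuous_const.mul (((continuous_const.add (continuous_norm.pow 2)).inv₀
      fun z => (by positivity : (1 + ‖z‖ ^ 2 : ℝ) ≠ 0)).pow 2)
  have hw0 (z : ℂ) : 0 < w z := by rw [hwz]; positivity
  have hw4 (z : ℂ) : |w z| ≤ 4 := by
    rw [abs_of_pos (hw0 z), hwz]
    have h2 : (1 + ‖z‖ ^ 2)⁻¹ ≤ 1 := inv_le_one_of_one_le₀ (by nlinarith [norm_nonneg z])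
    have h3 : ((1 + ‖z‖ ^ 2)⁻¹) ^ 2 ≤ 1 := pow_le_one₀ (by positivity) h2
    linarith
  have hharm (z : ℂ) : IsConformalHarmonicAt (invStereoRot R) (w z) z := by
    rw [hwz]; exact isConformalHarmonicAt_invStereoRot R z
  have hfC : ContDiff ℝ ∞ f := contDiff_iff_contDiffAt.2 fun z => (hharm z).1 c
  have hfd (z : ℂ) : DifferentiableAt ℝ f z := hfC.differentiable (by simp) z
  have hfg (z : ℂ) : gradDot f f z = w z * (1 - f z ^ 2) := by
    rw [(hharm z).2.1, inner_self_sphere, pow_two]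
  have hf1 (z : ℂ) : |f z| ≤ 1 := by
    have := abs_real_inner_le_norm (c : E3) (invStereoRot R z : E3)
    rwa [norm_eq_of_mem_sphere, norm_eq_of_mem_sphere, one_mul] at this
  have hgc : Continuous (gradDot f f) := by
    rw [show gradDot f f = fun z => w z * (1 - f z ^ 2) from funext hfg]
    exact hwc.mul (continuous_const.sub (hfC.continuous.pow 2))
  have hg4 (z : ℂ) : |gradDot f f z| ≤ 4 := by
    rw [abs_of_nonneg (gradDot_self_nonneg f z), hfg]
    have := hw4 z
    rw [abs_of_pos (hw0 z)] at this
    nlinarith [hw0 z, sq_nonneg (f z)]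
  have hfU (z : ℂ) : z ∈ U ↔ 0 < f z := Iff.rfl
  have hUm := hUo.measurableSet
  have hUf : volume U ≠ ⊤ := hUb.measure_lt_top.ne
  obtain ⟨θ, θ', C, hθ, hθd, hθc, hδ, hθs, hθC, hθl, hθl'⟩ := exists_smooth_posPart
  have hθ0 (k : ℕ) {z : ℂ} (hz : z ∉ U) : θ k (f z) = 0 ∧ θ' k (f z) = 0 := by
    obtain ⟨δ, hδ0, h⟩ := hδ k
    exact h _ ((not_lt.1 fun h => hz ((hfU z).2 h)).trans_lt hδ0)
  have hu (k : ℕ) : IsTest U fun z => θ k (f z) := by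
    obtain ⟨δ, hδ0, h⟩ := hδ k
    have hcl : tsupport (fun z => θ k (f z)) ⊆ {z | δ ≤ f z} := by
      refine closure_minimal (fun z hz => ?_) (isClosed_le continuous_const hfC.continuous)
      exact not_lt.1 fun hlt => hz (h _ hlt).1
    have hsub : tsupport (fun z => θ k (f z)) ⊆ U := fun z hz =>
      (hfU z).2 (hδ0.trans_le (hcl hz))
    exact ⟨(hθ k).comp hfC, Metric.isCompact_of_isClosed_isBounded (isClosed_tsupport _)
      (hUb.subset hsub), hsub⟩
  have hpd (k : ℕ) (v z : ℂ) : pd v (fun z => θ k (f z)) z = θ' k (f z) * pd v f z :=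
    pd_comp_real (hθd k _) (hfd z)
  have hθ1 (k : ℕ) (z : ℂ) : |θ k (f z)| ≤ 1 := (hθs k _).trans (hf1 z)
  have hmass (k : ℕ) : mass w (fun z => θ k (f z)) = ∫ z in U, θ k (f z) ^ 2 * w z := by
    rw [setIntegral_eq_integral_of_forall_compl_eq_zero fun z hz => by simp [(hθ0 k hz).1], mass]
    simp only [mul_comm]
  have henergy (k : ℕ) : energy (fun z => θ k (f z)) =
      ∫ z in U, θ' k (f z) ^ 2 * gradDot f f z := by
    rw [setIntegral_eq_integral_of_forall_compl_eq_zero fun z hz => by simp [(hθ0 k hz).2], energy]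
    congr 1
    funext z
    simp only [gradDot, hpd]
    ring
  -- Green's formula for `θ k ∘ f` and `f`
  have hgreen (k : ℕ) : ∫ z in U, θ' k (f z) * gradDot f f z =
      2 * ∫ z in U, θ k (f z) * f z * w z := by
    rw [setIntegral_eq_integral_of_forall_compl_eq_zero fun z hz => by simp [(hθ0 k hz).2],
      setIntegral_eq_integral_of_forall_compl_eq_zero fun z hz => by simp [(hθ0 k hz).1]]
    have h := integral_gradDot_eq_neg_integral_mul_lap (hu k).1 (hu k).2.1 (F := f)
      fun z _ => contDiffAt_two ((hharm z).1 c)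
    rw [← integral_neg] at h
    rw [← integral_const_mul]
    have e1 (z : ℂ) : θ' k (f z) * gradDot f f z = gradDot (fun z => θ k (f z)) f z := by
      simp only [gradDot, hpd]
      ring
    have e2 (z : ℂ) : 2 * (θ k (f z) * f z * w z) = -(θ k (f z) * lap f z) := by
      rw [(hharm z).2.2]
      ring
    simp only [e1, e2]
    exact h
  have lE := tendsto_setIntegral_comp_mul hUm hUf hfC.continuous (fun z hz => (hfU z).1 hz) hgc
    (fun z _ => hg4 z) (h := fun k s => θ' k s ^ 2) (fun k => (hθc k).pow 2) (C := C ^ 2)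
    (fun k z _ => by rw [abs_pow]; exact pow_le_pow_left₀ (abs_nonneg _) (hθC k _) 2)
    (g := fun _ => 1 ^ 2) fun s hs => (hθl' s hs).pow 2
  have lE' := tendsto_setIntegral_comp_mul hUm hUf hfC.continuous (fun z hz => (hfU z).1 hz) hgc
    (fun z _ => hg4 z) (h := θ') hθc (fun k z _ => hθC k _) (g := fun _ => 1) hθl'
  have lM := tendsto_setIntegral_comp_mul hUm hUf hfC.continuous (fun z hz => (hfU z).1 hz) hwc
    (fun z _ => hw4 z) (h := fun k s => θ k s ^ 2) (fun k => (hθ k).continuous.pow 2) (C := 1)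
    (fun k z _ => by rw [abs_pow]; exact pow_le_one₀ (abs_nonneg _) (hθ1 k z))
    (g := fun s => s ^ 2) fun s hs => (hθl s hs).pow 2
  have lM' := tendsto_setIntegral_comp_mul hUm hUf hfC.continuous (fun z hz => (hfU z).1 hz) hwc
    (fun z _ => hw4 z) (h := fun k s => θ k s * s) (fun k => (hθ k).continuous.mul continuous_id)
    (C := 1) (fun k z _ => by
      rw [abs_mul]; exact mul_le_one₀ (hθ1 k z) (abs_nonneg _) (hf1 z))
    (g := fun s => s * s) fun s hs => (hθl s hs).mul_const s
  simp only [hgreen] at lE'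
  simp only [one_pow] at lE
  have hEM := tendsto_nhds_unique lE' (lM'.const_mul 2)
  simp only [← pow_two] at hEM
  rw [hEM] at lE
  have hle := le_of_tendsto_of_tendsto' (lM.const_mul l) lE fun k => by
    rw [← hmass, ← henergy]; exact hl _ (hu k)
  have hpos : 0 < ∫ z in U, f z ^ 2 * w z := by
    have hint : IntegrableOn (fun z => f z ^ 2 * w z) U :=
      ((hfC.continuous.pow 2).mul hwc).locallyIntegrable.integrableOn_isCompact
        hUb.isCompact_closure |>.mono_set subset_closure
    rw [setIntegral_pos_iff_support_of_nonneg_ae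
      (Eventually.of_forall fun z => mul_nonneg (sq_nonneg _) (hw0 z).le) hint]
    refine (hUo.measure_pos volume hUc.nonempty).trans_le (measure_mono fun z hz => ⟨?_, hz⟩)
    exact (mul_pos (pow_pos ((hfU z).1 hz) 2) (hw0 z)).ne'
  exact le_of_mul_le_mul_right hle hpos

end Hemisphere

end SphereEigen

theorem lemma2 (N : ℂ → SphereEigen.S2) (D : Set ℂ) (hDo : IsOpen D)
    (hDb : Bornology.IsBounded D) (hN : SphereEigen.IsConformalMap N D)
    (hNc : ContinuousOn N (closure D)) :
    (∀ Ω : Set SphereEigen.S2, IsOpen Ω → IsConnected Ω → SphereEigen.HasC2Boundary Ω →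
      Ω ⊆ N '' D → (N '' frontier D) ∩ Ω = ∅ →
      ∀ R : SphereEigen.E3 ≃ₗᵢ[ℝ] SphereEigen.E3,
        SphereEigen.rot R SphereEigen.north ∉ closure Ω →
        ∃ lD lΩ : ℝ, SphereEigen.IsLeastEigenvalue N D lD ∧
          SphereEigen.IsLeastEigenvalueSphere R Ω lΩ ∧
          lD ≤ lΩ ∧
          ((N ⁻¹' frontier Ω ∩ D).Nonempty → lD < lΩ)) ∧
    (∀ c : SphereEigen.S2, SphereEigen.hemisphere c ⊆ N '' D →
      (N '' frontier D) ∩ SphereEigen.hemisphere c = ∅ →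
      (N ⁻¹' frontier (SphereEigen.hemisphere c) ∩ D).Nonempty →
      ∃ lD : ℝ, SphereEigen.IsLeastEigenvalue N D lD ∧ lD < 2) := by
  refine ⟨fun Ω hΩo hΩc hC2 hsub hfr R hR => ?_, fun c hsub hfr hne => ?_⟩
  · obtain ⟨lD, lΩ, h1, h2, h3, h4, -⟩ :=
      SphereEigen.exists_isLeastEigenvalue_le hDo hDb hN hNc hΩo hΩc hC2 hsub hfr hR
    exact ⟨lD, lΩ, h1, h2, h3, h4⟩
  · obtain ⟨R, hR⟩ := SphereEigen.exists_rot_north_notMem_closure c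
    obtain ⟨lD, lΩ, h1, -, -, h4, h5⟩ :=
      SphereEigen.exists_isLeastEigenvalue_le hDo hDb hN hNc (SphereEigen.isOpen_hemisphere c)
        (SphereEigen.isConnected_hemisphere c) (SphereEigen.hasC2Boundary_hemisphere c) hsub hfr hR
    exact ⟨lD, h1, (h4 hne).trans_le (SphereEigen.le_two_of_rayleigh_hemisphere hR h5)⟩
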